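/- Notation. $\lg=\log_2$. A $(g,b)$-factored vector $v$ consists of $g$ sets $v[1],\dots,v[g]\subseteq\{0,1\}^b$. Fix an integer $k\ge 2$ and positive integers $g=g(n)=o(\lg n/\lg\lg n)$ and $b=b(n)=o(\lg n)$. For $f=f_n:(\{0,1\}^{b})^k\to\{0,1\}$, the problem $\#\mathrm{F}k\text{-}f$ is: given $k$ lists $V_1,\dots,V_k$ of $n$ $(g,b)$-factored vectors each (each set given by its characteristic bit vector of length $2^b$), compute $$\sum_{v_1\in V_1,\dots,v_k\in V_k}\ \prod_{i=1}^{g}\ \sum_{w_1\in v_1[i],\dots,w_k\in v_k[i]} f(w_1,\dots,w_k).$$ For $0<\mu<1$, average-case $\#\mathrm{F}k\text{-}f^{\mu}$ is this problem on random inputs in which every string of $\{0,1\}^b$ is put into every set $v[i]$ of every factored vector $v$ independently with probability $\mu$. Average-case $\#\mathrm{F}k\text{-}f$ is the case $\mu=1/2$. Time is measured on a probabilistic random access machine with logarithmic cost, which can draw uniformly random integers from $\{0,\dots,m\}$ and flip coins with biases from a fixed set $C$. "Solvable in time $T(n)$ with probability $p(n)$ on average" means that some program halts within time $T(n)$ on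 every input with parameter $n$ and every outcome of its random choices, for all large $n$, and that its output is correct with probability at least $p(n)$ over the random input and its random choices. "Worst-case solvable in time $\tilde O(T(n))$" means that some program halts within time $T'(n)$ on every input and every outcome of its random choices, for all large $n$, where $T'(n)=O(n^{\varepsilon}T(n))$ for every $\varepsilon>0$, and that on every input its output is correct with probability at least $1-2^{-\lg^2 n}$. Theorem. Let $T:\mathbb N\to\mathbb N$ satisfy $T(n)\ge n$ for all large $n$. (1) Let $\mu$ be a constant with $0<\mu<1$ that is rational or belongs to $C$, and let $f=(f_n)$ be arbitrary. If average-case $\#\mathrm{F}k\text{-}f^{\mu}$ can be solved in time $T(n)$ with probability at least $$1-\frac{1}{(\lg n)^{kg}\,(\lg\lg n)^{kg}},$$ then worst-case $\#\mathrm{F}k\text{-}f$ can be solved in time $\tilde O(T(n))$. (2) For $\mu=1/2$ the average-case distribution is the uniform distribution on all inputs. (3) In particular, if average-case $\#\mathrm{F}k\text{-OV}$ (respectively $\#\mathrm{F}k\text{-SUM}$, $\#\mathrm{F}k\text{-XOR}$) can be solved in time $T(n)$ with probability at least $1-1/((\lg n)^{kg}(\lg\lg n)^{kg})$, then worst-case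 $\#\mathrm{F}k\text{-OV}$ (respectively $\#\mathrm{F}k\text{-SUM}$, $\#\mathrm{F}k\text{-XOR}$) can be solved in time $\tilde O(T(n))$. Here $f(w_1,\dots,w_k)=1$ iff, respectively: $\sum_a\prod_j w_j[a]=0$; the $w_j$, read as $b$-bit two's complement integers, sum to $0$ (or, in the variant of the problem, the first $k-1$ of the $w_j$, read as unsigned integers, sum to the last one); $w_1\oplus\dots\oplus w_k=\vec 0$. -/

import Mathlib

open Filter Asymptotics

namespace FactoredAvg

/-! ### Factored problems -/

/-- A `(g,b)`-factored vector: `g` subsets of `{0,1}^b`. -/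
abbrev FactoredVector (g b : ℕ) : Type := Fin g → Finset (Fin b → Bool)

/-- An input: `k` lists of `n` factored vectors each. -/
abbrev Inst (k n g b : ℕ) : Type := Fin k → Fin n → FactoredVector g b

/-- `∘_f (Z₁,…,Z_k)`: the number of tuples `(w₁,…,w_k)`, `w_j ∈ Z_j`, accepted by `f`. -/
def circ {k b : ℕ} (f : (Fin k → Fin b → Bool) → Bool) (Z : Fin k → Finset (Fin b → Bool)) : ℕ :=
  ∑ w ∈ Fintype.piFinset Z, if f w = true then 1 else 0

/-- `⊚_f (v₁,…,v_k) = ∏ᵢ ∘_f (v₁[i],…,v_k[i])`. -/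
def bigCirc {k g b : ℕ} (f : (Fin k → Fin b → Bool) → Bool) (v : Fin k → FactoredVector g b) : ℕ :=
  ∏ i : Fin g, circ f (fun j => v j i)

/-- The value asked for by `#Fk-f`: the sum of `⊚_f (v₁,…,v_k)` over all choices of one entry
`v_j` from each of the `k` lists. -/
def count {k n g b : ℕ} (f : (Fin k → Fin b → Bool) → Bool) (I : Inst k n g b) : ℕ :=
  ∑ c : Fin k → Fin n, bigCirc f (fun j => I j (c j))

/-- `k`-OV: `∑_a ∏_j w_j[a] = 0`. -/
def orthogonalTuple (k b : ℕ) (w : Fin k → Fin b → Bool) : Bool :=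
  decide (∑ a : Fin b, ∏ j : Fin k, (w j a).toNat = 0)

/-- `k`-XOR: the componentwise parity of the `k` vectors is the zero vector. -/
def zeroXor (k b : ℕ) (w : Fin k → Fin b → Bool) : Bool :=
  decide (∀ a : Fin b, (∑ j : Fin k, (w j a).toNat) % 2 = 0)

/-- The natural number with binary digits `u 0, u 1, …` (least significant first). -/
def natOfBits {b : ℕ} (u : Fin b → Bool) : ℕ := ∑ a : Fin b, (u a).toNat * 2 ^ (a : ℕ)

/-- The integer in `[-2^(b-1), 2^(b-1))` with two's complement representation `u`. -/
def intOfBits {b : ℕ} (u : Fin b → Bool) : ℤ :=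
  ∑ a : Fin b, ((u a).toNat : ℤ) * (if (a : ℕ) + 1 = b then -(2 : ℤ) ^ (a : ℕ) else 2 ^ (a : ℕ))

/-- `k`-SUM: the `k` vectors, viewed as (signed) `b`-bit integers, sum to zero. -/
def zeroSum (k b : ℕ) (w : Fin k → Fin b → Bool) : Bool :=
  decide (∑ j : Fin k, intOfBits (w j) = 0)

/-- The variant of `k`-SUM for unsigned `b`-bit integers in which the first `k - 1` numbers
have to sum to the last one. -/
def sumToLast (k b : ℕ) (w : Fin k → Fin b → Bool) : Bool :=
  decide (∀ l : Fin k, (l : ℕ) + 1 = k →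
    ∑ j ∈ Finset.univ.erase l, natOfBits (w j) = natOfBits (w l))

/-! ### The average-case distributions (probability mass functions on finite types) -/

/-- `S_{b,μ}`: every string of `{0,1}^b` is included independently with probability `μ`. -/
def setMass (μ : ℝ) {b : ℕ} (Z : Finset (Fin b → Bool)) : ℝ :=
  ∏ w : Fin b → Bool, if w ∈ Z then μ else 1 - μ

/-- `D_{g,b,μ}`: the `g` sets of the factored vector are iid from `S_{b,μ}`. -/
def vectorMass (μ : ℝ) {g b : ℕ} (v : FactoredVector g b) : ℝ := ∏ i : Fin g, setMass μ (v i)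

/-- The average-case distribution of `#Fk-f^μ`: all factored vectors are iid from `D_{g,b,μ}`. -/
def instMass (μ : ℝ) {k n g b : ℕ} (I : Inst k n g b) : ℝ :=
  ∏ j : Fin k, ∏ i : Fin n, vectorMass μ (I j i)

/-! ### The machine model: a probabilistic random access machine with logarithmic cost

Programs are structured (`while` programs). The memory consists of arrays, indexed by constants
of the program, each of which is an infinite sequence of natural numbers with computed (indirect)
addresses. Every operation is charged the bit lengths of its operands, addresses and results. -/

/-- The memory: cell `x` of array `a` holds `s a x`. -/
abbrev Store : Type := ℕ → ℕ → ℕ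

inductive BinOp : Type
  | add | sub | mul | div | mod | lt | eq

def BinOp.apply : BinOp → ℕ → ℕ → ℕ
  | .add, x, y => x + y
  | .sub, x, y => x - y
  | .mul, x, y => x * y
  | .div, x, y => x / y
  | .mod, x, y => x % y
  | .lt, x, y => if x < y then 1 else 0
  | .eq, x, y => if x = y then 1 else 0

/-- Arithmetic expressions; `get a e` reads the cell of array `a` whose address is `e`. -/
inductive AExp : Type
  | lit (c : ℕ)
  | get (a : ℕ) (e : AExp)
  | bin (o : BinOp) (e₁ e₂ : AExp)

def AExp.val : AExp → Store → ℕ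
  | .lit c, _ => c
  | .get a e, s => s a (e.val s)
  | .bin o e₁ e₂, s => o.apply (e₁.val s) (e₂.val s)

/-- Logarithmic cost of evaluating an expression (`Nat.size` is the bit length). -/
def AExp.cost : AExp → Store → ℕ
  | .lit c, _ => 1 + c.size
  | .get a e, s => e.cost s + 1 + (e.val s).size + (s a (e.val s)).size
  | .bin o e₁ e₂, s => e₁.cost s + e₂.cost s + 1 + (e₁.val s).size + (e₂.val s).size
      + (o.apply (e₁.val s) (e₂.val s)).size

/-- Commands. `set a e₁ e₂` writes `e₂` to cell `e₁` of array `a`; `rand a e₁ e₂` writes a fresh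
uniformly random element of `{0,…,e₂}` there, and `flip a e₁ q` the outcome (`0` or `1`) of a fresh
coin that shows `1` with the fixed probability `q`. -/
inductive Cmd : Type
  | skip
  | set (a : ℕ) (e₁ e₂ : AExp)
  | rand (a : ℕ) (e₁ e₂ : AExp)
  | flip (a : ℕ) (e₁ : AExp) (q : unitInterval)
  | seq (c₁ c₂ : Cmd)
  | ite (e : AExp) (c₁ c₂ : Cmd)
  | while (e : AExp) (c : Cmd)

/-- All coins used by the program have their biases in `coins`. (Uniformly random integers are
always available, so that with `coins = ∅` this is the usual probabilistic machine.) -/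
def Cmd.UsesCoins (coins : Set ℝ) : Cmd → Prop
  | .skip => True
  | .set _ _ _ => True
  | .rand _ _ _ => True
  | .flip _ _ q => (q : ℝ) ∈ coins
  | .seq c₁ c₂ => c₁.UsesCoins coins ∧ c₂.UsesCoins coins
  | .ite _ c₁ c₂ => c₁.UsesCoins coins ∧ c₂.UsesCoins coins
  | .while _ c => c.UsesCoins coins

def Store.write (s : Store) (a x v : ℕ) : Store :=
  fun a' x' => if a' = a ∧ x' = x then v else s a' x'

/-- The uniform distribution on `{0,…,m}`. -/
noncomputable def uniformUpTo (m : ℕ) : PMF ℕ :=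
  PMF.uniformOfFinset (Finset.range (m + 1)) ⟨0, Finset.mem_range.2 (Nat.succ_pos m)⟩

/-- The outcome of a coin that shows `1` with probability `q` and `0` otherwise. -/
noncomputable def coin (q : unitInterval) : PMF ℕ :=
  (PMF.ofFintype (fun c : Bool => if c = true then ENNReal.ofReal q else ENNReal.ofReal (1 - q))
    (by
      rw [Fintype.sum_bool]
      simp only [if_true, Bool.false_eq_true, if_false]
      rw [← ENNReal.ofReal_add q.2.1 (sub_nonneg.2 q.2.2)]
      simp)).map Bool.toNat

/-- Big-step semantics with cost. `Runs c s D` says that the command `c`, started in the memory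
`s`, halts on every outcome of its random choices, and that `D` is the joint distribution of the
final memory and of the total cost of the run. -/
inductive Runs : Cmd → Store → PMF (Store × ℕ) → Prop
  | skip (s : Store) : Runs .skip s (PMF.pure (s, 1))
  | set (s : Store) (a : ℕ) (e₁ e₂ : AExp) :
      Runs (.set a e₁ e₂) s (PMF.pure
        (s.write a (e₁.val s) (e₂.val s),
          e₁.cost s + e₂.cost s + 1 + (e₁.val s).size + (e₂.val s).size))
  | rand (s : Store) (a : ℕ) (e₁ e₂ : AExp) :
      Runs (.rand a e₁ e₂) s ((uniformUpTo (e₂.val s)).map fun v =>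
        (s.write a (e₁.val s) v,
          e₁.cost s + e₂.cost s + 1 + (e₁.val s).size + (e₂.val s).size))
  | flip (s : Store) (a : ℕ) (e₁ : AExp) (q : unitInterval) :
      Runs (.flip a e₁ q) s ((coin q).map fun v =>
        (s.write a (e₁.val s) v, e₁.cost s + 1 + (e₁.val s).size))
  | seq (c₁ c₂ : Cmd) (s : Store) (D₁ : PMF (Store × ℕ)) (D₂ : Store → PMF (Store × ℕ)) :
      Runs c₁ s D₁ → (∀ r ∈ D₁.support, Runs c₂ r.1 (D₂ r.1)) →
      Runs (.seq c₁ c₂) s (D₁.bind fun r => (D₂ r.1).map fun r' => (r'.1, r.2 + r'.2))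
  | ite_true (e : AExp) (c₁ c₂ : Cmd) (s : Store) (D : PMF (Store × ℕ)) :
      e.val s ≠ 0 → Runs c₁ s D →
      Runs (.ite e c₁ c₂) s (D.map fun r => (r.1, e.cost s + 1 + r.2))
  | ite_false (e : AExp) (c₁ c₂ : Cmd) (s : Store) (D : PMF (Store × ℕ)) :
      e.val s = 0 → Runs c₂ s D →
      Runs (.ite e c₁ c₂) s (D.map fun r => (r.1, e.cost s + 1 + r.2))
  | while_true (e : AExp) (c : Cmd) (s : Store) (D₁ : PMF (Store × ℕ))
      (D₂ : Store → PMF (Store × ℕ)) :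
      e.val s ≠ 0 → Runs c s D₁ → (∀ r ∈ D₁.support, Runs (.while e c) r.1 (D₂ r.1)) →
      Runs (.while e c) s
        (D₁.bind fun r => (D₂ r.1).map fun r' => (r'.1, e.cost s + 1 + r.2 + r'.2))
  | while_false (e : AExp) (c : Cmd) (s : Store) :
      e.val s = 0 → Runs (.while e c) s (PMF.pure (s, e.cost s + 1))

/-! ### Solving factored problems -/

/-- The input memory. Array `0` starts with the parameters `n, g, b`. Array `1` holds the
characteristic bit vectors, of `2^b` bits each, of all the sets of all the factored vectors, one
after another. All other cells are `0`. -/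
noncomputable def inputStore {k n g b : ℕ} (I : Inst k n g b) : Store := fun a x =>
  open Classical in
  if a = 0 then (if x = 0 then n else if x = 1 then g else if x = 2 then b else 0)
  else if a = 1 then
    (if ∃ (j : Fin k) (i : Fin n) (l : Fin g) (w : Fin b → Bool),
        x = (((j : ℕ) * n + i) * g + l) * 2 ^ b + natOfBits w ∧ w ∈ I j i l
      then 1 else 0)
  else 0

/-- The probability that the output, read from cell `0` of array `2` of the final memory,
is the number `N`. -/
noncomputable def successProb (D : PMF (Store × ℕ)) (N : ℕ) : ℝ :=
  (D.toOuterMeasure {r | r.1 2 0 = N}).toReal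

/-- The family `f` of Boolean functions, one for each `n`, taking `k` strings of length `b n`. -/
abbrev FunFamily (k : ℕ) (b : ℕ → ℕ) : Type := ∀ n : ℕ, (Fin k → Fin (b n) → Bool) → Bool

/-- For all large `n`, the program `P` halts with cost at most `T n` on every input of size `n` and
every outcome of its random choices, and `D n I` is the distribution of the result on `I`. -/
def RunsInTime {k : ℕ} (g b : ℕ → ℕ) (P : Cmd) (T : ℕ → ℕ)
    (D : ∀ n : ℕ, Inst k n (g n) (b n) → PMF (Store × ℕ)) : Prop :=
  ∀ᶠ n : ℕ in atTop, ∀ I : Inst k n (g n) (b n),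
    Runs P (inputStore I) (D n I) ∧ ∀ r ∈ (D n I).support, r.2 ≤ T n

/-- Average-case `#Fk-f^μ` can be solved in time `T` with probability at least `p n`, over the
average-case distribution on the inputs and the random choices of the program. -/
def AvgCaseSolvable (coins : Set ℝ) {k : ℕ} (g b : ℕ → ℕ) (f : FunFamily k b) (μ : ℝ)
    (T : ℕ → ℕ) (p : ℕ → ℝ) : Prop :=
  ∃ (P : Cmd) (D : ∀ n : ℕ, Inst k n (g n) (b n) → PMF (Store × ℕ)),
    P.UsesCoins coins ∧ RunsInTime g b P T D ∧
    ∀ᶠ n : ℕ in atTop,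
      p n ≤ ∑ I : Inst k n (g n) (b n), instMass μ I * successProb (D n I) (count (f n) I)

/-- Worst-case `#Fk-f` can be solved (by a randomized algorithm, on every input with probability
at least `1 - 2^(-lg² n)`) in time `Õ(T)`, that is, in time `T(n) · n^{o(1)}`. -/
def WorstCaseSolvableSoftO (coins : Set ℝ) {k : ℕ} (g b : ℕ → ℕ) (f : FunFamily k b)
    (T : ℕ → ℕ) : Prop :=
  ∃ (P : Cmd) (T' : ℕ → ℕ) (D : ∀ n : ℕ, Inst k n (g n) (b n) → PMF (Store × ℕ)),
    P.UsesCoins coins ∧ RunsInTime g b P T' D ∧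
    (∀ ε : ℝ, 0 < ε → (fun n : ℕ => (T' n : ℝ)) =O[atTop] fun n : ℕ => (n : ℝ) ^ ε * (T n : ℝ)) ∧
    ∀ᶠ n : ℕ in atTop, ∀ I : Inst k n (g n) (b n),
      1 - (2 : ℝ) ^ (-(Real.logb 2 n) ^ 2) ≤ successProb (D n I) (count (f n) I)

/-- The success probability `1 - 1/(lg(n)^{kg} lglg(n)^{kg})`. -/
noncomputable def threshold (k : ℕ) (g : ℕ → ℕ) (n : ℕ) : ℝ :=
  1 - 1 / (Real.logb 2 n ^ (k * g n) * Real.logb 2 (Real.logb 2 n) ^ (k * g n))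

end FactoredAvg

/-!
The count asked for is a multilinear form in `d = k * g` blocks of variables: the block `(j, l)`
consists of the characteristic bits of the `l`-th sets of the vectors in the `j`-th list. The
reduction from the worst case to the average case uses only this multilinearity, over the integers.

Every input bit `y` is written as `∑ e < t, splitCoeff m e * z e` with random bits `z e`, where
`t = 2 * m * s` and `2 ^ s > n ^ 3`. For each of the `s` powers of two there are `m` pairs of bits
with opposite signs. If `y = 1`, a uniformly random nonzero `U < 2 ^ s` decides, through the
identity `1 = 2 ^ v - ∑ j < v, 2 ^ j` with `v` the 2-adic valuation of `U`, in which levels exactly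
one pair is unequal, and with which sign; the other pairs of these levels are equal, with a bias
that compensates the effect of the unequal pair, which is possible because `m` is large
(`EnoughPairs`). In the remaining levels, and in all levels if `y = 0`, the bits equal one coin. The
identity is exact (`sum_splitBit`), while each single bit `z e` has the law of a coin of bias `μ` up
to `2 / 2 ^ s`, whatever `y` is (`expect_splitBit_le`).

Choosing one of the `t` bits for each block and expanding the multilinear form shows that the count
is a combination of the counts of `t ^ d` instances (`sum_count_queryInst`). Each of these uses a
single split bit of each variable, and the variables are split independently, so it is distributed
nearly as an average-case instance: every event is at most twice as likely. As `t = O(lg n)`, the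
factor `(lg lg n) ^ d` in the error bound of the average-case solver makes the errors of all queries
of a trial add up to at most `1 / 10` (`expect_trial_le_tenth`). After `s * s` independent trials, a
majority vote fails with probability at most `(7 / 10) ^ (s * s)`, which is below `2 ^ (-lg² n)`
(`expect_vote_le`).

The vote is that of Boyer and Moore, which needs a candidate and a counter only. The analysis uses a
potential whose expectation shrinks by the factor `7 / 10` with every vote.

The other half of the proof is a program with this behaviour. `SimC` says that a program simulates
an abstract probabilistic computation; it has a rule for every command of the machine. Each call of
the average-case solver needs a blank memory, so the memory is divided into as many interleaved
stripes as there are calls: the transformed program `Cmd.stripe` works in one stripe only and is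
slower by a factor that is logarithmic in the number of stripes (`Runs.stripe`). The cost of the
whole (`solver_sim`) is that of `s * s * t ^ d` calls and of writing their inputs, which have
`k * n * g * 2 ^ b` bits. This is `n ^ o(1) * T n` because `t ^ d` and `2 ^ b` are subpolynomial
(`softO_queries`, `softO_two_pow`) and `n ≤ T n`.
-/

namespace FactoredAvg

/-! ### Program logic -/

theorem mem_support_uniformUpTo {m v : ℕ} : v ∈ (uniformUpTo m).support ↔ v ≤ m := by
  refine (PMF.mem_support_uniformOfFinset_iff ⟨0, Finset.mem_range.2 (Nat.succ_pos m)⟩ v).trans ?_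
  rw [Finset.mem_range, Nat.lt_succ_iff]

theorem PMF.bind_congr_of_mem_support {α β : Type*} (p : PMF α) {f g : α → PMF β}
    (h : ∀ a ∈ p.support, f a = g a) : p.bind f = p.bind g := by
  ext b
  simp only [PMF.bind_apply]
  refine tsum_congr fun a => ?_
  by_cases ha : p a = 0
  · simp [ha]
  · rw [h a ((PMF.mem_support_iff _ _).2 ha)]

/-- The distribution of the outcome of a program is determined by the program and the memory. -/
theorem Runs.det {c : Cmd} {s : Store} {D D' : PMF (Store × ℕ)} (h : Runs c s D)
    (h' : Runs c s D') : D = D' := by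
  induction h generalizing D' with
  | skip s => cases h'; rfl
  | set s a e₁ e₂ => cases h'; rfl
  | rand s a e₁ e₂ => cases h'; rfl
  | flip s a e₁ q => cases h'; rfl
  | seq c₁ c₂ s D₁ D₂ h₁ h₂ ih₁ ih₂ =>
    cases h' with
    | seq _ _ _ D₁' D₂' h₁' h₂' =>
      obtain rfl := ih₁ h₁'
      exact PMF.bind_congr_of_mem_support _ fun r hr => by rw [ih₂ r hr (h₂' r hr)]
  | ite_true e c₁ c₂ s D he h ih =>
    cases h' with
    | ite_true _ _ _ _ D' he' h' => rw [ih h']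
    | ite_false _ _ _ _ D' he' h' => exact absurd he' he
  | ite_false e c₁ c₂ s D he h ih =>
    cases h' with
    | ite_true _ _ _ _ D' he' h' => exact absurd he he'
    | ite_false _ _ _ _ D' he' h' => rw [ih h']
  | while_true e c s D₁ D₂ he h₁ h₂ ih₁ ih₂ =>
    cases h' with
    | while_true _ _ _ D₁' D₂' he' h₁' h₂' =>
      obtain rfl := ih₁ h₁'
      exact PMF.bind_congr_of_mem_support _ fun r hr => by rw [ih₂ r hr (h₂' r hr)]
    | while_false _ _ _ he' => exact absurd he' he
  | while_false e c s he =>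
    cases h' with
    | while_true _ _ _ D₁' D₂' he' h₁' h₂' => exact absurd he he'
    | while_false _ _ _ he' => rfl

/-- `SimC c s M R`: started in `s`, the command `c` halts, and its outcome can be coupled with the
probabilistic value `M` in such a way that `R` holds between the final memory, the cost of the run
and the value. -/
def SimC {α : Type} (c : Cmd) (s : Store) (M : PMF α) (R : Store → ℕ → α → Prop) : Prop :=
  ∃ J : PMF ((Store × ℕ) × α), Runs c s (J.map Prod.fst) ∧ J.map Prod.snd = M ∧
    ∀ p ∈ J.support, R p.1.1 p.1.2 p.2

/-- `Sim c s B M R`: the outcome of `c`, started in `s`, costs at most `B` and simulates the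
probabilistic value `M` up to the relation `R` between memories and values. -/
def Sim {α : Type} (c : Cmd) (s : Store) (B : ℕ) (M : PMF α) (R : Store → α → Prop) : Prop :=
  SimC c s M fun s' t a => t ≤ B ∧ R s' a

/-- `Det c s B Q`: every run of `c` from `s` costs at most `B` and ends in a memory
satisfying `Q`. -/
def Det (c : Cmd) (s : Store) (B : ℕ) (Q : Store → Prop) : Prop :=
  Sim c s B (PMF.pure ()) fun s' _ => Q s'

section Rules

variable {α β : Type} {c c₁ c₂ : Cmd} {s : Store}

theorem SimC.mono {M : PMF α} {R R' : Store → ℕ → α → Prop} (h : SimC c s M R)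
    (hR : ∀ s' t, ∀ a ∈ M.support, R s' t a → R' s' t a) : SimC c s M R' := by
  obtain ⟨J, h₁, h₂, h₃⟩ := h
  refine ⟨J, h₁, h₂, fun p hp => hR _ _ _ ?_ (h₃ p hp)⟩
  rw [← h₂, PMF.mem_support_map_iff]
  exact ⟨p, hp, rfl⟩

theorem SimC.map {M : PMF α} {R : Store → ℕ → α → Prop} {R' : Store → ℕ → β → Prop}
    (h : SimC c s M R) (f : α → β) (hR : ∀ s' t a, R s' t a → R' s' t (f a)) :
    SimC c s (M.map f) R' := by
  obtain ⟨J, h₁, h₂, h₃⟩ := h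
  refine ⟨J.map fun p => (p.1, f p.2), ?_, ?_, ?_⟩
  · rw [PMF.map_comp]; exact h₁
  · rw [PMF.map_comp, ← h₂, PMF.map_comp]; rfl
  · intro p hp
    obtain ⟨q, hq, rfl⟩ := (PMF.mem_support_map_iff _ _ _).1 hp
    exact hR _ _ _ (h₃ q hq)

theorem SimC.pure {D : Store × ℕ} (h : Runs c s (PMF.pure D)) {R : Store → ℕ → α → Prop} {a : α}
    (hR : R D.1 D.2 a) : SimC c s (PMF.pure a) R := by
  refine ⟨PMF.pure (D, a), by rwa [PMF.pure_map], by rw [PMF.pure_map], fun p hp => ?_⟩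
  rw [PMF.mem_support_pure_iff] at hp
  subst hp
  exact hR

/-- The common core of the rules for sequencing and loops: couplings can be composed. -/
theorem exists_coupling_bind {J : PMF ((Store × ℕ) × α)} {M : α → PMF β}
    {R : Store → ℕ → α → Prop} {R' : Store → ℕ → α → ℕ → Store → β → Prop} (h : ℕ → ℕ → ℕ)
    (hJ : ∀ p ∈ J.support, R p.1.1 p.1.2 p.2)
    (hc : ∀ s' t a, R s' t a → SimC c s' (M a) fun s'' t' b => R' s' t a t' s'' b) :
    ∃ (D : Store → PMF (Store × ℕ)) (J' : PMF ((Store × ℕ) × β)),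
      (∀ r ∈ (J.map Prod.fst).support, Runs c r.1 (D r.1)) ∧
      J'.map Prod.fst = (J.map Prod.fst).bind
        (fun r => (D r.1).map fun r' => (r'.1, h r.2 r'.2)) ∧
      J'.map Prod.snd = (J.map Prod.snd).bind M ∧
      ∀ p' ∈ J'.support, ∃ s' t a t', R' s' t a t' p'.1.1 p'.2 ∧ p'.1.2 = h t t' := by
  classical
  have hc' : ∀ p : (Store × ℕ) × α, ∃ J₂ : PMF ((Store × ℕ) × β), p ∈ J.support →
      Runs c p.1.1 (J₂.map Prod.fst) ∧ J₂.map Prod.snd = M p.2 ∧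
        ∀ p' ∈ J₂.support, R' p.1.1 p.1.2 p.2 p'.1.2 p'.1.1 p'.2 := by
    intro p
    by_cases hp : p ∈ J.support
    · obtain ⟨J₂, h₁, h₂, h₃⟩ := hc _ _ _ (hJ p hp)
      exact ⟨J₂, fun _ => ⟨h₁, h₂, h₃⟩⟩
    · exact ⟨(M p.2).map fun b => ((fun _ _ => 0, 0), b), fun h => absurd h hp⟩
  choose J₂ hJ₂ using hc'
  have hD : ∀ s' : Store, ∃ D : PMF (Store × ℕ),
      ∀ p ∈ J.support, p.1.1 = s' → Runs c s' D := by
    intro s'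
    by_cases hp : ∃ p ∈ J.support, p.1.1 = s'
    · obtain ⟨p, hp, rfl⟩ := hp
      exact ⟨_, fun _ _ _ => (hJ₂ p hp).1⟩
    · exact ⟨PMF.pure (fun _ _ => 0, 0), fun p hp' h => absurd ⟨p, hp', h⟩ hp⟩
  choose D hD using hD
  refine ⟨D, J.bind fun p => (J₂ p).map fun p' => ((p'.1.1, h p.1.2 p'.1.2), p'.2),
    ?_, ?_, ?_, ?_⟩
  · intro r hr
    obtain ⟨p, hp, rfl⟩ := (PMF.mem_support_map_iff _ _ _).1 hr
    exact hD _ p hp rfl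
  · rw [PMF.map_bind, PMF.bind_map]
    refine PMF.bind_congr_of_mem_support _ fun p hp => ?_
    rw [PMF.map_comp, Function.comp_apply, (hD _ p hp rfl).det (hJ₂ p hp).1, PMF.map_comp]
    rfl
  · rw [PMF.map_bind, PMF.bind_map]
    refine PMF.bind_congr_of_mem_support _ fun p hp => ?_
    rw [PMF.map_comp, Function.comp_apply, ← (hJ₂ p hp).2.1]
    rfl
  · intro p' hp'
    obtain ⟨p, hp, hp'⟩ := (PMF.mem_support_bind_iff _ _ _).1 hp'
    obtain ⟨q, hq, rfl⟩ := (PMF.mem_support_map_iff _ _ _).1 hp'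
    exact ⟨_, _, _, _, (hJ₂ p hp).2.2 q hq, rfl⟩

theorem SimC.seq {M₁ : PMF α} {M₂ : α → PMF β} {R₁ : Store → ℕ → α → Prop}
    {R : Store → ℕ → β → Prop} (h₁ : SimC c₁ s M₁ R₁)
    (h₂ : ∀ s' t a, R₁ s' t a → SimC c₂ s' (M₂ a) fun s'' t' b => R s'' (t + t') b) :
    SimC (.seq c₁ c₂) s (M₁.bind M₂) R := by
  obtain ⟨J, h, rfl, hJ⟩ := h₁
  obtain ⟨D, J', hD, hJ₁, hJ₂, hJ₃⟩ := exists_coupling_bind (c := c₂)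
    (R' := fun s' t a t' s'' b => R s'' (t + t') b) (fun t t' => t + t') hJ h₂
  refine ⟨J', ?_, hJ₂, fun p hp => ?_⟩
  · rw [hJ₁]
    exact Runs.seq _ _ _ _ _ h hD
  · obtain ⟨s', t, a, t', h, ht⟩ := hJ₃ p hp
    rwa [ht]

theorem SimC.while_true {e : AExp} {M₁ : PMF α} {M₂ : α → PMF β} {R₁ : Store → ℕ → α → Prop}
    {R : Store → ℕ → β → Prop} (he : e.val s ≠ 0) (h₁ : SimC c s M₁ R₁)
    (h₂ : ∀ s' t a, R₁ s' t a →
      SimC (.while e c) s' (M₂ a) fun s'' t' b => R s'' (e.cost s + 1 + t + t') b) :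
    SimC (.while e c) s (M₁.bind M₂) R := by
  obtain ⟨J, h, rfl, hJ⟩ := h₁
  obtain ⟨D, J', hD, hJ₁, hJ₂, hJ₃⟩ := exists_coupling_bind (c := .while e c)
    (R' := fun s' t a t' s'' b => R s'' (e.cost s + 1 + t + t') b)
    (fun t t' => e.cost s + 1 + t + t') hJ h₂
  refine ⟨J', ?_, hJ₂, fun p hp => ?_⟩
  · rw [hJ₁]
    exact Runs.while_true _ _ _ _ _ he h hD
  · obtain ⟨s', t, a, t', h, ht⟩ := hJ₃ p hp
    rwa [ht]

theorem SimC.ite_true {e : AExp} {M : PMF α} {R : Store → ℕ → α → Prop} (he : e.val s ≠ 0)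
    (h : SimC c₁ s M fun s' t a => R s' (e.cost s + 1 + t) a) : SimC (.ite e c₁ c₂) s M R := by
  obtain ⟨J, h, hM, hJ⟩ := h
  refine ⟨J.map fun p => ((p.1.1, e.cost s + 1 + p.1.2), p.2), ?_, ?_, ?_⟩
  · have := Runs.ite_true e c₁ c₂ s _ he h
    rw [PMF.map_comp] at this ⊢
    exact this
  · rw [PMF.map_comp]; exact hM
  · intro p hp
    obtain ⟨q, hq, rfl⟩ := (PMF.mem_support_map_iff _ _ _).1 hp
    exact hJ q hq

theorem SimC.ite_false {e : AExp} {M : PMF α} {R : Store → ℕ → α → Prop} (he : e.val s = 0)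
    (h : SimC c₂ s M fun s' t a => R s' (e.cost s + 1 + t) a) : SimC (.ite e c₁ c₂) s M R := by
  obtain ⟨J, h, hM, hJ⟩ := h
  refine ⟨J.map fun p => ((p.1.1, e.cost s + 1 + p.1.2), p.2), ?_, ?_, ?_⟩
  · have := Runs.ite_false e c₁ c₂ s _ he h
    rw [PMF.map_comp] at this ⊢
    exact this
  · rw [PMF.map_comp]; exact hM
  · intro p hp
    obtain ⟨q, hq, rfl⟩ := (PMF.mem_support_map_iff _ _ _).1 hp
    exact hJ q hq

theorem SimC.rand (a : ℕ) (e₁ e₂ : AExp) {R : Store → ℕ → ℕ → Prop}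
    (hR : ∀ v ≤ e₂.val s, R (s.write a (e₁.val s) v)
      (e₁.cost s + e₂.cost s + 1 + (e₁.val s).size + (e₂.val s).size) v) :
    SimC (.rand a e₁ e₂) s (uniformUpTo (e₂.val s)) R := by
  refine ⟨(uniformUpTo (e₂.val s)).map fun v => ((s.write a (e₁.val s) v,
          e₁.cost s + e₂.cost s + 1 + (e₁.val s).size + (e₂.val s).size), v), ?_, ?_, ?_⟩
  · rw [PMF.map_comp]; exact Runs.rand s a e₁ e₂
  · rw [PMF.map_comp]; exact PMF.map_id _
  · intro p hp
    obtain ⟨v, hv, rfl⟩ := (PMF.mem_support_map_iff _ _ _).1 hp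
    exact hR v (mem_support_uniformUpTo.1 hv)

theorem SimC.flip (a : ℕ) (e₁ : AExp) (q : unitInterval) {R : Store → ℕ → ℕ → Prop}
    (hR : ∀ v ≤ 1, R (s.write a (e₁.val s) v) (e₁.cost s + 1 + (e₁.val s).size) v) :
    SimC (.flip a e₁ q) s (coin q) R := by
  refine ⟨(coin q).map fun v => ((s.write a (e₁.val s) v,
          e₁.cost s + 1 + (e₁.val s).size), v), ?_, ?_, ?_⟩
  · rw [PMF.map_comp]; exact Runs.flip s a e₁ q
  · rw [PMF.map_comp]; exact PMF.map_id _
  · intro p hp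
    obtain ⟨v, hv, rfl⟩ := (PMF.mem_support_map_iff _ _ _).1 hp
    refine hR v ?_
    obtain ⟨w, -, rfl⟩ := (PMF.mem_support_map_iff _ _ _).1 hv
    cases w <;> simp

/-! Rules for runs with a bound on the cost. -/

theorem Sim.mono {B B' : ℕ} {M : PMF α} {R R' : Store → α → Prop} (h : Sim c s B M R)
    (hB : B ≤ B') (hR : ∀ s' a, R s' a → R' s' a) : Sim c s B' M R' :=
  SimC.mono h fun _ _ _ _ h => ⟨h.1.trans hB, hR _ _ h.2⟩

theorem Sim.map {B : ℕ} {M : PMF α} {R : Store → α → Prop} {R' : Store → β → Prop}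
    (h : Sim c s B M R) (f : α → β) (hR : ∀ s' a, R s' a → R' s' (f a)) :
    Sim c s B (M.map f) R' :=
  SimC.map h f fun _ _ _ h => ⟨h.1, hR _ _ h.2⟩

theorem Sim.seq {B₁ B₂ : ℕ} {M₁ : PMF α} {M₂ : α → PMF β} {R₁ : Store → α → Prop}
    {R : Store → β → Prop} (h₁ : Sim c₁ s B₁ M₁ R₁)
    (h₂ : ∀ s' a, R₁ s' a → Sim c₂ s' B₂ (M₂ a) R) :
    Sim (.seq c₁ c₂) s (B₁ + B₂) (M₁.bind M₂) R :=
  SimC.seq h₁ fun s' t a h => SimC.mono (h₂ s' a h.2) fun _ _ _ _ h' => ⟨by omega, h'.2⟩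

theorem Sim.seq_map {B₁ B₂ : ℕ} {M₁ : PMF α} {f : α → β} {R₁ : Store → α → Prop}
    {R : Store → β → Prop} (h₁ : Sim c₁ s B₁ M₁ R₁)
    (h₂ : ∀ s' a, R₁ s' a → Det c₂ s' B₂ fun s'' => R s'' (f a)) :
    Sim (.seq c₁ c₂) s (B₁ + B₂) (M₁.map f) R := by
  rw [← PMF.bind_pure_comp]
  refine Sim.seq h₁ fun s' a h => ?_
  have := (h₂ s' a h).map (R' := R) (fun _ => f a) fun _ _ h => h
  rwa [PMF.pure_map] at this

theorem Sim.seq_det {B₁ B₂ : ℕ} {M₁ : PMF α} {R₁ : Store → α → Prop}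
    {R : Store → α → Prop} (h₁ : Sim c₁ s B₁ M₁ R₁)
    (h₂ : ∀ s' a, R₁ s' a → Det c₂ s' B₂ fun s'' => R s'' a) :
    Sim (.seq c₁ c₂) s (B₁ + B₂) M₁ R := by
  have := Sim.seq_map (f := id) h₁ h₂
  rwa [PMF.map_id] at this

theorem Det.seq_sim {B₁ B₂ : ℕ} {M : PMF α} {Q : Store → Prop} {R : Store → α → Prop}
    (h₁ : Det c₁ s B₁ Q) (h₂ : ∀ s', Q s' → Sim c₂ s' B₂ M R) :
    Sim (.seq c₁ c₂) s (B₁ + B₂) M R := by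
  have := Sim.seq (M₂ := fun _ => M) h₁ fun s' _ h => h₂ s' h
  rwa [PMF.pure_bind] at this

theorem Det.seq {B₁ B₂ : ℕ} {Q R : Store → Prop} (h₁ : Det c₁ s B₁ Q)
    (h₂ : ∀ s', Q s' → Det c₂ s' B₂ R) : Det (.seq c₁ c₂) s (B₁ + B₂) R :=
  Det.seq_sim h₁ h₂

theorem Det.mono {B B' : ℕ} {Q Q' : Store → Prop} (h : Det c s B Q) (hB : B ≤ B')
    (hQ : ∀ s', Q s' → Q' s') : Det c s B' Q' :=
  Sim.mono h hB fun s' _ => hQ s'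

theorem Det.set {a : ℕ} {e₁ e₂ : AExp} {B : ℕ} {Q : Store → Prop}
    (hB : e₁.cost s + e₂.cost s + 1 + (e₁.val s).size + (e₂.val s).size ≤ B)
    (hQ : Q (s.write a (e₁.val s) (e₂.val s))) : Det (.set a e₁ e₂) s B Q :=
  SimC.pure (R := fun s' t (_ : Unit) => t ≤ B ∧ Q s') (Runs.set s a e₁ e₂) ⟨hB, hQ⟩

theorem Sim.ite {e : AExp} {B B' : ℕ} {M : PMF α} {R : Store → α → Prop}
    (hB : e.cost s + 1 ≤ B') (h₁ : e.val s ≠ 0 → Sim c₁ s B M R)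
    (h₂ : e.val s = 0 → Sim c₂ s B M R) :
    Sim (.ite e c₁ c₂) s (B' + B) M R := by
  by_cases he : e.val s = 0
  · exact SimC.ite_false he (SimC.mono (h₂ he) fun _ _ _ _ h => ⟨by omega, h.2⟩)
  · exact SimC.ite_true he (SimC.mono (h₁ he) fun _ _ _ _ h => ⟨by omega, h.2⟩)

/-- `iterFrom M i n a` starts with `a` and performs the probabilistic steps `M i`, …,
`M (i + n - 1)`. -/
noncomputable def iterFrom (M : ℕ → α → PMF α) : ℕ → ℕ → α → PMF α
  | _, 0, a => PMF.pure a
  | i, n + 1, a => (M i a).bind (iterFrom M (i + 1) n)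

theorem iterFrom_succ (M : ℕ → α → PMF α) (i n : ℕ) (a : α) :
    iterFrom M i (n + 1) a = (iterFrom M i n a).bind (M (i + n)) := by
  induction n generalizing i a with
  | zero => simp [iterFrom]
  | succ n ih =>
    rw [iterFrom, iterFrom, PMF.bind_bind]
    congr 1
    ext1 a'
    rw [ih, show i + 1 + n = i + (n + 1) by ring]

theorem iterFrom_pure (i n : ℕ) (a : α) : iterFrom (fun _ a => PMF.pure a) i n a = PMF.pure a := by
  induction n generalizing i with
  | zero => rfl
  | succ n ih => rw [iterFrom, PMF.pure_bind, ih]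

/-- The rule for a loop that is known to perform `n` iterations. -/
theorem Sim.while {e : AExp} {n B B' : ℕ} {M : ℕ → α → PMF α} {Inv : ℕ → Store → α → Prop}
    (hcost : ∀ i ≤ n, ∀ s a, Inv i s a → e.cost s + 1 ≤ B')
    (hguard : ∀ i ≤ n, ∀ s a, Inv i s a → (e.val s ≠ 0 ↔ i < n))
    (hbody : ∀ i < n, ∀ s a, Inv i s a → Sim c s B (M i a) (Inv (i + 1)))
    {a : α} (h0 : Inv 0 s a) :
    Sim (.while e c) s (n * (B' + B) + B') (iterFrom M 0 n a) (Inv n) := by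
  suffices ∀ j i s a, i + j = n → Inv i s a →
      Sim (.while e c) s (j * (B' + B) + B') (iterFrom M i j a) (Inv n) from
    this n 0 s a (by omega) h0
  intro j
  induction j with
  | zero =>
    intro i s a hi hinv
    obtain rfl : i = n := by omega
    have he : e.val s = 0 := by
      by_contra h
      exact absurd ((hguard i le_rfl s a hinv).1 h) (lt_irrefl _)
    exact SimC.pure (Runs.while_false e c s he)
      ⟨by have := hcost i le_rfl s a hinv; simpa using this, hinv⟩
  | succ j ih =>
    intro i s a hi hinv
    have he : e.val s ≠ 0 := (hguard i (by omega) s a hinv).2 (by omega)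
    refine SimC.while_true he (hbody i (by omega) s a hinv) fun s' t a' h => ?_
    refine SimC.mono (ih (i + 1) s' a' (by omega) h.2) fun s'' t' b _ h' => ⟨?_, h'.2⟩
    have h1 := hcost i (by omega) s a hinv
    have h2 := h.1
    have h3 := h'.1
    have : (j + 1) * (B' + B) + B' = j * (B' + B) + B' + (B' + B) := by ring
    omega

theorem Det.while {e : AExp} {n B B' : ℕ} {Inv : ℕ → Store → Prop}
    (hcost : ∀ i ≤ n, ∀ s, Inv i s → e.cost s + 1 ≤ B')
    (hguard : ∀ i ≤ n, ∀ s, Inv i s → (e.val s ≠ 0 ↔ i < n))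
    (hbody : ∀ i < n, ∀ s, Inv i s → Det c s B (Inv (i + 1))) (h0 : Inv 0 s) :
    Det (.while e c) s (n * (B' + B) + B') (Inv n) := by
  have := Sim.while (c := c) (e := e) (n := n) (B := B) (B' := B') (a := ()) (s := s)
    (M := fun _ a => PMF.pure a)
    (Inv := fun i s _ => Inv i s) (fun i hi s _ => hcost i hi s) (fun i hi s _ => hguard i hi s)
    (fun i hi s _ => hbody i hi s) h0
  rwa [iterFrom_pure] at this

end Rules

/-! ### Cost of expressions -/

/-- All arrays read by the expression have an index below `A`. -/
def AExp.Reads (A : ℕ) : AExp → Prop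
  | .lit _ => True
  | .get a e => a < A ∧ e.Reads A
  | .bin _ e₁ e₂ => e₁.Reads A ∧ e₂.Reads A

/-- If all cells have at most `q` bits, then the value of `e` has at most `e.bits * q` bits. -/
def AExp.bits : AExp → ℕ
  | .lit c => c.size
  | .get _ _ => 1
  | .bin _ e₁ e₂ => e₁.bits + e₂.bits + 1

/-- If all cells have at most `q` bits, then the cost of `e` is at most `e.weight * q`. -/
def AExp.weight : AExp → ℕ
  | .lit c => 1 + c.size
  | .get _ e => e.weight + 1 + e.bits + 1
  | .bin _ e₁ e₂ => e₁.weight + e₂.weight + 1 + e₁.bits + e₂.bits + (e₁.bits + e₂.bits + 1)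

/-- The cells of the arrays with an index below `A` have at most `q` bits. -/
def Bdd (A q : ℕ) (s : Store) : Prop := ∀ a < A, ∀ x, (s a x).size ≤ q

theorem size_add_le (x y : ℕ) : (x + y).size ≤ max x.size y.size + 1 := by
  rw [Nat.size_le, pow_succ]
  have h1 : x < 2 ^ max x.size y.size := Nat.size_le.1 (le_max_left _ _)
  have h2 : y < 2 ^ max x.size y.size := Nat.size_le.1 (le_max_right _ _)
  omega

theorem size_mul_le (x y : ℕ) : (x * y).size ≤ x.size + y.size := by
  rw [Nat.size_le, pow_add]
  exact Nat.mul_lt_mul'' (Nat.lt_size_self x) (Nat.lt_size_self y)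

theorem BinOp.size_apply_le (o : BinOp) (x y : ℕ) : (o.apply x y).size ≤ x.size + y.size + 1 := by
  cases o with
  | add =>
    have := max_le_add_of_nonneg (Nat.zero_le x.size) (Nat.zero_le y.size)
    exact (size_add_le x y).trans (by omega)
  | sub => exact (Nat.size_le_size (Nat.sub_le x y)).trans (by omega)
  | mul => exact (size_mul_le x y).trans (by omega)
  | div => exact (Nat.size_le_size (Nat.div_le_self x y)).trans (by omega)
  | mod => exact (Nat.size_le_size (Nat.mod_le x y)).trans (by omega)
  | lt =>
    have : (if x < y then 1 else 0 : ℕ) ≤ 1 := by split_ifs <;> simp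
    exact (Nat.size_le_size this).trans (by simp)
  | eq =>
    have : (if x = y then 1 else 0 : ℕ) ≤ 1 := by split_ifs <;> simp
    exact (Nat.size_le_size this).trans (by simp)

theorem AExp.size_val_le {A q : ℕ} (hq : 1 ≤ q) {s : Store} (hs : Bdd A q s) {e : AExp}
    (he : e.Reads A) : (e.val s).size ≤ e.bits * q := by
  induction e with
  | lit c => exact Nat.le_mul_of_pos_right _ hq
  | get a e ih =>
    rw [AExp.bits, one_mul]
    exact hs a he.1 _
  | bin o e₁ e₂ ih₁ ih₂ =>
    have h1 := ih₁ he.1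
    have h2 := ih₂ he.2
    have h3 := o.size_apply_le (e₁.val s) (e₂.val s)
    simp only [AExp.val, AExp.bits, add_mul]
    omega

theorem AExp.cost_le {A q : ℕ} (hq : 1 ≤ q) {s : Store} (hs : Bdd A q s) {e : AExp}
    (he : e.Reads A) : e.cost s ≤ e.weight * q := by
  induction e with
  | lit c => exact Nat.le_mul_of_pos_right _ hq
  | get a e ih =>
    have h1 := ih he.2
    have h2 := AExp.size_val_le hq hs he.2
    have h3 := hs a he.1 (e.val s)
    simp only [AExp.cost, AExp.weight, add_mul]
    omega
  | bin o e₁ e₂ ih₁ ih₂ =>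
    have h1 := ih₁ he.1
    have h2 := ih₂ he.2
    have h3 := AExp.size_val_le hq hs he.1
    have h4 := AExp.size_val_le hq hs he.2
    have h5 := o.size_apply_le (e₁.val s) (e₂.val s)
    simp only [AExp.cost, AExp.weight, add_mul]
    omega

/-- The weight of an assignment of `e₂` to the cell `e₁`, see `Det.assign`. -/
def AExp.assignWeight (e₁ e₂ : AExp) : ℕ := e₁.weight + e₂.weight + 1 + e₁.bits + e₂.bits

theorem AExp.assign_cost_le {A q : ℕ} (hq : 1 ≤ q) {s : Store} (hs : Bdd A q s) {e₁ e₂ : AExp}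
    (h₁ : e₁.Reads A) (h₂ : e₂.Reads A) :
    e₁.cost s + e₂.cost s + 1 + (e₁.val s).size + (e₂.val s).size ≤
      AExp.assignWeight e₁ e₂ * q := by
  have h3 := AExp.size_val_le hq hs h₁
  have h4 := AExp.size_val_le hq hs h₂
  have h5 := AExp.cost_le hq hs h₁
  have h6 := AExp.cost_le hq hs h₂
  simp only [AExp.assignWeight, add_mul]
  omega

theorem Det.assign {A q : ℕ} (hq : 1 ≤ q) {s : Store} (hs : Bdd A q s) {a : ℕ} {e₁ e₂ : AExp}
    (h₁ : e₁.Reads A) (h₂ : e₂.Reads A) {Q : Store → Prop}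
    (hQ : Q (s.write a (e₁.val s) (e₂.val s))) :
    Det (.set a e₁ e₂) s (AExp.assignWeight e₁ e₂ * q) Q :=
  Det.set (AExp.assign_cost_le hq hs h₁ h₂) hQ

theorem Bdd.write {A q : ℕ} {s : Store} (h : Bdd A q s) {a x v : ℕ} (hv : v.size ≤ q) :
    Bdd A q (s.write a x v) := by
  intro a' ha' x'
  unfold Store.write
  split_ifs
  · exact hv
  · exact h a' ha' x'

/-- A cell of at least `A` may be written without any harm to the bound below `A`. -/
theorem Bdd.write_of_le {A q : ℕ} {s : Store} (h : Bdd A q s) {a x v : ℕ} (ha : A ≤ a) :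
    Bdd A q (s.write a x v) := by
  intro a' ha' x'
  unfold Store.write
  rw [if_neg (by omega)]
  exact h a' ha' x'

/-- Writing a number is charged its length, so a run of cost `t` creates no number of more than
`t` bits. -/
theorem Runs.size_le {c : Cmd} {s : Store} {D : PMF (Store × ℕ)} (h : Runs c s D) :
    ∀ r ∈ D.support, ∀ a x, (r.1 a x).size ≤ max (s a x).size r.2 := by
  have hw : ∀ (s : Store) (a x v t : ℕ), v.size ≤ t →
      ∀ a' x', (s.write a x v a' x').size ≤ max (s a' x').size t := by
    intro s a x v t hv a' x'
    unfold Store.write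
    split_ifs
    · exact hv.trans (le_max_right _ _)
    · exact le_max_left _ _
  induction h with
  | skip s =>
    intro r hr a x
    rw [PMF.mem_support_pure_iff] at hr
    subst hr
    exact le_max_left _ _
  | set s a e₁ e₂ =>
    intro r hr
    rw [PMF.mem_support_pure_iff] at hr
    subst hr
    exact hw _ _ _ _ _ (by omega)
  | rand s a e₁ e₂ =>
    intro r hr
    obtain ⟨v, hv, rfl⟩ := (PMF.mem_support_map_iff _ _ _).1 hr
    refine hw _ _ _ _ _ ?_
    have hv : v ≤ e₂.val s := mem_support_uniformUpTo.1 hv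
    have := Nat.size_le_size hv
    omega
  | flip s a e₁ q =>
    intro r hr
    obtain ⟨v, hv, rfl⟩ := (PMF.mem_support_map_iff _ _ _).1 hr
    refine hw _ _ _ _ _ ?_
    obtain ⟨w, -, rfl⟩ := (PMF.mem_support_map_iff _ _ _).1 hv
    have : w.toNat.size ≤ 1 := by cases w <;> simp
    omega
  | seq c₁ c₂ s D₁ D₂ h₁ h₂ ih₁ ih₂ =>
    intro r hr a x
    obtain ⟨r₁, hr₁, hr⟩ := (PMF.mem_support_bind_iff _ _ _).1 hr
    obtain ⟨r₂, hr₂, rfl⟩ := (PMF.mem_support_map_iff _ _ _).1 hr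
    have h1 := ih₁ r₁ hr₁ a x
    have h2 := ih₂ r₁ hr₁ r₂ hr₂ a x
    simp only [le_max_iff] at h1 h2 ⊢
    omega
  | ite_true e c₁ c₂ s D he h ih =>
    intro r hr a x
    obtain ⟨r₂, hr₂, rfl⟩ := (PMF.mem_support_map_iff _ _ _).1 hr
    have h1 := ih r₂ hr₂ a x
    simp only [le_max_iff] at h1 ⊢
    omega
  | ite_false e c₁ c₂ s D he h ih =>
    intro r hr a x
    obtain ⟨r₂, hr₂, rfl⟩ := (PMF.mem_support_map_iff _ _ _).1 hr
    have h1 := ih r₂ hr₂ a x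
    simp only [le_max_iff] at h1 ⊢
    omega
  | while_true e c s D₁ D₂ he h₁ h₂ ih₁ ih₂ =>
    intro r hr a x
    obtain ⟨r₁, hr₁, hr⟩ := (PMF.mem_support_bind_iff _ _ _).1 hr
    obtain ⟨r₂, hr₂, rfl⟩ := (PMF.mem_support_map_iff _ _ _).1 hr
    have h1 := ih₁ r₁ hr₁ a x
    have h2 := ih₂ r₁ hr₁ r₂ hr₂ a x
    simp only [le_max_iff] at h1 h2 ⊢
    omega
  | while_false e c s he =>
    intro r hr a x
    rw [PMF.mem_support_pure_iff] at hr
    subst hr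
    exact le_max_left _ _

theorem SimC.size_le {α : Type} {c : Cmd} {s : Store} {M : PMF α} {R : Store → ℕ → α → Prop}
    (h : SimC c s M R) :
    SimC c s M fun s' t v => R s' t v ∧ ∀ a x, (s' a x).size ≤ max (s a x).size t := by
  obtain ⟨J, h₁, h₂, h₃⟩ := h
  refine ⟨J, h₁, h₂, fun p hp => ⟨h₃ p hp, h₁.size_le p.1 ?_⟩⟩
  exact (PMF.mem_support_map_iff _ _ _).2 ⟨p, hp, rfl⟩

/-! ### Running a program in a stripe of the memory -/

/-- Scalar variable number `v`: cell `0` of array `v`. -/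
abbrev AExp.var (v : ℕ) : AExp := .get v (.lit 0)

/-- The first array used for the simulated memories. -/
abbrev simBase : ℕ := 40

/-- The address, within the simulated arrays, of the cell with address `e` of the current stripe:
the number of stripes is kept in variable `7`, the current stripe in variable `8`. -/
abbrev AExp.inStripe (e : AExp) : AExp := .bin .add (.bin .mul e (.var 7)) (.var 8)

/-- The expression with all memory accesses redirected to the current stripe. -/
def AExp.stripe : AExp → AExp
  | .lit c => .lit c
  | .get a e => .get (simBase + a) e.stripe.inStripe
  | .bin o e₁ e₂ => .bin o e₁.stripe e₂.stripe

/-- The program with all memory accesses redirected to the current stripe. Runs in different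
stripes do not interfere, so a stripe that has not been used is a blank memory. -/
def Cmd.stripe : Cmd → Cmd
  | .skip => .skip
  | .set a e₁ e₂ => .set (simBase + a) e₁.stripe.inStripe e₂.stripe
  | .rand a e₁ e₂ => .rand (simBase + a) e₁.stripe.inStripe e₂.stripe
  | .flip a e₁ q => .flip (simBase + a) e₁.stripe.inStripe q
  | .seq c₁ c₂ => .seq c₁.stripe c₂.stripe
  | .ite e c₁ c₂ => .ite e.stripe c₁.stripe c₂.stripe
  | .while e c => .while e.stripe c.stripe

theorem Cmd.UsesCoins.stripe {coins : Set ℝ} {c : Cmd} (h : c.UsesCoins coins) :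
    c.stripe.UsesCoins coins := by
  induction c with
  | skip => trivial
  | set a e₁ e₂ => trivial
  | rand a e₁ e₂ => trivial
  | flip a e₁ q => exact h
  | seq c₁ c₂ h₁ h₂ => exact ⟨h₁ h.1, h₂ h.2⟩
  | ite e c₁ c₂ h₁ h₂ => exact ⟨h₁ h.1, h₂ h.2⟩
  | _ =>
    rename_i ih
    exact ih h

/-- Stripe `c` of `K` of the memory `s'` holds the memory `s`. -/
structure InStripe (K c : ℕ) (s s' : Store) : Prop where
  lt : c < K
  stripes : s' 7 0 = K
  current : s' 8 0 = c
  cell : ∀ a x, s' (simBase + a) (x * K + c) = s a x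

/-- The memories `s` and `s'` differ only in stripe `c` of `K`. -/
structure EqOffStripe (K c : ℕ) (s s' : Store) : Prop where
  low : ∀ a < simBase, s' a = s a
  high : ∀ a x, x % K ≠ c → s' a x = s a x

theorem EqOffStripe.refl (K c : ℕ) (s : Store) : EqOffStripe K c s s :=
  ⟨fun _ _ => rfl, fun _ _ _ => rfl⟩

theorem EqOffStripe.trans {K c : ℕ} {s s' s'' : Store} (h : EqOffStripe K c s s')
    (h' : EqOffStripe K c s' s'') : EqOffStripe K c s s'' :=
  ⟨fun a ha => (h'.low a ha).trans (h.low a ha),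
    fun a x hx => (h'.high a x hx).trans (h.high a x hx)⟩

/-- The factor by which `K` stripes slow down a program. -/
def stripeFactor (K : ℕ) : ℕ := 10 * K.size + 10

section

variable {K c : ℕ} {s s' : Store}

theorem InStripe.val (h : InStripe K c s s') (e : AExp) : e.stripe.val s' = e.val s := by
  induction e with
  | lit c => rfl
  | get a e ih =>
    simp only [AExp.stripe, AExp.val, BinOp.apply, ih, h.stripes, h.current, h.cell]
  | bin o e₁ e₂ ih₁ ih₂ => simp only [AExp.stripe, AExp.val, ih₁, ih₂]

theorem InStripe.val_inStripe (h : InStripe K c s s') (e : AExp) :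
    e.stripe.inStripe.val s' = e.val s * K + c := by
  simp only [AExp.val, BinOp.apply, h.val, h.stripes, h.current]

theorem size_stripe_le (hc : c < K) (v : ℕ) : (v * K + c).size ≤ v.size + K.size := by
  rw [Nat.size_le, pow_add]
  calc v * K + c < (v + 1) * K := by rw [add_mul]; omega
    _ ≤ 2 ^ v.size * 2 ^ K.size :=
      Nat.mul_le_mul (Nat.lt_size_self v) (Nat.lt_size_self K).le

theorem InStripe.cost_inStripe_le (h : InStripe K c s s') (e : AExp) :
    e.stripe.inStripe.cost s' ≤ e.stripe.cost s' + 5 * (e.val s).size + 8 * K.size + 6 := by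
  have h1 := size_stripe_le h.lt (e.val s)
  have h2 : (e.val s * K).size ≤ (e.val s).size + K.size := size_mul_le _ _
  have h3 : c.size ≤ K.size := Nat.size_le_size h.lt.le
  simp only [AExp.cost, AExp.val, BinOp.apply, h.val, h.stripes, h.current, Nat.size_zero]
  omega

theorem InStripe.cost_le (h : InStripe K c s s') (e : AExp) :
    e.stripe.cost s' ≤ stripeFactor K * e.cost s := by
  induction e with
  | lit c => exact Nat.le_mul_of_pos_left _ (by simp [stripeFactor])
  | get a e ih =>
    have h1 := h.cost_inStripe_le e
    have h2 := size_stripe_le h.lt (e.val s)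
    rw [AExp.stripe, AExp.cost, h.val_inStripe, h.cell, AExp.cost]
    have h3 : stripeFactor K * (e.cost s + 1 + (e.val s).size + (s a (e.val s)).size) =
        stripeFactor K * e.cost s + stripeFactor K + stripeFactor K * (e.val s).size +
          stripeFactor K * (s a (e.val s)).size := by ring
    have h4 : 10 * (e.val s).size ≤ stripeFactor K * (e.val s).size :=
      Nat.mul_le_mul_right _ (by simp [stripeFactor])
    have h5 : 1 * (s a (e.val s)).size ≤ stripeFactor K * (s a (e.val s)).size :=
      Nat.mul_le_mul_right _ (by simp [stripeFactor])
    have h6 : stripeFactor K = 10 * K.size + 10 := rfl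
    omega
  | bin o e₁ e₂ ih₁ ih₂ =>
    simp only [AExp.stripe, AExp.cost, h.val]
    have h3 : ∀ x y z w : ℕ, stripeFactor K * (e₁.cost s + e₂.cost s + 1 + x + y + z) =
        stripeFactor K * e₁.cost s + stripeFactor K * e₂.cost s +
          stripeFactor K * (1 + x + y + z) := fun x y z _ => by ring
    rw [h3 _ _ _ 0]
    have h5 : ∀ x : ℕ, x ≤ stripeFactor K * x :=
      fun x => Nat.le_mul_of_pos_left _ (by simp [stripeFactor])
    have h6 := h5 (1 + (e₁.val s).size + (e₂.val s).size + (o.apply (e₁.val s) (e₂.val s)).size)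
    omega

theorem InStripe.write (h : InStripe K c s s') (a x v : ℕ) :
    InStripe K c (s.write a x v) (s'.write (simBase + a) (x * K + c) v) where
  lt := h.lt
  stripes := by
    unfold Store.write
    rw [if_neg (by simp only [simBase]; omega), h.stripes]
  current := by
    unfold Store.write
    rw [if_neg (by simp only [simBase]; omega), h.current]
  cell a' x' := by
    have hK : 0 < K := Nat.zero_lt_of_lt h.lt
    unfold Store.write
    by_cases h' : a' = a ∧ x' = x
    · rw [if_pos h', if_pos ⟨by rw [h'.1], by rw [h'.2]⟩]
    · rw [if_neg h', if_neg, h.cell]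
      rintro ⟨h1, h2⟩
      exact h' ⟨by omega, Nat.eq_of_mul_eq_mul_right hK (by omega)⟩

theorem EqOffStripe.write (hc : c < K) (a x v : ℕ) :
    EqOffStripe K c s (s.write (simBase + a) (x * K + c) v) where
  low a' ha' := by
    ext x'
    unfold Store.write
    rw [if_neg (by omega)]
  high a' x' hx' := by
    unfold Store.write
    rw [if_neg]
    rintro ⟨-, rfl⟩
    exact hx' (by rw [Nat.mul_comm, Nat.mul_add_mod, Nat.mod_eq_of_lt hc])

end

/-- The striped program does in its stripe what the original program does in its memory. -/
theorem Runs.stripe {K c : ℕ} {p : Cmd} {s : Store} {D : PMF (Store × ℕ)} (h : Runs p s D) :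
    ∀ s', InStripe K c s s' → SimC p.stripe s' D fun s₁' t' r =>
      t' ≤ stripeFactor K * r.2 ∧ InStripe K c r.1 s₁' ∧ EqOffStripe K c s' s₁' := by
  have hpos : ∀ x : ℕ, x ≤ stripeFactor K * x :=
    fun x => Nat.le_mul_of_pos_left _ (by simp [stripeFactor])
  have haddr : ∀ (s s' : Store) (e : AExp), InStripe K c s s' →
      e.stripe.inStripe.cost s' + 1 + (e.stripe.inStripe.val s').size ≤
        stripeFactor K * (e.cost s + 1 + (e.val s).size) := by
    intro s s' e h
    have h1 := h.cost_inStripe_le e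
    have h2 := size_stripe_le h.lt (e.val s)
    have h3 := h.cost_le e
    rw [h.val_inStripe]
    have h4 : 10 * (e.val s).size ≤ stripeFactor K * (e.val s).size :=
      Nat.mul_le_mul_right _ (by simp [stripeFactor])
    have h6 : stripeFactor K = 10 * K.size + 10 := rfl
    rw [mul_add, mul_add]
    omega
  induction h with
  | skip s =>
    intro s' hs
    exact SimC.pure (Runs.skip s') ⟨hpos 1, hs, EqOffStripe.refl _ _ _⟩
  | set s a e₁ e₂ =>
    intro s' hs
    refine SimC.pure (Runs.set s' _ _ _) ⟨?_, ?_, ?_⟩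
    · have h1 := haddr s s' e₁ hs
      have h2 := hs.cost_le e₂
      have h3 := hpos (e₂.val s).size
      rw [hs.val e₂]
      have : stripeFactor K * (e₁.cost s + e₂.cost s + 1 + (e₁.val s).size + (e₂.val s).size) =
        stripeFactor K * (e₁.cost s + 1 + (e₁.val s).size) + stripeFactor K * e₂.cost s +
          stripeFactor K * (e₂.val s).size := by ring
      simp only
      omega
    · rw [hs.val_inStripe, hs.val]
      exact hs.write _ _ _
    · rw [hs.val_inStripe]
      exact EqOffStripe.write hs.lt _ _ _
  | rand s a e₁ e₂ =>
    intro s' hs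
    have h := SimC.rand (s := s') (simBase + a) e₁.stripe.inStripe e₂.stripe
      (R := fun s₁' t' v =>
        t' ≤ stripeFactor K *
          (e₁.cost s + e₂.cost s + 1 + (e₁.val s).size + (e₂.val s).size) ∧
        InStripe K c (s.write a (e₁.val s) v) s₁' ∧ EqOffStripe K c s' s₁') ?_
    · rw [hs.val] at h
      exact h.map _ fun s₁' t' v h => h
    · intro v hv
      refine ⟨?_, ?_, ?_⟩
      · have h1 := haddr s s' e₁ hs
        have h2 := hs.cost_le e₂
        have h3 := hpos (e₂.val s).size
        rw [hs.val e₂]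
        have : stripeFactor K * (e₁.cost s + e₂.cost s + 1 + (e₁.val s).size + (e₂.val s).size) =
          stripeFactor K * (e₁.cost s + 1 + (e₁.val s).size) + stripeFactor K * e₂.cost s +
            stripeFactor K * (e₂.val s).size := by ring
        omega
      · rw [hs.val_inStripe]
        exact hs.write _ _ _
      · rw [hs.val_inStripe]
        exact EqOffStripe.write hs.lt _ _ _
  | flip s a e₁ q =>
    intro s' hs
    have h := SimC.flip (s := s') (simBase + a) e₁.stripe.inStripe q
      (R := fun s₁' t' v =>
        t' ≤ stripeFactor K * (e₁.cost s + 1 + (e₁.val s).size) ∧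
        InStripe K c (s.write a (e₁.val s) v) s₁' ∧ EqOffStripe K c s' s₁') ?_
    · exact h.map _ fun s₁' t' v h => h
    · intro v hv
      refine ⟨haddr s s' e₁ hs, ?_, ?_⟩
      · rw [hs.val_inStripe]
        exact hs.write _ _ _
      · rw [hs.val_inStripe]
        exact EqOffStripe.write hs.lt _ _ _
  | seq c₁ c₂ s D₁ D₂ h₁ h₂ ih₁ ih₂ =>
    intro s' hs
    refine SimC.seq (SimC.mono (ih₁ s' hs) (R' := fun s₁' t' r => r ∈ D₁.support ∧
      t' ≤ stripeFactor K * r.2 ∧ InStripe K c r.1 s₁' ∧ EqOffStripe K c s' s₁')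
      fun _ _ _ hr h => ⟨hr, h⟩) ?_
    rintro s₁' t r ⟨hr, ht, hin, hoff⟩
    refine SimC.map (ih₂ r hr s₁' hin) _ ?_
    rintro s₂' t₂ r₂ ⟨ht₂, hin₂, hoff₂⟩
    exact ⟨by rw [mul_add]; omega, hin₂, hoff.trans hoff₂⟩
  | ite_true e c₁ c₂ s D he h ih =>
    intro s' hs
    refine SimC.ite_true (by rwa [hs.val]) (SimC.map (ih s' hs) _ ?_)
    rintro s₁' t r ⟨ht, hin, hoff⟩
    have h1 := hs.cost_le e
    have h2 := hpos 1
    exact ⟨by simp only [mul_add]; omega, hin, hoff⟩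
  | ite_false e c₁ c₂ s D he h ih =>
    intro s' hs
    refine SimC.ite_false (by rwa [hs.val]) (SimC.map (ih s' hs) _ ?_)
    rintro s₁' t r ⟨ht, hin, hoff⟩
    have h1 := hs.cost_le e
    have h2 := hpos 1
    exact ⟨by simp only [mul_add]; omega, hin, hoff⟩
  | while_true e c' s D₁ D₂ he h₁ h₂ ih₁ ih₂ =>
    intro s' hs
    refine SimC.while_true (by rwa [hs.val]) (SimC.mono (ih₁ s' hs)
      (R' := fun s₁' t' r => r ∈ D₁.support ∧
      t' ≤ stripeFactor K * r.2 ∧ InStripe K c r.1 s₁' ∧ EqOffStripe K c s' s₁')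
      fun _ _ _ hr h => ⟨hr, h⟩) ?_
    rintro s₁' t r ⟨hr, ht, hin, hoff⟩
    refine SimC.map (ih₂ r hr s₁' hin) _ ?_
    rintro s₂' t₂ r₂ ⟨ht₂, hin₂, hoff₂⟩
    have h1 := hs.cost_le e
    have h2 := hpos 1
    exact ⟨by simp only [mul_add]; omega, hin₂, hoff.trans hoff₂⟩
  | while_false e c' s he =>
    intro s' hs
    refine SimC.pure (Runs.while_false _ _ s' (by rwa [hs.val])) ⟨?_, hs, EqOffStripe.refl _ _ _⟩
    have h1 := hs.cost_le e
    have h2 := hpos 1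
    simp only [mul_add]
    omega

/-! ### Addresses of the input bits -/

/-- Reading binary digits is a bijection from the strings of length `b` to the numbers below
`2 ^ b`. -/
def natOfBitsEquiv (b : ℕ) : (Fin b → Bool) ≃ Fin (2 ^ b) :=
  (Equiv.arrowCongr (Equiv.refl _) finTwoEquiv.symm).trans finFunctionFinEquiv

theorem natOfBitsEquiv_apply {b : ℕ} (w : Fin b → Bool) :
    (natOfBitsEquiv b w : ℕ) = natOfBits w := by
  rw [natOfBitsEquiv, Equiv.trans_apply, finFunctionFinEquiv_apply, natOfBits]
  refine Finset.sum_congr rfl fun a _ => ?_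
  simp only [Equiv.arrowCongr_apply, Equiv.refl_symm, Equiv.coe_refl, Function.comp_apply, id_eq]
  cases w a <;> rfl

theorem natOfBits_lt {b : ℕ} (w : Fin b → Bool) : natOfBits w < 2 ^ b := by
  rw [← natOfBitsEquiv_apply]
  exact (natOfBitsEquiv b w).2

theorem natOfBits_injective {b : ℕ} : Function.Injective (natOfBits (b := b)) := by
  intro w w' h
  rw [← natOfBitsEquiv_apply, ← natOfBitsEquiv_apply] at h
  exact (natOfBitsEquiv b).injective (Fin.ext h)

theorem exists_natOfBits_eq {b x : ℕ} (hx : x < 2 ^ b) : ∃ w : Fin b → Bool, natOfBits w = x :=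
  ⟨(natOfBitsEquiv b).symm ⟨x, hx⟩, by rw [← natOfBitsEquiv_apply, Equiv.apply_symm_apply]⟩

/-- The cell of the input array which says whether the string `w` belongs to the set number `l` of
vector number `i` of list number `j`. -/
def addr {b : ℕ} (n g j i l : ℕ) (w : Fin b → Bool) : ℕ :=
  ((j * n + i) * g + l) * 2 ^ b + natOfBits w

/-- The number of bits of the input. -/
abbrev numVars (k n g b : ℕ) : ℕ := k * n * g * 2 ^ b

theorem add_mul_lt {a c u v : ℕ} (hu : u < a) (hv : v < c) : u * c + v < a * c :=
  calc u * c + v < (u + 1) * c := by rw [add_mul]; omega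
    _ ≤ a * c := Nat.mul_le_mul_right c hu

theorem mul_add_div_of_lt {c u v : ℕ} (hv : v < c) : (u * c + v) / c = u := by
  rw [Nat.add_comm, Nat.add_mul_div_right _ _ (Nat.zero_lt_of_lt hv), Nat.div_eq_of_lt hv, zero_add]

theorem mul_add_mod_of_lt {c u v : ℕ} (hv : v < c) : (u * c + v) % c = v := by
  rw [Nat.add_comm, Nat.add_mul_mod_self_right, Nat.mod_eq_of_lt hv]

section Addr

variable {k n g b : ℕ}

theorem addr_lt (j : Fin k) (i : Fin n) (l : Fin g) (w : Fin b → Bool) :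
    addr n g j i l w < numVars k n g b :=
  add_mul_lt (add_mul_lt (add_mul_lt j.2 i.2) l.2) (natOfBits_lt w)

theorem addr_div_mod (j : Fin k) (i : Fin n) (l : Fin g) (w : Fin b → Bool) :
    addr n g j i l w / 2 ^ b % g = l := by
  rw [addr, mul_add_div_of_lt (natOfBits_lt w), mul_add_mod_of_lt l.2]

theorem addr_div (j : Fin k) (i : Fin n) (l : Fin g) (w : Fin b → Bool) :
    addr n g j i l w / (n * g * 2 ^ b) = j := by
  rw [addr, mul_comm (n * g), ← Nat.div_div_eq_div_mul, mul_add_div_of_lt (natOfBits_lt w),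
    mul_comm n, ← Nat.div_div_eq_div_mul, mul_add_div_of_lt l.2, mul_add_div_of_lt i.2]

theorem addr_injective {j j' : Fin k} {i i' : Fin n} {l l' : Fin g} {w w' : Fin b → Bool}
    (h : addr n g j i l w = addr n g j' i' l' w') : j = j' ∧ i = i' ∧ l = l' ∧ w = w' := by
  unfold addr at h
  have h1 := congrArg (· % 2 ^ b) h
  have h2 := congrArg (· / 2 ^ b) h
  simp only [mul_add_mod_of_lt (natOfBits_lt _), mul_add_div_of_lt (natOfBits_lt _)] at h1 h2
  have h3 := congrArg (· % g) h2
  have h4 := congrArg (· / g) h2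
  simp only [mul_add_mod_of_lt (Fin.is_lt _), mul_add_div_of_lt (Fin.is_lt _)] at h3 h4
  have h5 := congrArg (· % n) h4
  have h6 := congrArg (· / n) h4
  simp only [mul_add_mod_of_lt (Fin.is_lt _), mul_add_div_of_lt (Fin.is_lt _)] at h5 h6
  exact ⟨Fin.ext h6, Fin.ext h5, Fin.ext h3, natOfBits_injective h1⟩

theorem exists_addr_eq {x : ℕ} (hx : x < numVars k n g b) :
    ∃ (j : Fin k) (i : Fin n) (l : Fin g) (w : Fin b → Bool), addr n g j i l w = x := by
  have h1 : x / 2 ^ b < k * n * g := Nat.div_lt_of_lt_mul (by rwa [mul_comm])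
  have h2 : x / 2 ^ b / g < k * n := Nat.div_lt_of_lt_mul (by rwa [mul_comm])
  have h3 : x / 2 ^ b / g / n < k := Nat.div_lt_of_lt_mul (by rwa [mul_comm])
  have hg : 0 < g := by
    rcases Nat.eq_zero_or_pos g with h | h
    · subst h; simp at h1
    · exact h
  have hn : 0 < n := by
    rcases Nat.eq_zero_or_pos n with h | h
    · subst h; simp at h2
    · exact h
  obtain ⟨w, hw⟩ := exists_natOfBits_eq (Nat.mod_lt x (Nat.two_pow_pos b))
  refine ⟨⟨_, h3⟩, ⟨_, Nat.mod_lt (x / 2 ^ b / g) hn⟩, ⟨_, Nat.mod_lt (x / 2 ^ b) hg⟩, w, ?_⟩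
  simp only [addr, hw]
  rw [Nat.div_add_mod', Nat.div_add_mod', Nat.div_add_mod']

/-- The instance with the given input bits. -/
def bitsInst (k n g b : ℕ) (z : ℕ → Bool) : Inst k n g b := fun j i l =>
  Finset.univ.filter fun w => z (addr n g j i l w) = true

open Classical in
/-- The input bits of an instance. -/
noncomputable def instBits (I : Inst k n g b) (x : ℕ) : Bool :=
  decide (∃ (j : Fin k) (i : Fin n) (l : Fin g) (w : Fin b → Bool),
    x = addr n g j i l w ∧ w ∈ I j i l)

theorem instBits_addr (I : Inst k n g b) (j : Fin k) (i : Fin n) (l : Fin g) (w : Fin b → Bool) :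
    instBits I (addr n g j i l w) = decide (w ∈ I j i l) := by
  rw [instBits, decide_eq_decide]
  constructor
  · rintro ⟨j', i', l', w', h, hw⟩
    obtain ⟨rfl, rfl, rfl, rfl⟩ := addr_injective h
    exact hw
  · exact fun h => ⟨j, i, l, w, rfl, h⟩

theorem bitsInst_instBits (I : Inst k n g b) : bitsInst k n g b (instBits I) = I := by
  funext j i l
  ext w
  simp [bitsInst, instBits_addr]

theorem instBits_bitsInst (z : ℕ → Bool) {x : ℕ} (hx : x < numVars k n g b) :
    instBits (bitsInst k n g b z) x = z x := by
  obtain ⟨j, i, l, w, rfl⟩ := exists_addr_eq hx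
  rw [instBits_addr]
  simp [bitsInst]

theorem instBits_of_le (I : Inst k n g b) {x : ℕ} (hx : numVars k n g b ≤ x) :
    instBits I x = false := by
  rw [instBits, decide_eq_false_iff_not]
  rintro ⟨j, i, l, w, rfl, -⟩
  exact absurd (addr_lt j i l w) (by omega)

theorem bitsInst_congr {z z' : ℕ → Bool} (h : ∀ x < numVars k n g b, z x = z' x) :
    bitsInst k n g b z = bitsInst k n g b z' := by
  funext j i l
  ext w
  simp [bitsInst, h _ (addr_lt j i l w)]

theorem inputStore_one (I : Inst k n g b) (x : ℕ) : inputStore I 1 x = (instBits I x).toNat := by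
  unfold inputStore instBits addr
  rw [if_neg one_ne_zero, if_pos rfl]
  split_ifs with h
  · rw [decide_eq_true h]; rfl
  · rw [decide_eq_false h]; rfl

@[to_additive sum_range_mul]
theorem prod_range_mul {M : Type*} [CommMonoid M] (φ : ℕ → M) (a c : ℕ) :
    ∏ x ∈ Finset.range (a * c), φ x =
      ∏ u ∈ Finset.range a, ∏ v ∈ Finset.range c, φ (u * c + v) := by
  induction a with
  | zero => simp
  | succ a ih => rw [add_mul, one_mul, Finset.prod_range_add, Finset.prod_range_succ, ih]

theorem prod_addr {M : Type*} [CommMonoid M] (φ : ℕ → M) :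
    ∏ j : Fin k, ∏ i : Fin n, ∏ l : Fin g, ∏ w : Fin b → Bool, φ (addr n g j i l w) =
      ∏ x ∈ Finset.range (numVars k n g b), φ x := by
  rw [prod_range_mul, prod_range_mul, prod_range_mul, Finset.prod_range]
  refine Finset.prod_congr rfl fun j _ => ?_
  rw [Finset.prod_range]
  refine Finset.prod_congr rfl fun i _ => ?_
  rw [Finset.prod_range]
  refine Finset.prod_congr rfl fun l _ => ?_
  rw [Finset.prod_range, ← (natOfBitsEquiv b).prod_comp]
  simp only [natOfBitsEquiv_apply, addr]

theorem instMass_bitsInst (μ : ℝ) (z : ℕ → Bool) :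
    instMass μ (bitsInst k n g b z) =
      ∏ x ∈ Finset.range (numVars k n g b), if z x = true then μ else 1 - μ := by
  rw [← prod_addr]
  simp [instMass, vectorMass, setMass, bitsInst]

end Addr

/-! ### The count as a multilinear form -/

/-- The count as a form in integer variables, one for each input bit. It is linear in the
variables that belong to the same list and the same coordinate. -/
def countForm {k n g b : ℕ} (f : (Fin k → Fin b → Bool) → Bool)
    (X : Fin k → Fin n → Fin g → (Fin b → Bool) → ℤ) : ℤ :=
  ∑ c : Fin k → Fin n, ∏ l : Fin g, ∑ w : Fin k → Fin b → Bool,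
    (if f w = true then 1 else 0) * ∏ j : Fin k, X j (c j) l (w j)

section Form

variable {k n g b : ℕ} (f : (Fin k → Fin b → Bool) → Bool)

theorem count_eq_countForm (I : Inst k n g b) :
    (count f I : ℤ) = countForm f fun j i l w => if w ∈ I j i l then 1 else 0 := by
  simp only [count, bigCirc, circ, countForm, Nat.cast_sum, Nat.cast_prod]
  refine Finset.sum_congr rfl fun c _ => Finset.prod_congr rfl fun l _ => ?_
  have : Fintype.piFinset (fun j => I j (c j) l) =
      Finset.univ.filter fun w => ∀ j, w j ∈ I j (c j) l := by
    ext w; simp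
  rw [this, Finset.sum_filter]
  refine Finset.sum_congr rfl fun w _ => ?_
  rw [Finset.prod_ite_zero]
  by_cases h : ∀ j, w j ∈ I j (c j) l <;> simp [h]

theorem count_bitsInst (z : ℕ → Bool) :
    (count f (bitsInst k n g b z) : ℤ) =
      countForm f fun (j : Fin k) (i : Fin n) (l : Fin g) (w : Fin b → Bool) =>
        ((z (addr n g j i l w)).toNat : ℤ) := by
  rw [count_eq_countForm]
  congr 1
  funext j i l w
  cases h : z (addr n g j i l w) <;> simp [bitsInst, h]

/-- Expanding the form in all blocks of variables. -/
theorem countForm_sum {t : ℕ} (c : Fin t → ℤ)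
    (Z : Fin t → Fin k → Fin n → Fin g → (Fin b → Bool) → ℤ) :
    countForm f (fun j i l w => ∑ e, c e * Z e j i l w) =
      ∑ E : Fin g → Fin k → Fin t,
        (∏ l, ∏ j, c (E l j)) * countForm f fun j i l w => Z (E l j) j i l w := by
  simp only [countForm]
  simp_rw [Finset.mul_sum]
  rw [Finset.sum_comm]
  refine Finset.sum_congr rfl fun x _ => ?_
  simp_rw [← Finset.prod_mul_distrib]
  have h : ∀ l : Fin g, (∑ w : Fin k → Fin b → Bool, (if f w = true then 1 else 0) *
      ∏ j : Fin k, ∑ e, c e * Z e j (x j) l (w j)) =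
      ∑ E : Fin k → Fin t, (∏ j, c (E j)) * ∑ w : Fin k → Fin b → Bool,
        (if f w = true then 1 else 0) * ∏ j : Fin k, Z (E j) j (x j) l (w j) := by
    intro l
    simp_rw [Finset.prod_univ_sum, Finset.mul_sum]
    rw [Finset.sum_comm]
    simp only [Fintype.piFinset_univ]
    refine Finset.sum_congr rfl fun E _ => Finset.sum_congr rfl fun w _ => ?_
    rw [Finset.prod_mul_distrib]
    ring
  simp_rw [h]
  rw [Finset.prod_univ_sum]
  simp only [Fintype.piFinset_univ]

/-- Digit number `B` of `a` in base `t`. -/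
abbrev digit (t a B : ℕ) : ℕ := a / t ^ B % t

/-- The expansion of the form, with the choices of one summand for each block encoded as the digits
of a number. -/
theorem countForm_sum_digits {t : ℕ} (c : ℕ → ℤ)
    (Z : ℕ → Fin k → Fin n → Fin g → (Fin b → Bool) → ℤ) :
    countForm f (fun j i l w => ∑ e ∈ Finset.range t, c e * Z e j i l w) =
      ∑ a ∈ Finset.range (t ^ (g * k)), (∏ B ∈ Finset.range (g * k), c (digit t a B)) *
        countForm f fun j i l w => Z (digit t a (l * k + j)) j i l w := by
  simp_rw [Finset.sum_range]
  rw [countForm_sum f (fun e : Fin t => c e) fun e : Fin t => Z e]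
  let φ : Fin (t ^ (g * k)) ≃ (Fin g → Fin k → Fin t) :=
    (finFunctionFinEquiv.symm.trans (Equiv.arrowCongr finProdFinEquiv.symm (Equiv.refl _))).trans
      (Equiv.curry _ _ _)
  have hφ : ∀ a l j, (φ a l j : ℕ) = digit t a (l * k + j) := by
    intro a l j
    simp [φ, finFunctionFinEquiv, finProdFinEquiv, digit, add_comm, mul_comm]
  rw [← φ.sum_comp]
  refine Finset.sum_congr rfl fun a _ => ?_
  simp only [hφ]
  congr 1
  rw [prod_range_mul, Finset.prod_range]
  refine Finset.prod_congr rfl fun l _ => ?_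
  rw [Finset.prod_range]

end Form

/-! ### Splitting a bit into balanced bits -/

/-- The random choices made for one input bit: a coin, a biased bit, the index of a pair and a
number (one less than the number whose power of two determines the carries). -/
abbrev Sample : Type := Bool × Bool × ℕ × ℕ

/-- The coefficient of summand number `e`: the summands come in levels of `m` pairs, those of
level `j` having the coefficients `2 ^ j` and `-2 ^ j`. -/
def splitCoeff (m e : ℕ) : ℤ := (-1) ^ (e % 2) * 2 ^ (e / (2 * m))

/-- Bit number `e` in the splitting of the bit `y`. Both bits of a pair agree, except for one pair
in each level `j` with `2 ^ j ∣ u + 1`, and these only if `y = 1`. -/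
def splitBit (m : ℕ) (y : Bool) (v : Sample) (e : ℕ) : Bool :=
  if y = true ∧ 2 ^ (e / (2 * m)) ∣ v.2.2.2 + 1 then
    if e / 2 % m = v.2.2.1 then decide (2 ^ (e / (2 * m) + 1) ∣ v.2.2.2 + 1 ↔ e % 2 = 1)
    else v.2.1
  else v.1

/-- The split bits add up to the original bit: the one unequal pair of level `j` contributes
`2 ^ j` or `-2 ^ j`, and the sum telescopes. -/
theorem sum_splitBit {m s : ℕ} (y : Bool) {v : Sample} (hq : v.2.2.1 < m)
    (hu : v.2.2.2 + 1 < 2 ^ s) :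
    ∑ e ∈ Finset.range (2 * m * s), splitCoeff m e * ((splitBit m y v e).toNat : ℤ) =
      (y.toNat : ℤ) := by
  obtain ⟨al, be, q, u⟩ := v
  simp only at hq hu
  have hm : 0 < m := by omega
  have hlevel : ∀ j, (∑ p ∈ Finset.range (2 * m), splitCoeff m (j * (2 * m) + p) *
      ((splitBit m y (al, be, q, u) (j * (2 * m) + p)).toNat : ℤ)) =
      if y = true then (if 2 ^ j ∣ u + 1 then 2 ^ j else 0) -
        (if 2 ^ (j + 1) ∣ u + 1 then 2 ^ (j + 1) else 0) else 0 := by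
    intro j
    rw [show 2 * m = m * 2 by ring, sum_range_mul]
    have hpair : ∀ p ∈ Finset.range m, (∑ x ∈ Finset.range 2,
        splitCoeff m (j * (m * 2) + (p * 2 + x)) *
        ((splitBit m y (al, be, q, u) (j * (m * 2) + (p * 2 + x))).toNat : ℤ)) =
        if p = q then (if y = true then (if 2 ^ j ∣ u + 1 then 2 ^ j else 0) -
        (if 2 ^ (j + 1) ∣ u + 1 then 2 ^ (j + 1) else 0) else 0) else 0 := by
      intro p hp
      have hp : p < m := Finset.mem_range.1 hp
      have e1 : ∀ x < 2, (j * (m * 2) + (p * 2 + x)) / (2 * m) = j := by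
        intro x hx
        rw [mul_comm 2 m]
        exact mul_add_div_of_lt (by omega)
      have e2 : ∀ x < 2, (j * (m * 2) + (p * 2 + x)) / 2 % m = p := by
        intro x hx
        rw [show j * (m * 2) + (p * 2 + x) = (j * m + p) * 2 + x by ring, mul_add_div_of_lt hx,
          mul_add_mod_of_lt hp]
      have e3 : ∀ x < 2, (j * (m * 2) + (p * 2 + x)) % 2 = x := by
        intro x hx
        rw [show j * (m * 2) + (p * 2 + x) = (j * m + p) * 2 + x by ring, mul_add_mod_of_lt hx]
      rw [Finset.sum_range_succ, Finset.sum_range_one]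
      simp only [splitCoeff, splitBit, e1 0 (by norm_num), e1 1 (by norm_num), e2 0 (by norm_num),
        e2 1 (by norm_num), e3 0 (by norm_num), e3 1 (by norm_num)]
      have hdvd : 2 ^ (j + 1) ∣ u + 1 → 2 ^ j ∣ u + 1 :=
        fun h => (pow_dvd_pow 2 (Nat.le_succ j)).trans h
      by_cases hy : y = true <;> by_cases h1 : 2 ^ j ∣ u + 1 <;>
        by_cases h2 : 2 ^ (j + 1) ∣ u + 1 <;> by_cases h3 : p = q <;>
        simp_all [pow_succ] <;> ring
    rw [Finset.sum_congr rfl hpair, Finset.sum_ite_eq' _ q, if_pos (Finset.mem_range.2 hq)]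
  rw [mul_comm (2 * m) s, sum_range_mul, Finset.sum_congr rfl fun j _ => hlevel j]
  cases y with
  | false => simp
  | true =>
    simp only [if_true, Bool.toNat_true, Nat.cast_one]
    rw [Finset.sum_range_sub' (fun j => if 2 ^ j ∣ u + 1 then (2 : ℤ) ^ j else 0)]
    have hs : ¬ 2 ^ s ∣ u + 1 := fun h => absurd (Nat.le_of_dvd (Nat.succ_pos u) h) hu.not_ge
    simp [hs]

/-- The instance for query number `a`: the bits of each block are replaced by the corresponding
split bits, whose number is a digit of `a`. -/
def queryInst (k n g b m t : ℕ) (y : ℕ → Bool) (a : ℕ) (v : ℕ → Sample) : Inst k n g b :=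
  bitsInst k n g b fun x =>
    splitBit m (y x) (v x) (digit t a (x / 2 ^ b % g * k + x / (n * g * 2 ^ b)))

/-- The counts of the queries determine the count of the given instance. -/
theorem sum_count_queryInst {k n g b m s : ℕ} (f : (Fin k → Fin b → Bool) → Bool)
    (I : Inst k n g b) {v : ℕ → Sample}
    (hv : ∀ x < numVars k n g b, (v x).2.2.1 < m ∧ (v x).2.2.2 + 1 < 2 ^ s) :
    ∑ a ∈ Finset.range ((2 * m * s) ^ (g * k)),
      (∏ B ∈ Finset.range (g * k), splitCoeff m (digit (2 * m * s) a B)) *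
        (count f (queryInst k n g b m (2 * m * s) (instBits I) a v) : ℤ) = count f I := by
  conv_rhs => rw [← bitsInst_instBits I, count_bitsInst]
  have : (fun (j : Fin k) (i : Fin n) (l : Fin g) (w : Fin b → Bool) =>
      ((instBits I (addr n g j i l w)).toNat : ℤ)) =
          fun (j : Fin k) (i : Fin n) (l : Fin g) (w : Fin b → Bool) =>
        ∑ e ∈ Finset.range (2 * m * s), splitCoeff m e *
          ((splitBit m (instBits I (addr n g j i l w)) (v (addr n g j i l w)) e).toNat : ℤ) := by
    funext j i l w
    obtain ⟨h1, h2⟩ := hv _ (addr_lt j i l w)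
    rw [sum_splitBit _ h1 h2]
  rw [this, countForm_sum_digits f (splitCoeff m) fun e j i l w =>
    ((splitBit m (instBits I (addr n g j i l w)) (v (addr n g j i l w)) e).toNat : ℤ)]
  refine Finset.sum_congr rfl fun a _ => ?_
  rw [queryInst, count_bitsInst]
  simp only [addr_div_mod, addr_div]

open scoped ENNReal

/-! ### Expectations -/

/-- The expectation of `f` under `p`. -/
noncomputable def expect {α : Type} (p : PMF α) (f : α → ℝ≥0∞) : ℝ≥0∞ := ∑' a, p a * f a

section Expect

variable {α β : Type}

theorem expect_pure (a : α) (f : α → ℝ≥0∞) : expect (PMF.pure a) f = f a := by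
  rw [expect, tsum_eq_single a]
  · simp
  · intro b hb
    simp [hb]

theorem expect_bind (p : PMF α) (g : α → PMF β) (f : β → ℝ≥0∞) :
    expect (p.bind g) f = expect p fun a => expect (g a) f := by
  simp only [expect, PMF.bind_apply, ← ENNReal.tsum_mul_right, ← ENNReal.tsum_mul_left]
  rw [ENNReal.tsum_comm]
  simp only [mul_assoc]

theorem expect_map (p : PMF α) (g : α → β) (f : β → ℝ≥0∞) :
    expect (p.map g) f = expect p fun a => f (g a) := by
  rw [← PMF.bind_pure_comp, expect_bind]
  simp only [Function.comp_apply, expect_pure]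

theorem expect_mono {p : PMF α} {f g : α → ℝ≥0∞} (h : ∀ a ∈ p.support, f a ≤ g a) :
    expect p f ≤ expect p g := by
  refine ENNReal.tsum_le_tsum fun a => ?_
  by_cases ha : p a = 0
  · simp [ha]
  · gcongr
    exact h a ((PMF.mem_support_iff _ _).2 ha)

theorem expect_add (p : PMF α) (f g : α → ℝ≥0∞) :
    expect p (fun a => f a + g a) = expect p f + expect p g := by
  simp only [expect, mul_add, ENNReal.tsum_add]

theorem expect_const_mul (p : PMF α) (c : ℝ≥0∞) (f : α → ℝ≥0∞) :
    expect p (fun a => c * f a) = c * expect p f := by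
  simp only [expect, ← ENNReal.tsum_mul_left, mul_left_comm]

theorem expect_mul_const (p : PMF α) (c : ℝ≥0∞) (f : α → ℝ≥0∞) :
    expect p (fun a => f a * c) = expect p f * c := by
  simp only [mul_comm _ c, expect_const_mul]

theorem expect_const (p : PMF α) (c : ℝ≥0∞) : expect p (fun _ => c) = c := by
  simp only [expect, ENNReal.tsum_mul_right, p.tsum_coe, one_mul]

theorem expect_sum {ι : Type*} (p : PMF α) (S : Finset ι) (f : ι → α → ℝ≥0∞) :
    expect p (fun a => ∑ i ∈ S, f i a) = ∑ i ∈ S, expect p (f i) := by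
  classical
  induction S using Finset.induction_on with
  | empty => simp [expect]
  | insert i S hi ih => simp only [Finset.sum_insert hi, expect_add, ih]

theorem expect_fintype [Fintype α] (p : PMF α) (f : α → ℝ≥0∞) :
    expect p f = ∑ a, p a * f a := tsum_fintype _

theorem expect_ite_eq [DecidableEq α] (p : PMF α) (a : α) :
    expect p (fun b => if b = a then 1 else 0) = p a := by
  rw [expect, tsum_eq_single a]
  · simp
  · intro b hb
    simp [hb]

theorem expect_uniformUpTo (m : ℕ) {F : ℕ → ℝ} (hF : ∀ v, 0 ≤ F v) :
    expect (uniformUpTo m) (fun v => ENNReal.ofReal (F v)) =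
      ENNReal.ofReal ((∑ v ∈ Finset.range (m + 1), F v) / (m + 1)) := by
  have h : ∀ v, uniformUpTo m v =
      if v ∈ Finset.range (m + 1) then ((m + 1 : ℕ) : ℝ≥0∞)⁻¹ else 0 := by
    intro v
    refine (PMF.uniformOfFinset_apply ⟨0, Finset.mem_range.2 (Nat.succ_pos m)⟩ v).trans ?_
    rw [Finset.card_range]
    congr 1
  rw [expect, tsum_eq_sum (s := Finset.range (m + 1))]
  · have h' : ((m + 1 : ℕ) : ℝ≥0∞)⁻¹ = ENNReal.ofReal ((m + 1 : ℝ)⁻¹) := by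
      rw [ENNReal.ofReal_inv_of_pos (by positivity)]
      congr 1
      rw [← ENNReal.ofReal_natCast]
      norm_cast
    rw [Finset.sum_congr rfl fun v hv => by rw [h v, if_pos hv, h',
        ← ENNReal.ofReal_mul (by positivity)],
      ← ENNReal.ofReal_sum_of_nonneg (fun v _ => mul_nonneg (by positivity) (hF v)),
          ← Finset.mul_sum]
    congr 1
    rw [div_eq_inv_mul]
  · intro v hv
    rw [h v, if_neg hv, zero_mul]

end Expect

/-- A Boolean that is true with probability `q`. -/
noncomputable def bern (q : unitInterval) : PMF Bool :=
  (coin q).map fun v => decide (v = 1)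

theorem expect_bern (q : unitInterval) (f : Bool → ℝ≥0∞) :
    expect (bern q) f = ENNReal.ofReal q * f true + ENNReal.ofReal (1 - q) * f false := by
  rw [bern, coin, PMF.map_comp, expect_map, expect_fintype, Fintype.sum_bool]
  simp [PMF.ofFintype_apply]

theorem bern_apply (q : unitInterval) (v : Bool) :
    bern q v = ENNReal.ofReal (if v = true then (q : ℝ) else 1 - q) := by
  rw [← expect_ite_eq, expect_bern]
  cases v <;> simp

theorem expect_bern_ofReal (q : unitInterval) {F : Bool → ℝ} (hF : ∀ v, 0 ≤ F v) :
    expect (bern q) (fun v => ENNReal.ofReal (F v)) =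
      ENNReal.ofReal (q * F true + (1 - q) * F false) := by
  rw [expect_bern, ← ENNReal.ofReal_mul q.2.1, ← ENNReal.ofReal_mul (sub_nonneg.2 q.2.2),
    ← ENNReal.ofReal_add (mul_nonneg q.2.1 (hF _)) (mul_nonneg (sub_nonneg.2 q.2.2) (hF _))]

/-- A coin with rational bias can be simulated by comparing a random integer with the numerator. -/
theorem uniformUpTo_map_lt_eq_bern (q : unitInterval) {x y : ℕ} (hy : 0 < y) (hxy : x ≤ y)
    (hq : (q : ℝ) = x / y) :
    (uniformUpTo (y - 1)).map (fun v => decide (v < x)) = bern q := by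
  have hT : (uniformUpTo (y - 1)).map (fun v => decide (v < x)) true = ENNReal.ofReal q := by
    rw [← expect_ite_eq, expect_map]
    have : (fun v : ℕ => if decide (v < x) = true then (1 : ℝ≥0∞) else 0) =
        fun v => ENNReal.ofReal (if v < x then 1 else 0) := by
      funext v
      by_cases h : v < x <;> simp [h]
    rw [this, expect_uniformUpTo _ (fun v => by split_ifs <;> norm_num), Nat.sub_add_cancel hy,
      Finset.sum_boole, hq]
    have h2 : (Finset.range y).filter (fun v => v < x) = Finset.range x := by
      ext v; simp; omega
    rw [h2, Finset.card_range, Nat.cast_sub hy]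
    simp
  have hsum : ∀ p : PMF Bool, p true + p false = 1 := fun p => by
    rw [← Fintype.sum_bool, ← tsum_fintype (L := SummationFilter.unconditional _), p.tsum_coe]
  ext v
  cases v with
  | true => rw [hT, bern_apply, if_pos rfl]
  | false =>
    have h1 := hsum ((uniformUpTo (y - 1)).map (fun v => decide (v < x)))
    have h2 := hsum (bern q)
    rw [hT] at h1
    rw [bern_apply q true, if_pos rfl] at h2
    exact (ENNReal.add_right_inj ENNReal.ofReal_ne_top).1 (h1.trans h2.symm)

/-! ### The law of the split bits -/

/-- The number of heads in `n` coin flips. -/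
noncomputable def headCount (q : unitInterval) (n : ℕ) : PMF ℕ :=
  iterFrom (fun _ w => (bern q).map fun c => w + c.toNat) 0 n 0

theorem expect_headCount (q : unitInterval) (n : ℕ) (A B C θ : ℝ)
    (h : ∀ w : ℕ, 0 ≤ A + B * w + C * θ ^ w) :
    expect (headCount q n) (fun w => ENNReal.ofReal (A + B * w + C * θ ^ w)) =
      ENNReal.ofReal (A + B * (n * q) + C * (1 - q + q * θ) ^ n) := by
  unfold headCount
  induction n generalizing A C with
  | zero => simp [iterFrom, expect_pure]
  | succ n ih =>
    have h1 : ∀ w : ℕ, (q : ℝ) * (A + B * (w + 1 : ℕ) + C * θ ^ (w + 1)) +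
        (1 - q) * (A + B * w + C * θ ^ w) =
        (A + B * q) + B * w + (C * (1 - q + q * θ)) * θ ^ w := by
      intro w
      push_cast
      ring
    rw [iterFrom_succ, expect_bind]
    have h2 : ∀ w : ℕ, expect ((bern q).map fun c => w + c.toNat)
        (fun w => ENNReal.ofReal (A + B * w + C * θ ^ w)) =
        ENNReal.ofReal ((A + B * q) + B * w + (C * (1 - q + q * θ)) * θ ^ w) := by
      intro w
      rw [expect_map, expect_bern_ofReal q (F := fun c =>
        A + B * ((w + c.toNat : ℕ) : ℝ) + C * θ ^ (w + c.toNat)) fun c => h _]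
      simp only [Bool.toNat_true, Bool.toNat_false, Nat.add_zero]
      rw [h1]
    simp only [h2]
    rw [ih]
    · congr 1
      push_cast
      ring
    · intro w
      rw [← h1]
      exact add_nonneg (mul_nonneg q.2.1 (h _)) (mul_nonneg (sub_nonneg.2 q.2.2) (h _))

/-- The random choices for one input bit. The second bit compares a random number with the
number of heads in `2 m s` flips of the coin, so that its bias is very close to a linear function of
the bias of the coin: such a bit compensates for the unequal pairs, in which each bit is fair. -/
noncomputable def drawSample (q : unitInterval) (m s : ℕ) : PMF Sample :=
  (headCount q (2 * m * s)).bind fun W => (bern q).bind fun al =>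
    (uniformUpTo (s * (2 * m - 2) - 1)).bind fun V => (uniformUpTo (m - 1)).bind fun p =>
      (uniformUpTo (2 ^ s - 2)).map fun u => (al, decide (V < W - s), p, u)

theorem of_mem_support_drawSample {q : unitInterval} {m s : ℕ} (hm : 0 < m) (hs : 0 < s)
    {v : Sample} (hv : v ∈ (drawSample q m s).support) :
    v.2.2.1 < m ∧ v.2.2.2 + 1 < 2 ^ s := by
  simp only [drawSample, PMF.mem_support_bind_iff, PMF.mem_support_map_iff,
    mem_support_uniformUpTo] at hv
  obtain ⟨W, -, al, -, V, -, p, hp, u, hu, rfl⟩ := hv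
  have : 2 ^ 1 ≤ 2 ^ s := Nat.pow_le_pow_right (by norm_num) hs
  exact ⟨by simp only; omega, by simp only; omega⟩

/-- The probability of the outcome `v` of a coin with bias `q`. -/
noncomputable def bernMass (q : ℝ) (v : Bool) : ℝ := if v = true then q else 1 - q

/-- `m` is large enough, in terms of the bias `q`, for the compensation to work. -/
structure EnoughPairs (q : ℝ) (m : ℕ) : Prop where
  two_le : 2 ≤ m
  head : (1 - q / 2) ^ (2 * m) ≤ 1 / 4
  tail : ((1 + q) / 2) ^ (2 * m) ≤ 1 / 4

theorem exists_enoughPairs {q : ℝ} (h0 : 0 < q) (h1 : q < 1) : ∃ m, EnoughPairs q m := by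
  obtain ⟨a, ha⟩ := exists_pow_lt_of_lt_one (show (0 : ℝ) < 1 / 4 by norm_num)
    (show 1 - q / 2 < 1 by linarith)
  obtain ⟨b, hb⟩ := exists_pow_lt_of_lt_one (show (0 : ℝ) < 1 / 4 by norm_num)
    (show (1 + q) / 2 < 1 by linarith)
  refine ⟨a + b + 2, by omega, ?_, ?_⟩
  · exact (pow_le_pow_of_le_one (by linarith) (by linarith) (by omega)).trans ha.le
  · exact (pow_le_pow_of_le_one (by linarith) (by linarith) (by omega)).trans hb.le

section Marginal

variable {q : unitInterval} {m s : ℕ}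

/-- The bias of the compensating bit, up to the (exponentially small) effect of truncation. -/
theorem expect_compensation_le (hm : EnoughPairs q m) (hs : 0 < s) (v : Bool) :
    expect (headCount q (2 * m * s)) (fun W => ENNReal.ofReal
      (bernMass (min (W - s : ℕ) (s * (2 * m - 2) : ℕ) / (s * (2 * m - 2) : ℕ)) v)) ≤
    ENNReal.ofReal (bernMass ((2 * m * q - 1) / (2 * m - 2)) v + 1 / 2 ^ s) := by
  have hm2 : (2 : ℝ) ≤ m := by exact_mod_cast hm.two_le
  have hs1 : (1 : ℝ) ≤ s := by exact_mod_cast hs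
  have hc : ((s * (2 * m - 2) : ℕ) : ℝ) = s * (2 * m - 2) := by
    rw [Nat.cast_mul, Nat.cast_sub (by have := hm.two_le; omega)]
    push_cast; ring
  have hM : (1 : ℝ) ≤ 2 * m - 2 := by linarith
  have hcpos : (1 : ℝ) ≤ s * (2 * m - 2) := one_le_mul_of_one_le_of_one_le hs1 hM
  simp only [Nat.cast_min, hc]
  set c : ℝ := s * (2 * m - 2) with hcdef
  have hcs : (s : ℝ) ≤ c := by rw [hcdef]; nlinarith
  cases v with
  | true =>
    simp only [bernMass, if_true]
    -- Below the threshold `s` the linear function is negative; the error is dominated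
    -- by an exponential moment.
    have key : ∀ W : ℕ, min ((W - s : ℕ) : ℝ) c / c ≤
        (-(s / c)) + 1 / c * W + 2 ^ s * (1 / 2) ^ W := by
      intro W
      have h3 : -(s / c) + 1 / c * W = ((W : ℝ) - s) / c := by ring
      rw [h3]
      by_cases hW : s ≤ W
      · rw [Nat.cast_sub hW]
        have h1 : min ((W : ℝ) - s) c / c ≤ ((W : ℝ) - s) / c := by
          gcongr; exact min_le_left _ _
        have : (0 : ℝ) ≤ 2 ^ s * (1 / 2) ^ W := by positivity
        linarith
      · have hW' : W < s := by omega
        rw [Nat.sub_eq_zero_of_le hW'.le, Nat.cast_zero, min_eq_left (by linarith), zero_div]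
        have h1 : (2 : ℝ) ^ s * (1 / 2) ^ W = 2 ^ (s - W) := by
          rw [one_div, inv_pow, pow_sub₀ _ (by norm_num) hW'.le]
        have h2 : (1 : ℝ) ≤ 2 ^ (s - W) := one_le_pow₀ (by norm_num)
        have h4 : -1 ≤ ((W : ℝ) - s) / c := by
          rw [le_div_iff₀ (by linarith)]
          have : (0 : ℝ) ≤ W := Nat.cast_nonneg W
          linarith
        linarith
    have hnn : ∀ W : ℕ, 0 ≤ (-(s / c)) + 1 / c * W + 2 ^ s * (1 / 2 : ℝ) ^ W := fun W =>
      le_trans (div_nonneg (le_min (Nat.cast_nonneg _) (by linarith)) (by linarith)) (key W)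
    refine (expect_mono fun W _ => ENNReal.ofReal_le_ofReal (key W)).trans ?_
    rw [expect_headCount q _ _ _ _ _ hnn]
    refine ENNReal.ofReal_le_ofReal ?_
    have h1 : (2 : ℝ) ^ s * (1 - q + q * (1 / 2)) ^ (2 * m * s) ≤ 1 / 2 ^ s := by
      rw [pow_mul, ← mul_pow, ← one_div_pow]
      have h0 : (0 : ℝ) ≤ 1 - q + q * (1 / 2) := by have := q.2.2; have := q.2.1; linarith
      have := hm.head
      rw [show (1 : ℝ) - q / 2 = 1 - q + q * (1 / 2) by ring] at this
      exact pow_le_pow_left₀ (by positivity) (by linarith) s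
    have h2 : -(s / c) + 1 / c * ((2 * m * s : ℕ) * (q : ℝ)) = (2 * m * q - 1) / (2 * m - 2) := by
      rw [hcdef]
      push_cast
      have : (2 * m - 2 : ℝ) ≠ 0 := by linarith
      have : (s : ℝ) ≠ 0 := by linarith
      field_simp
      ring
    linarith
  | false =>
    simp only [bernMass, Bool.false_eq_true, if_false]
    have hT : ((s * (2 * m - 1) : ℕ) : ℝ) = s + c := by
      rw [hcdef, Nat.cast_mul, Nat.cast_sub (by have := hm.two_le; omega)]
      push_cast; ring
    have key : ∀ W : ℕ, 1 - min ((W - s : ℕ) : ℝ) c / c ≤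
        (1 + s / c) + (-(1 / c)) * W + (1 / 2) ^ (s * (2 * m - 1)) * 2 ^ W := by
      intro W
      have h3 : (1 + s / c) + (-(1 / c)) * W = 1 - ((W : ℝ) - s) / c := by ring
      rw [h3]
      by_cases hW : W ≤ s * (2 * m - 1)
      · have hWr : (W : ℝ) ≤ s + c := by rw [← hT]; exact_mod_cast hW
        have h1 : ((W : ℝ) - s) / c ≤ min ((W - s : ℕ) : ℝ) c / c := by
          have : (W : ℝ) - s ≤ (W - s : ℕ) := by
            rw [sub_le_iff_le_add]
            exact_mod_cast (by omega : W ≤ W - s + s)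
          gcongr
          exact le_min this (by linarith)
        have : (0 : ℝ) ≤ (1 / 2) ^ (s * (2 * m - 1)) * 2 ^ W := by positivity
        linarith
      · have hW' : s * (2 * m - 1) < W := by omega
        have hWr : (s + c : ℝ) ≤ W := by rw [← hT]; exact_mod_cast hW'.le
        have hsW : s ≤ W := by
          have : (s : ℝ) ≤ W := by linarith
          exact_mod_cast this
        rw [Nat.cast_sub hsW, min_eq_right (by linarith), div_self (by linarith), sub_self]
        have h1 : (1 / 2 : ℝ) ^ (s * (2 * m - 1)) * 2 ^ W = 2 ^ (W - s * (2 * m - 1)) := by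
          rw [one_div, inv_pow, pow_sub₀ _ (by norm_num) hW'.le, mul_comm]
        have h2 : (W : ℝ) - (s + c) ≤ 2 ^ (W - s * (2 * m - 1)) := by
          calc (W : ℝ) - (s + c) = ((W - s * (2 * m - 1) : ℕ) : ℝ) := by
                rw [Nat.cast_sub hW'.le, hT]
            _ ≤ _ := by exact_mod_cast Nat.lt_two_pow_self.le
        have h4 : ((W : ℝ) - s) / c - 1 ≤ (W : ℝ) - (s + c) := by
          rw [div_sub_one (by linarith), div_le_iff₀ (by linarith)]
          nlinarith
        rw [h1]
        linarith
    have hnn : ∀ W : ℕ, 0 ≤ (1 + s / c) + (-(1 / c)) * W +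
        (1 / 2) ^ (s * (2 * m - 1)) * (2 : ℝ) ^ W := fun W =>
      le_trans (sub_nonneg.2 (div_le_one_of_le₀ (min_le_right _ _) (by linarith))) (key W)
    refine (expect_mono fun W _ => ENNReal.ofReal_le_ofReal (key W)).trans ?_
    rw [expect_headCount q _ _ _ _ _ hnn]
    refine ENNReal.ofReal_le_ofReal ?_
    have h1 : (1 / 2 : ℝ) ^ (s * (2 * m - 1)) * (1 - q + q * 2) ^ (2 * m * s) ≤ 1 / 2 ^ s := by
      have h5 : (1 / 2 : ℝ) ^ (s * (2 * m - 1)) = (2 * (1 / 2) ^ (2 * m)) ^ s := by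
        rw [mul_comm s, pow_mul]
        congr 1
        have : 2 * m = (2 * m - 1) + 1 := by have := hm.two_le; omega
        conv_rhs => rw [this, pow_succ]
        ring
      rw [h5, pow_mul (1 - (q : ℝ) + q * 2), ← mul_pow, ← one_div_pow]
      have h0 : (0 : ℝ) ≤ 1 - q + q * 2 := by have := q.2.2; have := q.2.1; linarith
      have := hm.tail
      refine pow_le_pow_left₀ (by positivity) ?_ s
      calc 2 * (1 / 2 : ℝ) ^ (2 * m) * (1 - q + q * 2) ^ (2 * m)
          = 2 * ((1 + q) / 2) ^ (2 * m) := by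
            rw [mul_assoc, ← mul_pow]
            congr 2
            ring
        _ ≤ 1 / 2 := by linarith
    have h2 : (1 + s / c) + -(1 / c) * ((2 * m * s : ℕ) * (q : ℝ)) =
        1 - (2 * m * q - 1) / (2 * m - 2) := by
      rw [hcdef]
      push_cast
      have : (2 * m - 2 : ℝ) ≠ 0 := by linarith
      have : (s : ℝ) ≠ 0 := by linarith
      field_simp
      ring
    linarith

end Marginal

theorem sum_indicator_dvd (M d : ℕ) (x y : ℝ) :
    (∑ u ∈ Finset.range M, if d ∣ u + 1 then x else y) =
      (M / d : ℕ) * x + (M - (M / d : ℕ)) * y := by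
  have h := Nat.card_multiples M d
  have h2 := Finset.card_filter_add_card_filter_not (s := Finset.range M) (fun u => d ∣ u + 1)
  rw [h, Finset.card_range] at h2
  rw [Finset.sum_ite, Finset.sum_const, Finset.sum_const, h, nsmul_eq_mul, nsmul_eq_mul]
  congr 2
  rw [eq_sub_iff_add_eq']
  exact_mod_cast h2

theorem two_pow_sub_one_div {s j : ℕ} (hj : j ≤ s) : (2 ^ s - 1) / 2 ^ j = 2 ^ (s - j) - 1 := by
  have h : 2 ^ s = 2 ^ (s - j) * 2 ^ j := by rw [← pow_add, Nat.sub_add_cancel hj]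
  have h1 : 0 < 2 ^ j := by positivity
  have h2 : 0 < 2 ^ (s - j) := by positivity
  rw [Nat.div_eq_iff h1, h, Nat.sub_mul]
  have h3 : 2 ^ j ≤ 2 ^ (s - j) * 2 ^ j := Nat.le_mul_of_pos_left _ h2
  omega

/-- The number of `u` for which the split bit takes a given value: in the unequal pair of a level,
each value is taken in about half of the cases. -/
theorem sum_splitBit_eq_le {m s e : ℕ} (he : e / (2 * m) < s) (al be v : Bool) (p : ℕ) :
    (∑ u ∈ Finset.range (2 ^ s - 1), if splitBit m true (al, be, p, u) e = v then (1 : ℝ) else 0) ≤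
      (2 ^ s - 2 ^ (s - e / (2 * m))) * (if al = v then 1 else 0) +
        if e / 2 % m = p then 2 ^ (s - e / (2 * m) - 1)
        else (2 ^ (s - e / (2 * m)) - 1) * if be = v then 1 else 0 := by
  set j := e / (2 * m) with hj
  have hA : (((2 ^ s - 1) / 2 ^ j : ℕ) : ℝ) = 2 ^ (s - j) - 1 := by
    rw [two_pow_sub_one_div he.le, Nat.cast_sub Nat.one_le_two_pow]
    push_cast; ring
  have hA' : (((2 ^ s - 1) / 2 ^ (j + 1) : ℕ) : ℝ) = 2 ^ (s - j - 1) - 1 := by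
    rw [two_pow_sub_one_div (by omega), Nat.cast_sub Nat.one_le_two_pow, Nat.sub_sub]
    push_cast; ring
  have hM : ((2 ^ s - 1 : ℕ) : ℝ) = 2 ^ s - 1 := by
    rw [Nat.cast_sub Nat.one_le_two_pow]
    push_cast; ring
  have hpow : (2 : ℝ) ^ (s - j) = 2 * 2 ^ (s - j - 1) := by
    rw [← pow_succ', Nat.sub_add_cancel (by omega)]
  by_cases hp : e / 2 % m = p
  · rw [if_pos hp]
    set X : ℝ := if al = v then 1 else 0 with hX
    have hdvd : ∀ u, 2 ^ (j + 1) ∣ u + 1 → 2 ^ j ∣ u + 1 :=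
      fun u h => (pow_dvd_pow 2 (Nat.le_succ j)).trans h
    have hsb : ∀ u, splitBit m true (al, be, p, u) e =
        if 2 ^ j ∣ u + 1 then decide (2 ^ (j + 1) ∣ u + 1 ↔ e % 2 = 1) else al := by
      intro u
      simp only [splitBit, ← hj, hp, true_and, if_true]
    by_cases hev : (e % 2 = 1 ↔ v = true)
    · have : ∀ u, (if splitBit m true (al, be, p, u) e = v then (1 : ℝ) else 0) =
          (if 2 ^ (j + 1) ∣ u + 1 then 1 else 0) + if 2 ^ j ∣ u + 1 then 0 else X := by
        intro u
        rw [hsb, hX]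
        by_cases h2 : 2 ^ (j + 1) ∣ u + 1
        · rw [if_pos h2, if_pos (hdvd u h2), if_pos (hdvd u h2), add_zero, if_pos]
          rw [Bool.eq_iff_iff, decide_eq_true_iff, ← hev]
          exact ⟨fun h => h.1 h2, fun h => iff_of_true h2 h⟩
        · rw [if_neg h2]
          by_cases h1 : 2 ^ j ∣ u + 1
          · rw [if_pos h1, if_pos h1, add_zero, if_neg]
            rw [Bool.eq_iff_iff, decide_eq_true_iff, ← hev]
            exact fun h => h2 (by tauto)
          · rw [if_neg h1, if_neg h1, zero_add]
      rw [Finset.sum_congr rfl fun u _ => this u, Finset.sum_add_distrib, sum_indicator_dvd,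
        sum_indicator_dvd, hA, hA', hM]
      linarith
    · have : ∀ u, (if splitBit m true (al, be, p, u) e = v then (1 : ℝ) else 0) =
          (if 2 ^ j ∣ u + 1 then 1 else X) - if 2 ^ (j + 1) ∣ u + 1 then 1 else 0 := by
        intro u
        rw [hsb, hX]
        by_cases h2 : 2 ^ (j + 1) ∣ u + 1
        · rw [if_pos h2, if_pos (hdvd u h2), if_pos (hdvd u h2), sub_self, if_neg]
          rw [Bool.eq_iff_iff, decide_eq_true_iff]
          exact fun h => hev (by tauto)
        · rw [if_neg h2]
          by_cases h1 : 2 ^ j ∣ u + 1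
          · rw [if_pos h1, if_pos h1, sub_zero, if_pos]
            rw [Bool.eq_iff_iff, decide_eq_true_iff]
            tauto
          · rw [if_neg h1, if_neg h1, sub_zero]
      rw [Finset.sum_congr rfl fun u _ => this u, Finset.sum_sub_distrib, sum_indicator_dvd,
        sum_indicator_dvd, hA, hA', hM, hpow]
      linarith
  · rw [if_neg hp]
    have : ∀ u, (if splitBit m true (al, be, p, u) e = v then (1 : ℝ) else 0) =
        if 2 ^ j ∣ u + 1 then (if be = v then 1 else 0) else if al = v then 1 else 0 := by
      intro u
      simp only [splitBit, ← hj, hp]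
      by_cases h1 : 2 ^ j ∣ u + 1 <;> simp [h1]
    rw [Finset.sum_congr rfl fun u _ => this u, sum_indicator_dvd, hA, hM]
    linarith

theorem sum_decide_lt (c x : ℕ) (v : Bool) :
    (∑ V ∈ Finset.range c, if decide (V < x) = v then (1 : ℝ) else 0) =
      if v = true then ((min x c : ℕ) : ℝ) else c - (min x c : ℕ) := by
  have h : (Finset.range c).filter (fun V => V < x) = Finset.range (min x c) := by
    ext V; simp; omega
  have h2 := Finset.card_filter_add_card_filter_not (s := Finset.range c) (fun V => V < x)
  rw [h, Finset.card_range, Finset.card_range] at h2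
  cases v with
  | true => simp [Finset.sum_boole, h]
  | false =>
    simp only [decide_eq_false_iff_not, Finset.sum_boole, Bool.false_eq_true, if_false]
    rw [eq_sub_iff_add_eq']
    exact_mod_cast h2

theorem EnoughPairs.compensation_nonneg {q : unitInterval} {m : ℕ} (hm : EnoughPairs q m)
    (v : Bool) : 0 ≤ bernMass ((2 * m * q - 1) / (2 * m - 2)) v := by
  have hm2 : (2 : ℝ) ≤ m := by exact_mod_cast hm.two_le
  have hq := q.2.1
  have hq' := q.2.2
  cases v with
  | true =>
    have h := one_add_mul_le_pow (a := -((q : ℝ) / 2)) (by linarith) (2 * m)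
    rw [← sub_eq_add_neg] at h
    have h2 := h.trans hm.head
    push_cast at h2
    simp only [bernMass, if_true]
    exact div_nonneg (by nlinarith) (by linarith)
  | false =>
    have h := one_add_mul_le_pow (a := -((1 - q : ℝ) / 2)) (by linarith) (2 * m)
    rw [show (1 : ℝ) + -((1 - q) / 2) = (1 + q) / 2 by ring] at h
    have h2 := h.trans hm.tail
    push_cast at h2
    simp only [bernMass, Bool.false_eq_true, if_false]
    rw [sub_nonneg, div_le_one (by linarith)]
    nlinarith

/-- Each split bit has nearly the law of the coin. -/
theorem expect_splitBit_le {q : unitInterval} {m s e : ℕ} (hm : EnoughPairs q m)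
    (he : e < 2 * m * s) (y v : Bool) :
    expect (drawSample q m s) (fun w => if splitBit m y w e = v then 1 else 0) ≤
      ENNReal.ofReal (bernMass q v + 2 / 2 ^ s) := by
  have hm2 := hm.two_le
  have hs : 0 < s := by
    rcases Nat.eq_zero_or_pos s with h | h
    · subst h; simp at he
    · exact h
  have hj : e / (2 * m) < s := Nat.div_lt_of_lt_mul he
  have hm2r : (2 : ℝ) ≤ m := by exact_mod_cast hm2
  have hbern : ∀ b : Bool, 0 ≤ bernMass q b := by
    intro b
    unfold bernMass
    split_ifs
    · exact q.2.1
    · exact sub_nonneg.2 q.2.2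
  have hind : ∀ (p : Prop) [Decidable p], (if p then (1 : ℝ≥0∞) else 0) =
      ENNReal.ofReal (if p then 1 else 0) := by
    intro p _
    split_ifs <;> simp
  have hcoin : expect (bern q) (fun al => if al = v then 1 else 0) =
      ENNReal.ofReal (bernMass q v) := by
    rw [expect_ite_eq, bern_apply, bernMass]
  cases y with
  | false =>
    simp only [splitBit, Bool.false_eq_true, false_and, if_false, drawSample, expect_bind,
      expect_map]
    have h : ∀ al : Bool, expect (uniformUpTo (s * (2 * m - 2) - 1)) (fun _ =>
        expect (uniformUpTo (m - 1)) fun _ => expect (uniformUpTo (2 ^ s - 2)) fun _ =>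
          if al = v then (1 : ℝ≥0∞) else 0) = if al = v then 1 else 0 :=
      fun al => by rw [expect_const, expect_const, expect_const]
    simp only [h]
    rw [expect_const, hcoin]
    exact ENNReal.ofReal_le_ofReal (by linarith [show (0 : ℝ) ≤ 2 / 2 ^ s by positivity])
  | true =>
    set j := e / (2 * m) with hjdef
    set M : ℝ := 2 ^ s - 1 with hMdef
    have hM2 : (2 : ℝ) ≤ 2 ^ s := by
      calc (2 : ℝ) = 2 ^ 1 := by norm_num
        _ ≤ 2 ^ s := pow_le_pow_right₀ (by norm_num) hs
    have hM : 0 < M := by rw [hMdef]; linarith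
    set X : ℝ := 2 ^ (s - j) with hXdef
    have hX1 : 1 ≤ X := one_le_pow₀ (by norm_num)
    have hXs : X ≤ 2 ^ s := pow_le_pow_right₀ (by norm_num) (Nat.sub_le _ _)
    have hX2 : (2 : ℝ) ^ (s - j - 1) = X / 2 := by
      rw [hXdef, eq_div_iff (by norm_num), ← pow_succ, Nat.sub_add_cancel (by omega)]
    -- average over the random number that determines the carries
    have h1 : ∀ (al be : Bool) (p : ℕ), expect (uniformUpTo (2 ^ s - 2))
        (fun u => if splitBit m true (al, be, p, u) e = v then 1 else 0) ≤
        ENNReal.ofReal ((2 ^ s - X) / M * (if al = v then 1 else 0) +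
          if e / 2 % m = p then X / 2 / M else (X - 1) / M * if be = v then 1 else 0) := by
      intro al be p
      simp only [hind]
      rw [expect_uniformUpTo _ fun u => by split_ifs <;> norm_num]
      have h0 : 2 ^ 1 ≤ 2 ^ s := Nat.pow_le_pow_right (by norm_num) hs
      have h2 : ((2 ^ s - 2 : ℕ) : ℝ) + 1 = M := by
        rw [Nat.cast_sub (by simpa using h0), hMdef]; push_cast; ring
      have h3 : 2 ^ s - 2 + 1 = 2 ^ s - 1 := by omega
      rw [h2, h3]
      refine ENNReal.ofReal_le_ofReal ?_
      have := sum_splitBit_eq_le (m := m) (s := s) (e := e) hj al be v p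
      rw [← hjdef, hX2, ← hXdef] at this
      refine (div_le_div_of_nonneg_right this hM.le).trans (le_of_eq ?_)
      split_ifs <;> ring
    -- average over the index of the unequal pair
    have h2 : ∀ (al be : Bool), expect (uniformUpTo (m - 1)) (fun p =>
        expect (uniformUpTo (2 ^ s - 2))
        (fun u => if splitBit m true (al, be, p, u) e = v then 1 else 0)) ≤
        ENNReal.ofReal ((2 ^ s - X) / M) * (if al = v then 1 else 0) +
          (ENNReal.ofReal (X / 2 / M / m) +
          ENNReal.ofReal ((1 - 1 / m) * ((X - 1) / M)) * if be = v then 1 else 0) := by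
      intro al be
      have hn1 : 0 ≤ (2 ^ s - X) / M := div_nonneg (by linarith) hM.le
      have hn2 : 0 ≤ X / 2 / M := div_nonneg (by linarith) hM.le
      have hn3 : 0 ≤ (X - 1) / M := div_nonneg (by linarith) hM.le
      have hn4 : 0 ≤ 1 - 1 / (m : ℝ) := by
        rw [sub_nonneg, div_le_one (by linarith)]; linarith
      refine (expect_mono fun p _ => h1 al be p).trans ?_
      rw [expect_uniformUpTo _ fun p => by split_ifs <;> simp <;> positivity]
      rw [Nat.sub_add_cancel (by omega), Nat.cast_sub (by omega), Nat.cast_one, sub_add_cancel,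
        Finset.sum_add_distrib, Finset.sum_const, Finset.card_range, nsmul_eq_mul]
      have h5 : (∑ p ∈ Finset.range m, if e / 2 % m = p then X / 2 / M
          else (X - 1) / M * if be = v then 1 else 0) =
          X / 2 / M + (m - 1) * ((X - 1) / M * if be = v then 1 else 0) := by
        have hmem : e / 2 % m ∈ Finset.range m := Finset.mem_range.2 (Nat.mod_lt _ (by omega))
        rw [← Finset.add_sum_erase _ _ hmem, if_pos rfl]
        congr 1
        rw [Finset.sum_congr rfl fun p hp => if_neg (Finset.ne_of_mem_erase hp).symm,
          Finset.sum_const, Finset.card_erase_of_mem hmem, Finset.card_range, nsmul_eq_mul,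
          Nat.cast_sub (by omega), Nat.cast_one]
      rw [h5, hind (al = v), hind (be = v), ← ENNReal.ofReal_mul hn1,
        ← ENNReal.ofReal_mul (by positivity), ← ENNReal.ofReal_add (by positivity) (by positivity),
        ← ENNReal.ofReal_add (by positivity) (by positivity)]
      refine ENNReal.ofReal_le_ofReal (le_of_eq ?_)
      have : (m : ℝ) ≠ 0 := by linarith
      field_simp
    -- average over the number that determines the compensating bit
    have h3 : ∀ W : ℕ, expect (uniformUpTo (s * (2 * m - 2) - 1))
        (fun V => if decide (V < W - s) = v then 1 else 0) = ENNReal.ofReal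
        (bernMass (min (W - s : ℕ) (s * (2 * m - 2) : ℕ) / (s * (2 * m - 2) : ℕ)) v) := by
      intro W
      have hpos : 0 < s * (2 * m - 2) := Nat.mul_pos hs (by omega)
      simp only [hind]
      rw [expect_uniformUpTo _ fun V => by split_ifs <;> norm_num]
      have : ((s * (2 * m - 2) - 1 : ℕ) : ℝ) + 1 = (s * (2 * m - 2) : ℕ) := by
        exact_mod_cast Nat.sub_add_cancel hpos
      rw [this, Nat.sub_add_cancel hpos, sum_decide_lt]
      have hne : ((s * (2 * m - 2) : ℕ) : ℝ) ≠ 0 := by positivity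
      congr 1
      cases v with
      | true => simp only [bernMass, if_true]
      | false =>
        simp only [bernMass, Bool.false_eq_true, if_false]
        rw [sub_div, div_self hne]
    simp only [drawSample, expect_bind, expect_map]
    refine (expect_mono fun W _ => expect_mono fun al _ => expect_mono fun V _ =>
      h2 al (decide (V < W - s))).trans ?_
    simp only [expect_add, expect_const_mul, expect_const, h3, hcoin]
    refine (add_le_add le_rfl (add_le_add le_rfl (mul_le_mul_right
      (expect_compensation_le hm hs v) _))).trans ?_
    have hn1 : 0 ≤ (2 ^ s - X) / M := div_nonneg (by linarith) hM.le
    have hn2 : 0 ≤ X / 2 / M := div_nonneg (by linarith) hM.le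
    have hn3 : 0 ≤ (X - 1) / M := div_nonneg (by linarith) hM.le
    have hn4 : 0 ≤ 1 - 1 / (m : ℝ) := by
      rw [sub_nonneg, div_le_one (by linarith)]; linarith
    have hcomp : (1 - 1 / (m : ℝ)) * bernMass ((2 * m * q - 1) / (2 * m - 2)) v =
        bernMass q v - 1 / (2 * m) := by
      have : (2 * m - 2 : ℝ) ≠ 0 := by linarith
      have : (m : ℝ) - 1 ≠ 0 := by linarith
      cases v with
      | true =>
        simp only [bernMass, if_true]
        rw [show (2 * m - 2 : ℝ) = 2 * (m - 1) by ring]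
        field_simp
      | false =>
        simp only [bernMass, Bool.false_eq_true, if_false]
        rw [show (2 * m - 2 : ℝ) = 2 * (m - 1) by ring]
        field_simp
        ring
    have hcle : ENNReal.ofReal ((1 - 1 / m) * ((X - 1) / M)) *
        ENNReal.ofReal (bernMass ((2 * m * q - 1) / (2 * m - 2)) v + 1 / 2 ^ s) =
        ENNReal.ofReal ((1 - 1 / m) * ((X - 1) / M) *
          (bernMass ((2 * m * q - 1) / (2 * m - 2)) v + 1 / 2 ^ s)) :=
      (ENNReal.ofReal_mul (mul_nonneg hn4 hn3)).symm
    rw [hcle, ← ENNReal.ofReal_mul hn1]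
    set Y : ℝ := (1 - 1 / m) * ((X - 1) / M) *
          (bernMass ((2 * m * q - 1) / (2 * m - 2)) v + 1 / 2 ^ s) with hY
    have hYle : Y ≤ (X - 1) / M * (bernMass q v - 1 / (2 * m)) + 1 / 2 ^ s := by
      have hone : (X - 1) / M ≤ 1 := by rw [div_le_one hM, hMdef]; linarith
      have hle1 : (1 - 1 / (m : ℝ)) * ((X - 1) / M) ≤ 1 :=
        mul_le_one₀ (by linarith [show 0 < 1 / (m : ℝ) by positivity]) hn3 hone
      have : Y = (X - 1) / M * (bernMass q v - 1 / (2 * m)) +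
          (1 - 1 / (m : ℝ)) * ((X - 1) / M) * (1 / 2 ^ s) := by
        rw [hY, ← hcomp]; ring
      rw [this]
      have : (1 - 1 / (m : ℝ)) * ((X - 1) / M) * (1 / 2 ^ s) ≤ 1 * (1 / 2 ^ s) :=
        mul_le_mul_of_nonneg_right hle1 (by positivity)
      linarith
    have hb := hbern v
    have hY0 : 0 ≤ Y :=
      mul_nonneg (mul_nonneg hn4 hn3) (add_nonneg (hm.compensation_nonneg v) (by positivity))
    rw [← ENNReal.ofReal_add (by positivity) hY0,
        ← ENNReal.ofReal_add (by positivity) (by positivity)]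
    refine ENNReal.ofReal_le_ofReal ?_
    have e1 : (2 ^ s - X) / M * bernMass q v + (X - 1) / M * bernMass q v = bernMass q v := by
      rw [← add_mul, ← add_div, show (2 : ℝ) ^ s - X + (X - 1) = M by rw [hMdef]; ring,
        div_self hM.ne', one_mul]
    have e2 : X / 2 / M / m - (X - 1) / M * (1 / (2 * m)) = 1 / (2 * M * m) := by
      field_simp
      ring
    have e3 : 1 / (2 * M * m) ≤ 1 / 2 ^ s := by
      apply one_div_le_one_div_of_le (by positivity)
      have : M * 2 ≤ M * m := mul_le_mul_of_nonneg_left hm2r hM.le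
      rw [hMdef] at this ⊢
      linarith
    have e4 : (2 : ℝ) / 2 ^ s = 1 / 2 ^ s + 1 / 2 ^ s := by ring
    have e5 : (X - 1) / M * (bernMass q v - 1 / (2 * m)) =
      (X - 1) / M * bernMass q v - (X - 1) / M * (1 / (2 * m)) := by ring
    linarith

/-! ### Independent bits and the average-case distribution -/

/-- Independent choices for the input bits below `N`. -/
noncomputable def sampleTable (q : unitInterval) (m s N : ℕ) : PMF (ℕ → Sample) :=
  iterFrom (fun x v => (drawSample q m s).map (Function.update v x)) 0 N
    fun _ => (false, false, 0, 0)

/-- Independent coins for the input bits below `N`. -/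
noncomputable def bernTable (q : unitInterval) (N : ℕ) : PMF (ℕ → Bool) :=
  iterFrom (fun x z => (bern q).map (Function.update z x)) 0 N fun _ => false

theorem expect_bool_comp {α : Type} (p : PMF α) (h : α → Bool) (F : Bool → ℝ≥0∞) :
    expect p (fun a => F (h a)) =
      ∑ v : Bool, expect p (fun a => if h a = v then 1 else 0) * F v := by
  simp only [← expect_mul_const]
  rw [← expect_sum]
  congr 1
  funext a
  simp

/-- If bits computed from the samples have nearly the law of the coin, then an expectation over
them is not much larger than the one over independent coins. -/
theorem expect_sampleTable_le {q : unitInterval} {m s : ℕ} {c : ℝ≥0∞} {h : ℕ → Sample → Bool}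
    (hh : ∀ x v, expect (drawSample q m s) (fun w => if h x w = v then 1 else 0) ≤ c * bern q v)
    (N : ℕ) (G : (ℕ → Bool) → ℝ≥0∞) :
    expect (sampleTable q m s N) (fun f => G fun x => if x < N then h x (f x) else false) ≤
      c ^ N * expect (bernTable q N) G := by
  induction N generalizing G with
  | zero => simp [sampleTable, bernTable, iterFrom, expect_pure]
  | succ N ih =>
    have key : ∀ (f : ℕ → Sample) (w : Sample),
        (fun x => if x < N + 1 then h x (Function.update f N w x) else false) =
          Function.update (fun x => if x < N then h x (f x) else false) N (h N w) := by
      intro f w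
      funext x
      rcases lt_trichotomy x N with hx | rfl | hx
      · simp [hx, hx.ne, Nat.lt_succ_of_lt hx]
      · simp
      · simp [hx.ne', hx.not_gt, show ¬ x < N + 1 by omega]
    unfold sampleTable bernTable at ih ⊢
    simp only [iterFrom_succ, expect_bind, expect_map, zero_add, key]
    calc _ ≤ expect (iterFrom (fun x v => (drawSample q m s).map (Function.update v x)) 0 N
          fun _ => (false, false, 0, 0)) fun f => c * expect (bern q) fun v =>
            G (Function.update (fun x => if x < N then h x (f x) else false) N v) := by
          refine expect_mono fun f _ => ?_
          rw [expect_bool_comp _ (h N) fun v =>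
            G (Function.update (fun x => if x < N then h x (f x) else false) N v),
            expect_fintype, Finset.mul_sum]
          refine Finset.sum_le_sum fun v _ => ?_
          rw [← mul_assoc]
          gcongr
          exact hh N v
      _ ≤ _ := by
          rw [expect_const_mul, pow_succ', mul_assoc]
          gcongr
          exact ih fun z => expect (bern q) fun v => G (Function.update z N v)

theorem expect_bernTable_agree (q : unitInterval) (N : ℕ) (z₀ : ℕ → Bool) :
    expect (bernTable q N) (fun z => if ∀ x < N, z x = z₀ x then 1 else 0) =
      ∏ x ∈ Finset.range N, bern q (z₀ x) := by
  induction N with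
  | zero => simp [bernTable, iterFrom, expect_pure]
  | succ N ih =>
    unfold bernTable at ih ⊢
    simp only [iterFrom_succ, expect_bind, expect_map, zero_add]
    rw [Finset.prod_range_succ, ← ih, ← expect_mul_const]
    congr 1
    funext z
    rw [← expect_ite_eq (bern q), ← expect_const_mul]
    congr 1
    funext v
    have : (∀ x < N + 1, Function.update z N v x = z₀ x) ↔ (∀ x < N, z x = z₀ x) ∧ v = z₀ N := by
      constructor
      · intro h
        refine ⟨fun x hx => ?_, by simpa using h N (Nat.lt_succ_self N)⟩
        have := h x (by omega)
        rwa [Function.update_of_ne hx.ne] at this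
      · rintro ⟨h1, h2⟩ x hx
        rcases Nat.lt_succ_iff_lt_or_eq.1 hx with hx | rfl
        · rw [Function.update_of_ne hx.ne, h1 x hx]
        · simpa using h2
    rw [if_congr this rfl rfl]
    by_cases h1 : ∀ x < N, z x = z₀ x <;> by_cases h2 : v = z₀ N <;> simp [h1, h2]

/-- Independent coins for all input bits give the average-case distribution. -/
theorem expect_bernTable (q : unitInterval) {k n g b : ℕ} (F : Inst k n g b → ℝ≥0∞) :
    expect (bernTable q (numVars k n g b)) (fun z => F (bitsInst k n g b z)) =
      ∑ I, ENNReal.ofReal (instMass q I) * F I := by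
  classical
  rw [← expect_map, expect_fintype]
  refine Finset.sum_congr rfl fun I _ => ?_
  congr 1
  rw [← expect_ite_eq, expect_map]
  have h : ∀ z, bitsInst k n g b z = I ↔ ∀ x < numVars k n g b, z x = instBits I x := by
    intro z
    constructor
    · rintro rfl x hx
      exact (instBits_bitsInst z hx).symm
    · intro h
      rw [bitsInst_congr h, bitsInst_instBits]
  have h2 := expect_bernTable_agree q (numVars k n g b) (instBits I)
  conv_rhs => rw [← bitsInst_instBits I, instMass_bitsInst]
  rw [ENNReal.ofReal_prod_of_nonneg fun x _ => by
    split_ifs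
    · exact q.2.1
    · exact sub_nonneg.2 q.2.2]
  simp only [← bern_apply]
  rw [← h2]
  congr 1
  funext z
  exact if_congr (h z) rfl rfl

/-! ### One trial of the reduction -/

section Trial

variable {k n g b : ℕ}

/-- The absolute value of the coefficient of query number `a`. -/
def queryCoeff (m t d a : ℕ) : ℕ := ∏ B ∈ Finset.range d, 2 ^ (digit t a B / (2 * m))

/-- The parity of this number is the sign of the coefficient of query number `a`. -/
def querySign (t d a : ℕ) : ℕ := ∑ B ∈ Finset.range d, digit t a B % 2

/-- Adds the answer `o` to query number `a` to the sum of the positive or to the sum of the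
negative terms. -/
def addAnswer (m t d a o : ℕ) (P : ℕ × ℕ) : ℕ × ℕ :=
  if querySign t d a % 2 = 0 then (P.1 + queryCoeff m t d a * o, P.2)
  else (P.1, P.2 + queryCoeff m t d a * o)

theorem prod_splitCoeff (m t d a : ℕ) :
    ∏ B ∈ Finset.range d, splitCoeff m (digit t a B) =
      (-1) ^ querySign t d a * (queryCoeff m t d a : ℤ) := by
  simp only [splitCoeff, Finset.prod_mul_distrib, querySign, queryCoeff]
  rw [Finset.prod_pow_eq_pow_sum]
  push_cast
  rfl

theorem addAnswer_sub (m t d a o : ℕ) (P : ℕ × ℕ) :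
    ((addAnswer m t d a o P).1 : ℤ) - (addAnswer m t d a o P).2 =
      ((P.1 : ℤ) - P.2) + (∏ B ∈ Finset.range d, splitCoeff m (digit t a B)) * o := by
  rw [prod_splitCoeff]
  unfold addAnswer
  split_ifs with h
  · rw [(Nat.even_iff.2 h).neg_one_pow]
    push_cast
    ring
  · rw [(Nat.odd_iff.2 (by omega : querySign t d a % 2 = 1)).neg_one_pow]
    push_cast
    ring

/-- The sums of the positive and of the negative terms, after asking all queries. -/
noncomputable def queries (m t : ℕ) (out : Inst k n g b → PMF ℕ) (y : ℕ → Bool)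
    (v : ℕ → Sample) : PMF (ℕ × ℕ) :=
  iterFrom (fun a P => (out (queryInst k n g b m t y a v)).map
    fun o => addAnswer m t (g * k) a o P) 0 (t ^ (g * k)) (0, 0)

/-- One trial: split the input bits at random and combine the answers to all queries. -/
noncomputable def trial (q : unitInterval) (m s : ℕ) (out : Inst k n g b → PMF ℕ)
    (y : ℕ → Bool) : PMF ℕ :=
  (sampleTable q m s (numVars k n g b)).bind fun v =>
    (queries m (2 * m * s) out y v).map fun P => P.1 - P.2

/-- The probability that the oracle errs on an instance. -/
noncomputable def oracleErr (f : (Fin k → Fin b → Bool) → Bool) (out : Inst k n g b → PMF ℕ)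
    (I : Inst k n g b) : ℝ≥0∞ := expect (out I) fun o => if o = count f I then 0 else 1

theorem expect_queries_le (f : (Fin k → Fin b → Bool) → Bool) (m t : ℕ)
    (out : Inst k n g b → PMF ℕ) (y : ℕ → Bool) (v : ℕ → Sample) :
    expect (queries m t out y v) (fun P => if (P.1 : ℤ) - P.2 =
        ∑ a ∈ Finset.range (t ^ (g * k)), (∏ B ∈ Finset.range (g * k), splitCoeff m (digit t a B)) *
          (count f (queryInst k n g b m t y a v) : ℤ) then 0 else 1) ≤
      ∑ a ∈ Finset.range (t ^ (g * k)), oracleErr f out (queryInst k n g b m t y a v) := by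
  unfold queries
  generalize t ^ (g * k) = A
  induction A with
  | zero => simp [iterFrom, expect_pure]
  | succ A ih =>
    rw [iterFrom_succ, expect_bind, Finset.sum_range_succ, Finset.sum_range_succ]
    simp only [expect_map, zero_add, addAnswer_sub]
    refine le_trans ?_ (add_le_add ih le_rfl)
    rw [← expect_const (iterFrom _ 0 A (0, 0)) (oracleErr f out _), ← expect_add]
    refine expect_mono fun P _ => ?_
    rw [oracleErr, ← expect_const (out _) (if (_ : ℤ) = _ then (0 : ℝ≥0∞) else 1), ← expect_add]
    refine expect_mono fun o _ => ?_
    split_ifs with h1 h2 h3 h4 <;> simp_all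

theorem of_mem_support_sampleTable {q : unitInterval} {m s : ℕ} (hm : 0 < m) (hs : 0 < s) {N : ℕ}
    {v : ℕ → Sample} (hv : v ∈ (sampleTable q m s N).support) :
    ∀ x < N, (v x).2.2.1 < m ∧ (v x).2.2.2 + 1 < 2 ^ s := by
  induction N generalizing v with
  | zero => simp
  | succ N ih =>
    unfold sampleTable at ih hv
    rw [iterFrom_succ, PMF.mem_support_bind_iff] at hv
    obtain ⟨v', hv', hv⟩ := hv
    obtain ⟨w, hw, rfl⟩ := (PMF.mem_support_map_iff _ _ _).1 hv
    intro x hx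
    rcases Nat.lt_succ_iff_lt_or_eq.1 hx with hx | rfl
    · rw [Function.update_of_ne (by omega)]
      exact ih hv' x hx
    · rw [zero_add, Function.update_self]
      exact of_mem_support_drawSample hm hs hw

/-- A trial fails only if some query is answered incorrectly, and each query is distributed nearly
as the average-case instances. -/
theorem expect_trial_le {q : unitInterval} {m s : ℕ} (hm : EnoughPairs q m) (hs : 0 < s)
    (f : (Fin k → Fin b → Bool) → Bool) (out : Inst k n g b → PMF ℕ) (I : Inst k n g b)
    {c : ℝ≥0∞} (hc : ∀ v, ENNReal.ofReal (bernMass q v + 2 / 2 ^ s) ≤ c * bern q v) :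
    expect (trial q m s out (instBits I)) (fun v => if v = count f I then 0 else 1) ≤
      ((2 * m * s) ^ (g * k) : ℕ) * (c ^ numVars k n g b *
        ∑ I : Inst k n g b, ENNReal.ofReal (instMass q I) * oracleErr f out I) := by
  have hmpos : 0 < m := by have := hm.two_le; omega
  unfold trial
  rw [expect_bind]
  calc _ ≤ expect (sampleTable q m s (numVars k n g b)) fun v =>
        ∑ a ∈ Finset.range ((2 * m * s) ^ (g * k)),
          oracleErr f out (queryInst k n g b m (2 * m * s) (instBits I) a v) := by
        refine expect_mono fun v hv => ?_
        refine le_trans ?_ (expect_queries_le f m (2 * m * s) out (instBits I) v)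
        rw [expect_map, sum_count_queryInst f I (of_mem_support_sampleTable hmpos hs hv)]
        refine expect_mono fun P _ => ?_
        by_cases h : (P.1 : ℤ) - P.2 = count f I
        · rw [if_pos (by omega), if_pos h]
        · rw [if_neg h]
          split_ifs <;> simp
    _ = ∑ a ∈ Finset.range ((2 * m * s) ^ (g * k)), expect (sampleTable q m s (numVars k n g b))
          fun v => oracleErr f out (queryInst k n g b m (2 * m * s) (instBits I) a v) :=
        expect_sum _ _ _
    _ ≤ ∑ a ∈ Finset.range ((2 * m * s) ^ (g * k)), c ^ numVars k n g b *
        ∑ I : Inst k n g b, ENNReal.ofReal (instMass q I) * oracleErr f out I := by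
        refine Finset.sum_le_sum fun a _ => ?_
        have htpos : 0 < 2 * m * s := by positivity
        have := expect_sampleTable_le (q := q) (m := m) (s := s) (c := c)
          (h := fun x w => splitBit m (instBits I x) w
            (digit (2 * m * s) a (x / 2 ^ b % g * k + x / (n * g * 2 ^ b))))
          (fun x v => (expect_splitBit_le hm (Nat.mod_lt _ htpos) _ v).trans (hc v))
          (numVars k n g b) fun z => oracleErr f out (bitsInst k n g b z)
        rw [expect_bernTable q (oracleErr f out)] at this
        refine le_trans (le_of_eq ?_) this
        congr 1
        funext v
        congr 1
        exact bitsInst_congr fun x hx => by rw [if_pos hx]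
    _ = _ := by rw [Finset.sum_const, Finset.card_range, nsmul_eq_mul]

end Trial

/-! ### Majority vote -/

/-- One step of the majority vote of Boyer and Moore, with the state consisting of a candidate and a
counter. -/
def voteStep (v : ℕ) (P : ℕ × ℕ) : ℕ × ℕ :=
  if P.2 = 0 then (v, 1) else if v = P.1 then (P.1, P.2 + 1) else (P.1, P.2 - 1)

/-- The state of the vote after `R` independent votes. -/
noncomputable def vote (M : PMF ℕ) (R : ℕ) : PMF (ℕ × ℕ) :=
  iterFrom (fun _ P => M.map fun v => voteStep v P) 0 R (0, 0)

/-- The potential of a state of the vote: `2 ^ (-h)` if the candidate is the right value `c`, and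
`2 ^ h` otherwise, where `h` is the counter. -/
noncomputable def votePotential (c : ℕ) (P : ℕ × ℕ) : ℝ≥0∞ :=
  if P.1 = c then 2⁻¹ ^ P.2 else 2 ^ P.2

theorem votePotential_step_le (c : ℕ) (v : ℕ) (P : ℕ × ℕ) :
    votePotential c (voteStep v P) ≤
      (2⁻¹ + (if v = c then 0 else 1) * 2) * votePotential c P := by
  have h2 : (2 : ℝ≥0∞)⁻¹ * 2 = 1 := ENNReal.inv_mul_cancel (by norm_num) (by norm_num)
  obtain ⟨d, h⟩ := P
  rcases h with _ | h
  · by_cases hv : v = c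
    · simp [voteStep, votePotential, hv]
    · simp [voteStep, votePotential, hv]
  · by_cases hd : v = d
    · subst hd
      by_cases hv : v = c
      · simp [voteStep, votePotential, hv, pow_succ' _ (h + 1)]
      · simp only [voteStep, votePotential, Nat.add_eq_zero_iff, one_ne_zero, and_false, if_false,
          if_true, hv, pow_succ' _ (h + 1), one_mul]
        gcongr
        exact le_add_self
    · by_cases hv : v = c
      · subst hv
        simp only [voteStep, votePotential, Nat.add_eq_zero_iff, one_ne_zero, and_false, if_false,
          if_true, hd, Ne.symm hd, zero_mul, add_zero, Nat.add_sub_cancel, pow_succ']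
        rw [← mul_assoc, h2, one_mul]
      · by_cases hdc : d = c
        · subst hdc
          simp only [voteStep, votePotential, Nat.add_eq_zero_iff, one_ne_zero, and_false, if_false,
            if_true, hd, Nat.add_sub_cancel, pow_succ', one_mul]
          rw [← mul_assoc, add_mul, mul_comm (2 : ℝ≥0∞) 2⁻¹, h2, add_mul, one_mul]
          exact le_add_self
        · simp only [voteStep, votePotential, Nat.add_eq_zero_iff, one_ne_zero, and_false, if_false,
            hd, hv, hdc, Nat.add_sub_cancel, pow_succ', one_mul]
          rw [← mul_assoc, add_mul, h2, add_mul, one_mul]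
          exact le_self_add

/-- If each vote is wrong with probability at most `1 / 10`, then the candidate elected by `R`
votes is wrong with probability at most `(7 / 10) ^ R`. -/
theorem expect_vote_le {M : PMF ℕ} {c : ℕ}
    (hM : expect M (fun v => if v = c then 0 else 1) ≤ 10⁻¹) (R : ℕ) :
    expect (vote M R) (fun P => if P.1 = c then 0 else 1) ≤ (2⁻¹ + 10⁻¹ * 2) ^ R := by
  calc _ ≤ expect (vote M R) (votePotential c) := by
        refine expect_mono fun P _ => ?_
        unfold votePotential
        split_ifs
        · exact zero_le
        · exact one_le_pow₀ (by norm_num)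
    _ ≤ _ := by
        unfold vote
        induction R with
        | zero => simp [iterFrom, expect_pure, votePotential]
        | succ R ih =>
          rw [iterFrom_succ, expect_bind]
          simp only [expect_map]
          calc _ ≤ expect (iterFrom (fun _ P => M.map fun v => voteStep v P) 0 R (0, 0))
                (fun P => (2⁻¹ + 10⁻¹ * 2) * votePotential c P) := by
                refine expect_mono fun P _ => ?_
                refine (expect_mono fun v _ => votePotential_step_le c v P).trans ?_
                rw [expect_mul_const, expect_add, expect_const, expect_mul_const]
                gcongr
            _ ≤ _ := by
                rw [expect_const_mul, pow_succ']
                gcongr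

/-! ### Straight-line code and counting loops -/

local infixl:65 " +ₑ " => AExp.bin BinOp.add
local infixl:65 " -ₑ " => AExp.bin BinOp.sub
local infixl:70 " *ₑ " => AExp.bin BinOp.mul
local infixl:70 " /ₑ " => AExp.bin BinOp.div
local infixl:70 " %ₑ " => AExp.bin BinOp.mod
local infix:50 " <ₑ " => AExp.bin BinOp.lt
local infix:50 " =ₑ " => AExp.bin BinOp.eq
local infixr:30 " ;; " => Cmd.seq

/-- Assignment to the scalar variable number `v`. -/
abbrev Cmd.assign (v : ℕ) (e : AExp) : Cmd := .set v (.lit 0) e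

/-- The cost of straight-line code on cells of at most `q` bits is at most `c.lineWeight * q`. -/
def Cmd.lineWeight : Cmd → ℕ
  | .skip => 1
  | .set _ e₁ e₂ => AExp.assignWeight e₁ e₂
  | .rand _ e₁ e₂ => AExp.assignWeight e₁ e₂
  | .flip _ e₁ _ => e₁.weight + 1 + e₁.bits
  | .seq c₁ c₂ => c₁.lineWeight + c₂.lineWeight
  | .ite e c₁ c₂ => e.weight + 1 + (c₁.lineWeight + c₂.lineWeight)
  | .while _ _ => 0

/-- The memories `s` and `s'` differ only in the arrays in `S`. -/
def EqOff (S : Set ℕ) (s s' : Store) : Prop := ∀ a ∉ S, s' a = s a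

theorem EqOff.refl (S : Set ℕ) (s : Store) : EqOff S s s := fun _ _ => rfl

theorem EqOff.trans {S : Set ℕ} {s s' s'' : Store} (h : EqOff S s s') (h' : EqOff S s' s'') :
    EqOff S s s'' := fun a ha => (h' a ha).trans (h a ha)

theorem EqOff.mono {S S' : Set ℕ} {s s' : Store} (h : EqOff S s s') (hS : S ⊆ S') :
    EqOff S' s s' := fun a ha => h a fun h' => ha (hS h')

theorem Store.write_of_ne (s : Store) {a a' : ℕ} (h : a' ≠ a) (x v : ℕ) :
    s.write a x v a' = s a' := by
  funext x'
  unfold Store.write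
  rw [if_neg fun h' => h h'.1]

theorem Store.write_self (s : Store) (a x v : ℕ) : s.write a x v a x = v := by
  unfold Store.write
  rw [if_pos ⟨rfl, rfl⟩]

theorem Store.write_apply (s : Store) (a x v x' : ℕ) :
    s.write a x v a x' = if x' = x then v else s a x' := by
  unfold Store.write
  exact if_congr (by simp) rfl rfl

theorem Store.write_write (s : Store) (a x v v' : ℕ) :
    (s.write a x v).write a x v' = s.write a x v' := by
  funext a' x'
  unfold Store.write
  split_ifs <;> rfl

theorem EqOff.write {S : Set ℕ} {s s' : Store} (h : EqOff S s s') {a : ℕ} (ha : a ∈ S)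
    (x v : ℕ) : EqOff S s (s'.write a x v) := fun a' ha' => by
  rw [Store.write_of_ne _ (by rintro rfl; exact ha' ha), h a' ha']

section LineRules

variable {α β : Type} {A q : ℕ} {s : Store}

theorem size_le_of_lt_two_pow {v q : ℕ} (h : v < 2 ^ q) : v.size ≤ q := Nat.size_le.2 h

/-- Symbolic execution of an assignment in a straight line. -/
theorem Sim.assign_seq (hq : 1 ≤ q) (hs : Bdd A q s) {a x v B : ℕ} {e₁ e₂ : AExp} {c : Cmd}
    {M : PMF α} {R : Store → α → Prop} (h₁ : e₁.Reads A) (h₂ : e₂.Reads A)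
    (hx : e₁.val s = x) (hv : e₂.val s = v) (h : Sim c (s.write a x v) B M R) :
    Sim (.set a e₁ e₂ ;; c) s ((Cmd.set a e₁ e₂).lineWeight * q + B) M R := by
  subst hx hv
  exact Det.seq_sim (Q := fun s' => s' = s.write a (e₁.val s) (e₂.val s))
    (Det.assign hq hs h₁ h₂ rfl) fun s' hs' => hs' ▸ h

theorem Det.assign_last (hq : 1 ≤ q) (hs : Bdd A q s) {a x v : ℕ} {e₁ e₂ : AExp}
    {Q : Store → Prop} (h₁ : e₁.Reads A) (h₂ : e₂.Reads A)
    (hx : e₁.val s = x) (hv : e₂.val s = v) (h : Q (s.write a x v)) :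
    Det (.set a e₁ e₂) s ((Cmd.set a e₁ e₂).lineWeight * q) Q := by
  subst hx hv
  exact Det.assign hq hs h₁ h₂ h

theorem Sim.rand (hq : 1 ≤ q) (hs : Bdd A q s) {a x m : ℕ} {e₁ e₂ : AExp}
    {R : Store → ℕ → Prop} (h₁ : e₁.Reads A) (h₂ : e₂.Reads A)
    (hx : e₁.val s = x) (hm : e₂.val s = m) (h : ∀ v ≤ m, R (s.write a x v) v) :
    Sim (.rand a e₁ e₂) s ((Cmd.rand a e₁ e₂).lineWeight * q) (uniformUpTo m) R := by
  subst hx hm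
  exact SimC.rand a e₁ e₂ fun v hv => ⟨AExp.assign_cost_le hq hs h₁ h₂, h v hv⟩

theorem Sim.ite_line (hq : 1 ≤ q) (hs : Bdd A q s) {e : AExp} (he : e.Reads A) {c₁ c₂ : Cmd}
    {M : PMF α} {R : Store → α → Prop}
    (h₁ : e.val s ≠ 0 → Sim c₁ s (c₁.lineWeight * q) M R)
    (h₂ : e.val s = 0 → Sim c₂ s (c₂.lineWeight * q) M R) :
    Sim (.ite e c₁ c₂) s ((Cmd.ite e c₁ c₂).lineWeight * q) M R := by
  rw [Cmd.lineWeight, add_mul]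
  refine Sim.ite ?_ (fun h => (h₁ h).mono ?_ fun _ _ h => h)
    (fun h => (h₂ h).mono ?_ fun _ _ h => h)
  · have := AExp.cost_le hq hs he
    rw [add_mul]
    omega
  · exact Nat.mul_le_mul_right _ (Nat.le_add_right _ _)
  · exact Nat.mul_le_mul_right _ (Nat.le_add_left _ _)

/-- `for v = 0, 1, …` while `v < e`. -/
def Cmd.for (v : ℕ) (e : AExp) (c : Cmd) : Cmd :=
  .assign v (.lit 0) ;; .while (.var v <ₑ e) (c ;; .assign v (.var v +ₑ .lit 1))

/-- The overhead of one iteration of a loop. -/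
def Cmd.forWeight (v : ℕ) (e : AExp) : ℕ :=
  AExp.assignWeight (.lit 0) (.lit 0) + ((AExp.var v <ₑ e).weight + 1) +
    AExp.assignWeight (.lit 0) (.var v +ₑ .lit 1)

theorem Sim.for {v n B : ℕ} {e : AExp} {c : Cmd} {M : ℕ → α → PMF α}
    (Inv : ℕ → Store → α → Prop) {a : α} (hq : 1 ≤ q) (hv : v < A) (he : e.Reads A)
    (hinv : ∀ i ≤ n, ∀ s a, Inv i s a → Bdd A q s ∧ e.val s = n ∧ s v 0 = i)
    (hbody : ∀ i < n, ∀ s a, Inv i s a → Sim c s B (M i a) fun s' a' =>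
      Bdd A q s' ∧ s' v 0 = i ∧ Inv (i + 1) (s'.write v 0 (i + 1)) a')
    (hs : Bdd A q s) (h0 : Inv 0 (s.write v 0 0) a) :
    Sim (.for v e c) s ((n + 1) * (B + Cmd.forWeight v e * q)) (iterFrom M 0 n a) (Inv n) := by
  have hr : (AExp.var v <ₑ e).Reads A := ⟨⟨hv, trivial⟩, he⟩
  have h1 := Sim.while (c := c ;; .assign v (.var v +ₑ .lit 1)) (e := .var v <ₑ e) (n := n)
    (B := B + AExp.assignWeight (.lit 0) (.var v +ₑ .lit 1) * q)
    (B' := ((AExp.var v <ₑ e).weight + 1) * q) (s := s.write v 0 0) (a := a) (M := M)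
    (Inv := Inv) ?_ ?_ ?_ h0
  · refine Sim.mono (Sim.assign_seq hq hs trivial trivial rfl rfl h1) ?_ fun _ _ h => h
    simp only [Cmd.lineWeight, Cmd.forWeight]
    generalize AExp.assignWeight (.lit 0) (.lit 0) = w₁
    generalize (AExp.var v <ₑ e).weight = w₂
    generalize AExp.assignWeight (.lit 0) (.var v +ₑ .lit 1) = w₃
    have e1 : (n + 1) * (B + (w₁ + (w₂ + 1) + w₃) * q) =
      w₁ * q + (n * ((w₂ + 1) * q + (B + w₃ * q)) + (w₂ + 1) * q) +
        (n * (w₁ * q) + B + w₃ * q) := by ring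
    rw [e1]
    exact Nat.le_add_right _ _
  · intro i hi s a h
    obtain ⟨hb, -, -⟩ := hinv i hi s a h
    have := AExp.cost_le hq hb hr
    rw [add_mul]
    omega
  · intro i hi s a h
    obtain ⟨-, h1, h2⟩ := hinv i hi s a h
    simp only [AExp.val, BinOp.apply, h1, h2]
    split_ifs with h3 <;> simp [h3]
  · intro i hi s a h
    refine Sim.seq_det (hbody i hi s a h) fun s' a' h' => ?_
    exact Det.assign (e₁ := .lit 0) (e₂ := .var v +ₑ .lit 1) hq h'.1 trivial ⟨⟨hv, trivial⟩,
        trivial⟩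
      (by simpa only [AExp.val, BinOp.apply, h'.2.1] using h'.2.2)

theorem Det.for {v n B : ℕ} {e : AExp} {c : Cmd}
    (Inv : ℕ → Store → Prop) (hq : 1 ≤ q) (hv : v < A) (he : e.Reads A)
    (hinv : ∀ i ≤ n, ∀ s, Inv i s → Bdd A q s ∧ e.val s = n ∧ s v 0 = i)
    (hbody : ∀ i < n, ∀ s, Inv i s → Det c s B fun s' =>
      Bdd A q s' ∧ s' v 0 = i ∧ Inv (i + 1) (s'.write v 0 (i + 1)))
    (hs : Bdd A q s) (h0 : Inv 0 (s.write v 0 0)) :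
    Det (.for v e c) s ((n + 1) * (B + Cmd.forWeight v e * q)) (Inv n) := by
  have := Sim.for (c := c) (a := ()) (M := fun _ a => PMF.pure a) (fun i s _ => Inv i s) hq hv he
    (fun i hi s _ => hinv i hi s) (fun i hi s _ => hbody i hi s) hs h0
  rwa [iterFrom_pure] at this

end LineRules

/-! ### Coins -/

/-- The command `c` puts the outcome of a coin of bias `μ` into the variable `22`. -/
structure IsCoin (μ : unitInterval) (c : Cmd) (w : ℕ) : Prop where
  sim : ∀ (s : Store) (q : ℕ), 1 ≤ q →
    Sim c s (w * q) (bern μ) fun s' v => s' = s.write 22 0 v.toNat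

theorem isCoin_flip (μ : unitInterval) : IsCoin μ (.flip 22 (.lit 0) μ) 2 where
  sim s q hq := by
    have h := SimC.flip (s := s) 22 (.lit 0) μ (R := fun s' t v => t ≤ 2 * q ∧ v ≤ 1 ∧
      s' = s.write 22 0 v) fun v hv => ⟨by simp [AExp.cost, AExp.val]; omega, hv, rfl⟩
    refine SimC.map h _ fun s' t v hv => ⟨hv.1, ?_⟩
    rw [hv.2.2]
    have := hv.2.1
    interval_cases v <;> rfl

theorem isCoin_rand (μ : unitInterval) {x y : ℕ} (hy : 0 < y) (hxy : x ≤ y)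
    (hμ : (μ : ℝ) = x / y) :
    ∃ w, IsCoin μ (.rand 22 (.lit 0) (.lit (y - 1)) ;; .assign 22 (.var 22 <ₑ .lit x)) w := by
  refine ⟨20 + 10 * y.size, ⟨fun s q hq => ?_⟩⟩
  rw [← uniformUpTo_map_lt_eq_bern μ hy hxy hμ]
  have hsz : (y - 1).size ≤ y.size := Nat.size_le_size (Nat.sub_le _ _)
  have hxs : x.size ≤ y.size := Nat.size_le_size hxy
  refine (Sim.seq_map (B₁ := 10 + 2 * y.size) (B₂ := 10 + 8 * y.size)
    (R₁ := fun s' v => v ≤ y - 1 ∧ s' = s.write 22 0 v)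
    (SimC.rand 22 (.lit 0) (.lit (y - 1)) ?_) ?_).mono ?_ fun _ _ h => h
  · intro v hv
    refine ⟨?_, hv, rfl⟩
    simp only [AExp.cost, AExp.val, Nat.size_zero]
    omega
  · rintro s' v ⟨hv, rfl⟩
    have hvs : v.size ≤ y.size := (Nat.size_le_size hv).trans hsz
    refine Det.set ?_ ?_
    · have h1 : (if v < x then 1 else 0 : ℕ).size ≤ 1 := by split_ifs <;> simp
      simp only [AExp.cost, AExp.val, BinOp.apply, Nat.size_zero, Store.write_self]
      omega
    · simp only [AExp.val, BinOp.apply, Store.write_self]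
      rw [Store.write_write]
      by_cases h : v < x <;> simp [h]
  · calc 10 + 2 * y.size + (10 + 8 * y.size) = (20 + 10 * y.size) * 1 := by ring
      _ ≤ _ := Nat.mul_le_mul_left _ hq

/-! ### The program: sampling -/

/-- Counts the heads among `t` coin flips, with `t` the value of variable `5`. -/
def countHeads (coinCmd : Cmd) : Cmd :=
  .for 23 (.var 5) (coinCmd ;; .assign 21 (.var 21 +ₑ .var 22))

theorem countHeads_sim {μ : unitInterval} {coinCmd : Cmd} {w : ℕ} (hc : IsCoin μ coinCmd w)
    {q t : ℕ} (hq : 1 ≤ q) (ht : t < 2 ^ q) {s : Store} (hs : Bdd 30 q s) (h5 : s 5 0 = t)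
    (h21 : s 21 0 = 0) :
    Sim (countHeads coinCmd) s ((t + 1) * ((w * q +
        (Cmd.assign 21 (.var 21 +ₑ .var 22)).lineWeight * q) + Cmd.forWeight 23 (.var 5) * q))
      (headCount μ t) fun s' W => Bdd 30 q s' ∧ EqOff {21, 22, 23} s s' ∧ s' 21 0 = W := by
  have h1 : 1 < 2 ^ q := Nat.one_lt_two_pow (by omega)
  refine (Sim.for (A := 30) (e := .var 5) (fun i s' W => Bdd 30 q s' ∧ EqOff {21, 22, 23} s s' ∧
      s' 21 0 = W ∧
    W ≤ i ∧ s' 23 0 = i) hq (by norm_num) ⟨by norm_num, trivial⟩ ?_ ?_ hs ?_).mono le_rfl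
    fun s' W h => ⟨h.1, h.2.1, h.2.2.1⟩
  · rintro i hi s' W ⟨hb, he, -, -, h23⟩
    exact ⟨hb, (congrFun (he 5 (by simp)) 0).trans h5, h23⟩
  · rintro i hi s' W ⟨hb, he, h21, hW, h23⟩
    refine Sim.seq_map (hc.sim s' q hq) ?_
    rintro _ c rfl
    have hb' : Bdd 30 q (s'.write 22 0 c.toNat) :=
      hb.write (size_le_of_lt_two_pow (by cases c <;> simp; omega))
    refine Det.assign_last (x := 0) (v := W + c.toNat) hq hb' trivial
      ⟨⟨by norm_num, trivial⟩, by norm_num, trivial⟩ rfl ?_ ?_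
    · simp [AExp.val, BinOp.apply, Store.write, h21]
    · have hc1 : c.toNat ≤ 1 := by cases c <;> simp
      have hb2 := hb'.write (a := 21) (x := 0) (v := W + c.toNat)
        (size_le_of_lt_two_pow (by omega))
      exact ⟨hb2, by simp [Store.write, h23], hb2.write (size_le_of_lt_two_pow (by omega)),
        ((he.write (by simp) _ _).write (by simp) _ _).write (by simp) _ _,
        by simp [Store.write], by omega, by simp [Store.write]⟩
  · exact ⟨hs.write (by simp), (EqOff.refl _ s).write (by simp) _ _,
      by simpa [Store.write] using h21,
      le_rfl, by simp [Store.write]⟩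

/-- The random choices for the input bit whose address is in variable `17`. -/
def sampleBody (coinCmd : Cmd) (m : ℕ) : Cmd :=
  .assign 21 (.lit 0) ;; countHeads coinCmd ;; coinCmd ;; .set 12 (.var 17) (.var 22) ;;
  .rand 22 (.lit 0) (.var 3 *ₑ .lit (2 * m - 2) -ₑ .lit 1) ;;
  .set 13 (.var 17) (.var 22 <ₑ (.var 21 -ₑ .var 3)) ;;
  .rand 14 (.var 17) (.lit (m - 1)) ;;
  .rand 15 (.var 17) (.get 4 (.var 3) -ₑ .lit 2)

/-- A bound for the cost of `sampleBody`. -/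
def sampleBodyCost (w m t q : ℕ) : ℕ :=
  (t + 1) * ((w * q + (Cmd.assign 21 (.var 21 +ₑ .var 22)).lineWeight * q) +
    Cmd.forWeight 23 (.var 5) * q) + w * q + (Cmd.assign 21 (.lit 0) ;;
  .set 12 (.var 17) (.var 22) ;;
  .rand 22 (.lit 0) (.var 3 *ₑ .lit (2 * m - 2) -ₑ .lit 1) ;;
  .set 13 (.var 17) (.var 22 <ₑ (.var 21 -ₑ .var 3)) ;;
  .rand 14 (.var 17) (.lit (m - 1)) ;;
  .rand 15 (.var 17) (.get 4 (.var 3) -ₑ .lit 2)).lineWeight * q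

/-- Cell `x` of the four tables of random choices holds the sample `v`. -/
def HoldsSample (s : Store) (x : ℕ) (v : Sample) : Prop :=
  s 12 x = v.1.toNat ∧ s 13 x = v.2.1.toNat ∧ s 14 x = v.2.2.1 ∧ s 15 x = v.2.2.2

theorem sampleBody_sim {μ : unitInterval} {coinCmd : Cmd} {w : ℕ} (hc : IsCoin μ coinCmd w)
    {q m sz x : ℕ} (hq : 1 ≤ q) (ht : 2 * m * sz < 2 ^ q) (hsz : sz < q) (hm : m < 2 ^ q)
    {s : Store}
    (hs : Bdd 30 q s) (h3 : s 3 0 = sz) (h4 : s 4 sz = 2 ^ sz) (h5 : s 5 0 = 2 * m * sz)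
    (h17 : s 17 0 = x) :
    Sim (sampleBody coinCmd m) s (sampleBodyCost w m (2 * m * sz) q) (drawSample μ m sz)
      fun s' v => Bdd 30 q s' ∧ EqOff {12, 13, 14, 15, 21, 22, 23} s s' ∧ HoldsSample s' x v ∧
        ∀ x' ≠ x, ∀ v', HoldsSample s x' v' → HoldsSample s' x' v' := by
  have h1 : 1 < 2 ^ q := Nat.one_lt_two_pow (by omega)
  have hpow : 2 ^ sz < 2 ^ q := Nat.pow_lt_pow_right (by norm_num) hsz
  have hV : sz * (2 * m - 2) - 1 < 2 ^ q := by
    calc sz * (2 * m - 2) - 1 ≤ sz * (2 * m) :=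
          (Nat.sub_le _ _).trans (Nat.mul_le_mul_left _ (Nat.sub_le _ _))
      _ = 2 * m * sz := mul_comm _ _
      _ < 2 ^ q := ht
  refine Sim.mono (Sim.assign_seq hq hs trivial trivial rfl rfl
    (Sim.seq (countHeads_sim hc hq ht (hs.write (by simp [AExp.val])) ?_ (Store.write_self _ _ _ _))
    (B₂ := w * q + (Cmd.set 12 (.var 17) (.var 22) ;;
      .rand 22 (.lit 0) (.var 3 *ₑ .lit (2 * m - 2) -ₑ .lit 1) ;;
      .set 13 (.var 17) (.var 22 <ₑ (.var 21 -ₑ .var 3)) ;;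
      .rand 14 (.var 17) (.lit (m - 1)) ;;
      .rand 15 (.var 17) (.get 4 (.var 3) -ₑ .lit 2)).lineWeight * q) ?_)) ?_ fun _ _ h => h
  · rw [Store.write_of_ne _ (by norm_num), h5]
  · rintro s₁ W ⟨hb₁, he₁, h21₁⟩
    have he₁' : EqOff {12, 13, 14, 15, 21, 22, 23} s s₁ :=
      EqOff.trans ((EqOff.refl _ s).write (a := 21) (by simp) 0 _) (he₁.mono (by
        intro a ha; simp at ha ⊢; tauto))
    refine Sim.seq (hc.sim s₁ q hq) ?_
    rintro _ al rfl
    have hal : al.toNat ≤ 1 := by cases al <;> simp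
    have hb₂ : Bdd 30 q (s₁.write 22 0 al.toNat) := hb₁.write (size_le_of_lt_two_pow (by omega))
    have he₂ := he₁'.write (a := 22) (by simp) 0 al.toNat
    have e17 : ∀ {s'}, EqOff {12, 13, 14, 15, 21, 22, 23} s s' → s' 17 0 = x :=
      fun h => (congrFun (h 17 (by simp)) 0).trans h17
    have e3 : ∀ {s'}, EqOff {12, 13, 14, 15, 21, 22, 23} s s' → s' 3 0 = sz :=
      fun h => (congrFun (h 3 (by simp)) 0).trans h3
    have e4 : ∀ {s'}, EqOff {12, 13, 14, 15, 21, 22, 23} s s' → s' 4 sz = 2 ^ sz :=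
      fun h => (congrFun (h 4 (by simp)) sz).trans h4
    have f21 : s₁.write 22 0 al.toNat 21 0 = W := by
      rw [Store.write_of_ne _ (by norm_num), h21₁]
    have f22 : s₁.write 22 0 al.toNat 22 0 = al.toNat := Store.write_self _ _ _ _
    have f : ∀ a ∈ ({12, 13, 14, 15} : Set ℕ), s₁.write 22 0 al.toNat a = s a := by
      intro a ha
      rw [Store.write_of_ne _ (by rintro rfl; simp at ha),
        he₁ a (by rintro h; simp at ha h; omega), Store.write_of_ne _ (by rintro rfl; simp at ha)]
    generalize s₁.write 22 0 al.toNat = s₂ at hb₂ he₂ f21 f22 f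
    rw [Cmd.lineWeight, add_mul]
    refine Sim.assign_seq (x := x) (v := al.toNat) hq hb₂ ⟨by norm_num, trivial⟩
      ⟨by norm_num, trivial⟩ (e17 he₂) f22 ?_
    have hb₃ := hb₂.write (a := 12) (x := x) (v := al.toNat) (size_le_of_lt_two_pow (by omega))
    have he₃ := he₂.write (a := 12) (by simp) x al.toNat
    rw [Cmd.lineWeight, add_mul]
    refine Sim.seq (Sim.rand (x := 0) (m := sz * (2 * m - 2) - 1)
      (R := fun s' V => V < 2 ^ q ∧ s' = (s₂.write 12 x al.toNat).write 22 0 V) hq hb₃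
      trivial ⟨⟨⟨by norm_num, trivial⟩, trivial⟩, trivial⟩ rfl ?_
      fun v hv => ⟨by omega, rfl⟩) ?_
    · simp only [AExp.val, BinOp.apply, e3 he₃]
    rintro _ V ⟨hVq, rfl⟩
    have hb₄ := hb₃.write (a := 22) (x := 0) (v := V) (size_le_of_lt_two_pow hVq)
    have he₄ := he₃.write (a := 22) (by simp) 0 V
    have hbe : (decide (V < W - sz)).toNat ≤ 1 := by cases decide (V < W - sz) <;> simp
    rw [Cmd.lineWeight, add_mul]
    refine Sim.assign_seq (x := x) (v := (decide (V < W - sz)).toNat) hq hb₄ ⟨by norm_num, trivial⟩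
      ⟨⟨by norm_num, trivial⟩, ⟨by norm_num, trivial⟩, by norm_num, trivial⟩ (e17 he₄) ?_ ?_
    · simp only [AExp.val, BinOp.apply, e3 he₄]
      simp only [Store.write_apply, if_true, Store.write_of_ne _ (show 21 ≠ 22 by norm_num),
        Store.write_of_ne _ (show 21 ≠ 12 by norm_num), f21]
      by_cases h : V < W - sz <;> simp [h]
    have hb₅ := hb₄.write (a := 13) (x := x) (v := (decide (V < W - sz)).toNat)
      (size_le_of_lt_two_pow (by omega))
    have he₅ := he₄.write (a := 13) (by simp) x (decide (V < W - sz)).toNat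
    rw [Cmd.lineWeight, add_mul]
    refine Sim.seq (Sim.rand (x := x) (m := m - 1)
      (R := fun s' p => p < 2 ^ q ∧ s' = (((s₂.write 12 x al.toNat).write 22 0 V).write 13 x
        (decide (V < W - sz)).toNat).write 14 x p) hq hb₅
      ⟨by norm_num, trivial⟩ trivial (e17 he₅) rfl fun v hv => ⟨by omega, rfl⟩) ?_
    rintro _ p ⟨hp, rfl⟩
    have hb₆ := hb₅.write (a := 14) (x := x) (v := p) (size_le_of_lt_two_pow hp)
    have he₆ := he₅.write (a := 14) (by simp) x p
    refine Sim.map (Sim.rand (e₁ := .var 17) (e₂ := .get 4 (.var 3) -ₑ .lit 2) (x := x)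
      (m := 2 ^ sz - 2) hq hb₆
      ⟨by norm_num, trivial⟩ ⟨⟨by norm_num, ⟨by norm_num, trivial⟩⟩, trivial⟩ (e17 he₆) ?_
      (R := fun s' u => u < 2 ^ q ∧ s' = ((((s₂.write 12 x al.toNat).write 22 0 V).write 13 x
        (decide (V < W - sz)).toNat).write 14 x p).write 15 x u) fun u hu => ⟨by omega, rfl⟩) _ ?_
    · simp only [AExp.val, BinOp.apply, e3 he₆, e4 he₆]
    rintro _ u ⟨hu, rfl⟩
    refine ⟨hb₆.write (size_le_of_lt_two_pow hu), he₆.write (by simp) _ _, ?_, ?_⟩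
    · simp [HoldsSample, Store.write]
    · rintro x' hx' v' ⟨g1, g2, g3, g4⟩
      simp [HoldsSample, Store.write, hx', f 12, f 13, f 14, f 15, g1, g2, g3, g4]
  · simp only [sampleBodyCost, Cmd.lineWeight]
    apply le_of_eq
    ring

/-- Makes the random choices for all input bits. -/
def sampleAll (coinCmd : Cmd) (m : ℕ) : Cmd := .for 17 (.var 9) (sampleBody coinCmd m)

theorem sampleAll_sim {μ : unitInterval} {coinCmd : Cmd} {w : ℕ} (hc : IsCoin μ coinCmd w)
    {q m sz N : ℕ} (hq : 1 ≤ q) (ht : 2 * m * sz < 2 ^ q) (hsz : sz < q) (hm : m < 2 ^ q)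
    (hN : N < 2 ^ q) {s : Store}
    (hs : Bdd 30 q s) (h3 : s 3 0 = sz) (h4 : s 4 sz = 2 ^ sz) (h5 : s 5 0 = 2 * m * sz)
    (h9 : s 9 0 = N) :
    Sim (sampleAll coinCmd m) s
      ((N + 1) * (sampleBodyCost w m (2 * m * sz) q + Cmd.forWeight 17 (.var 9) * q))
      (sampleTable μ m sz N)
      fun s' v => Bdd 30 q s' ∧ EqOff {12, 13, 14, 15, 17, 21, 22, 23} s s' ∧
        ∀ x < N, HoldsSample s' x (v x) := by
  refine (Sim.for (A := 30) (e := .var 9) (fun i s' v => Bdd 30 q s' ∧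
    EqOff {12, 13, 14, 15, 17, 21, 22, 23} s s' ∧ s' 17 0 = i ∧ ∀ x < i, HoldsSample s' x (v x))
    hq (by norm_num) ⟨by norm_num, trivial⟩ ?_ ?_ hs ?_).mono le_rfl
    fun s' W h => ⟨h.1, h.2.1, h.2.2.2⟩
  · rintro i hi s' v ⟨hb, he, h17, -⟩
    exact ⟨hb, (congrFun (he 9 (by simp)) 0).trans h9, h17⟩
  · rintro i hi s' v ⟨hb, he, h17, hv⟩
    refine Sim.map (sampleBody_sim hc hq ht hsz hm hb ((congrFun (he 3 (by simp)) 0).trans h3)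
      ((congrFun (he 4 (by simp)) sz).trans h4) ((congrFun (he 5 (by simp)) 0).trans h5) h17) _ ?_
    rintro s₁ smp ⟨hb₁, he₁, hx, hx'⟩
    refine ⟨hb₁, by rw [he₁ 17 (by simp), h17], hb₁.write (size_le_of_lt_two_pow (by omega)),
      (he.trans (he₁.mono ?_)).write (by simp) _ _, Store.write_self _ _ _ _, ?_⟩
    · intro a ha; simp at ha ⊢; tauto
    · intro x hxi
      have key : HoldsSample s₁ x (Function.update v i smp x) := by
        rcases Nat.lt_succ_iff_lt_or_eq.1 hxi with h | rfl
        · rw [Function.update_of_ne h.ne]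
          exact hx' x h.ne _ (hv x h)
        · rwa [Function.update_self]
      unfold HoldsSample at key ⊢
      simpa only [Store.write_of_ne _ (show 12 ≠ 17 by norm_num),
        Store.write_of_ne _ (show 13 ≠ 17 by norm_num),
        Store.write_of_ne _ (show 14 ≠ 17 by norm_num),
        Store.write_of_ne _ (show 15 ≠ 17 by norm_num)] using key
  · exact ⟨hs.write (by simp), (EqOff.refl _ s).write (by simp) _ _, Store.write_self _ _ _ _,
      fun x hx => absurd hx (Nat.not_lt_zero x)⟩

/-! ### The program: queries -/

/-- The memory holds the input (with the input bits `y`) and the parameters computed from it. -/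
structure Env (k n g b m sz : ℕ) (y : ℕ → Bool) (s : Store) : Prop where
  n_eq : s 0 0 = n
  g_eq : s 0 1 = g
  b_eq : s 0 2 = b
  y_eq : ∀ x, s 1 x = (y x).toNat
  levels_eq : s 3 0 = sz
  pow_eq : ∀ j ≤ sz, s 4 j = 2 ^ j
  bits_eq : s 5 0 = 2 * m * sz
  queries_eq : s 6 0 = (2 * m * sz) ^ (g * k)
  stripes_eq : s 7 0 = sz * sz * (2 * m * sz) ^ (g * k)
  vars_eq : s 9 0 = numVars k n g b
  blocks_eq : s 10 0 = g * k
  trials_eq : s 11 0 = sz * sz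

/-- The arrays that are modified after the initialization. These are the output `2`, the number `8`
of the current stripe, the tables `12`, …, `15` of random choices, the table `16` of the digits of
the current query, loop variables and other scalars in `17`, …, `33`, and the arrays of the simulated
solver from `simBase` on. The arrays below `30` contain small numbers only. -/
def workArrays : Set ℕ := {a | a = 2 ∨ a = 8 ∨ 12 ≤ a}

theorem Env.of_eqOff {k n g b m sz : ℕ} {y : ℕ → Bool} {s s' : Store}
    (h : Env k n g b m sz y s) (hs : EqOff workArrays s s') : Env k n g b m sz y s' := by
  have h' : ∀ a, (a = 0 ∨ a = 1 ∨ (3 ≤ a ∧ a ≤ 7) ∨ (9 ≤ a ∧ a ≤ 11)) → s' a = s a :=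
    fun a ha => hs a (by simp only [workArrays, Set.mem_ofPred_eq]; omega)
  obtain ⟨h1, h2, h3, h4, h5, h6, h7, h8, h9, h10, h11, h12⟩ := h
  constructor
  · rw [h' 0 (by norm_num), h1]
  · rw [h' 0 (by norm_num), h2]
  · rw [h' 0 (by norm_num), h3]
  · rw [h' 1 (by norm_num)]; exact h4
  · rw [h' 3 (by norm_num), h5]
  · rw [h' 4 (by norm_num)]; exact h6
  · rw [h' 5 (by norm_num), h7]
  · rw [h' 6 (by norm_num), h8]
  · rw [h' 7 (by norm_num), h9]
  · rw [h' 9 (by norm_num), h10]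
  · rw [h' 10 (by norm_num), h11]
  · rw [h' 11 (by norm_num), h12]

/-- All numbers that occur, apart from the answers of the oracle, have at most `q` bits. -/
structure Sizes (k n g b m sz q : ℕ) : Prop where
  q_pos : 1 ≤ q
  m_pos : 0 < m
  levels_pos : 0 < sz
  levels_lt : sz < q
  n_lt : n < 2 ^ q
  g_lt : g < 2 ^ q
  b_le : b ≤ sz
  m_lt : m < 2 ^ q
  bits_lt : 2 * m * sz < 2 ^ q
  queries_lt : (2 * m * sz) ^ (g * k) < 2 ^ q
  stripes_lt : sz * sz * (2 * m * sz) ^ (g * k) < 2 ^ q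
  vars_lt : numVars k n g b < 2 ^ q
  blocks_lt : g * k < 2 ^ q
  trials_lt : sz * sz < 2 ^ q
  coeff_lt : 2 ^ (sz * (g * k)) < 2 ^ q

section Query

variable {k n g b m sz q : ℕ} {y : ℕ → Bool} {s : Store}

theorem Bdd.write_lt {A q : ℕ} {s : Store} (h : Bdd A q s) {a x v : ℕ} (hv : v < 2 ^ q) :
    Bdd A q (s.write a x v) := h.write (size_le_of_lt_two_pow hv)

theorem queryCoeff_le {t d a : ℕ} (ht : t = 2 * m * sz) (htpos : 0 < t) :
    queryCoeff m t d a ≤ 2 ^ (sz * d) := by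
  unfold queryCoeff
  calc ∏ B ∈ Finset.range d, 2 ^ (digit t a B / (2 * m)) ≤ ∏ _B ∈ Finset.range d, 2 ^ sz := by
        refine Finset.prod_le_prod' fun B _ => Nat.pow_le_pow_right (by norm_num) ?_
        have : digit t a B < t := Nat.mod_lt _ htpos
        exact (Nat.div_lt_of_lt_mul (by rwa [← ht])).le
    _ = 2 ^ (sz * d) := by rw [Finset.prod_const, Finset.card_range, pow_mul]

theorem querySign_le (t d a : ℕ) : querySign t d a ≤ d := by
  unfold querySign
  calc ∑ B ∈ Finset.range d, digit t a B % 2 ≤ ∑ _B ∈ Finset.range d, 1 :=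
        Finset.sum_le_sum fun B _ => by omega
    _ = d := by simp

/-- The body of the loop that computes the digits of the number of a query, and with them the
coefficient of the query. -/
def digitStep (m : ℕ) : Cmd :=
  .set 16 (.var 19) ((.var 18 /ₑ .var 24) %ₑ .var 5) ;;
  .assign 25 (.var 25 *ₑ .get 4 (.get 16 (.var 19) /ₑ .lit (2 * m))) ;;
  .assign 26 (.var 26 +ₑ .get 16 (.var 19) %ₑ .lit 2) ;;
  .assign 24 (.var 24 *ₑ .var 5)

/-- Decomposes the number of the query, which is in variable `18`. -/
def digitsCmd (m : ℕ) : Cmd :=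
  .assign 24 (.lit 1) ;; .assign 25 (.lit 1) ;; .assign 26 (.lit 0) ;;
  .for 19 (.var 10) (digitStep m)

/-- The facts about the digits of the query number `a` after `i` steps. -/
structure Digits (m t i a : ℕ) (s : Store) : Prop where
  power : s 24 0 = t ^ i
  coeff : s 25 0 = queryCoeff m t i a
  sign : s 26 0 = querySign t i a
  digit : ∀ B < i, s 16 B = digit t a B

theorem digitStep_det (hz : Sizes k n g b m sz q) (he : Env k n g b m sz y s) (hs : Bdd 30 q s)
    {a i : ℕ} (hi : i < g * k) (ha : s 18 0 = a) (hd : Digits m (2 * m * sz) i a s)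
    (h19 : s 19 0 = i) :
    Det (digitStep m) s ((digitStep m).lineWeight * q) fun s' =>
      Bdd 30 q s' ∧ EqOff {16, 24, 25, 26} s s' ∧ Digits m (2 * m * sz) (i + 1) a s' := by
  have hq := hz.q_pos
  set t := 2 * m * sz with ht
  have htpos : 0 < t := by have := hz.m_pos; have := hz.levels_pos; positivity
  have hdig : digit t a i < t := Nat.mod_lt _ htpos
  have hlev : digit t a i / (2 * m) < sz := Nat.div_lt_of_lt_mul hdig
  have hpw := he.pow_eq _ hlev.le
  have htq : t < 2 ^ q := hz.bits_lt
  have hcoeff : queryCoeff m t (i + 1) a < 2 ^ q :=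
    (queryCoeff_le ht htpos).trans_lt ((Nat.pow_le_pow_right (by norm_num)
      (Nat.mul_le_mul_left _ hi)).trans_lt hz.coeff_lt)
  have hsign : querySign t (i + 1) a < 2 ^ q :=
    (querySign_le _ _ _).trans_lt (lt_of_le_of_lt hi hz.blocks_lt)
  have hpow : t ^ (i + 1) < 2 ^ q := (Nat.pow_le_pow_right htpos hi).trans_lt hz.queries_lt
  have hb1 := hs.write_lt (a := 16) (x := i) (hdig.trans htq)
  have hb2 := hb1.write_lt (a := 25) (x := 0) hcoeff
  have hb3 := hb2.write_lt (a := 26) (x := 0) hsign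
  have hb4 := hb3.write_lt (a := 24) (x := 0) hpow
  rw [digitStep, Cmd.lineWeight, add_mul]
  refine Sim.assign_seq (x := i) (v := digit t a i) hq hs ⟨by norm_num, trivial⟩
    ⟨⟨⟨by norm_num, trivial⟩, by norm_num, trivial⟩, by norm_num, trivial⟩ h19 ?_ ?_
  · simp only [AExp.val, BinOp.apply, ha, hd.power, he.bits_eq, ht, digit]
  rw [Cmd.lineWeight, add_mul]
  refine Sim.assign_seq (x := 0) (v := queryCoeff m t (i + 1) a) hq hb1 trivial
    ⟨⟨by norm_num, trivial⟩, by norm_num, ⟨by norm_num, by norm_num, trivial⟩, trivial⟩ rfl ?_ ?_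
  · simp [AExp.val, BinOp.apply, Store.write, h19, hpw, hd.coeff, queryCoeff,
      Finset.prod_range_succ]
  rw [Cmd.lineWeight, add_mul]
  refine Sim.assign_seq (x := 0) (v := querySign t (i + 1) a) hq hb2 trivial
    ⟨⟨by norm_num, trivial⟩, ⟨by norm_num, by norm_num, trivial⟩, trivial⟩ rfl ?_ ?_
  · simp [AExp.val, BinOp.apply, Store.write, h19, hd.sign, querySign,
      Finset.sum_range_succ]
  refine Det.assign_last (x := 0) (v := t ^ (i + 1)) hq hb3 trivial
    ⟨⟨by norm_num, trivial⟩, by norm_num, trivial⟩ rfl ?_ ?_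
  · simp [AExp.val, BinOp.apply, Store.write, hd.power, he.bits_eq, ht, pow_succ]
  refine ⟨hb4, ((((EqOff.refl _ _).write (by simp) _ _).write (by simp) _ _).write
    (by simp) _ _).write (by simp) _ _, ⟨?_, ?_, ?_, ?_⟩⟩
  · simp [Store.write]
  · simp [Store.write]
  · simp [Store.write]
  · intro B hB
    rcases Nat.lt_succ_iff_lt_or_eq.1 hB with h | rfl
    · simp [Store.write, h.ne, hd.digit B h]
    · simp [Store.write]

/-- A bound for the cost of `digitsCmd`. -/
def digitsCost (m d q : ℕ) : ℕ :=
  (Cmd.assign 24 (.lit 1) ;; .assign 25 (.lit 1) ;; .assign 26 (.lit 0)).lineWeight * q +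
    (d + 1) * ((digitStep m).lineWeight * q + Cmd.forWeight 19 (.var 10) * q)

theorem digitsCmd_det (hz : Sizes k n g b m sz q) (he : Env k n g b m sz y s) (hs : Bdd 30 q s)
    {a : ℕ} (ha : s 18 0 = a) :
    Det (digitsCmd m) s (digitsCost m (g * k) q) fun s' =>
      Bdd 30 q s' ∧ EqOff {16, 19, 24, 25, 26} s s' ∧
        Digits m (2 * m * sz) (g * k) a s' := by
  have hq := hz.q_pos
  have h1 : 1 < 2 ^ q := Nat.one_lt_two_pow (by omega)
  have hb1 := hs.write_lt (a := 24) (x := 0) h1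
  have hb2 := hb1.write_lt (a := 25) (x := 0) h1
  have hb3 := hb2.write_lt (a := 26) (x := 0) (Nat.two_pow_pos q)
  have hwork : ({16, 19, 24, 25, 26} : Set ℕ) ⊆ workArrays := by
    intro a ha; simp [workArrays] at ha ⊢; omega
  have he3 : EqOff {16, 19, 24, 25, 26} s (((s.write 24 0 1).write 25 0 1).write 26 0 0) :=
    (((EqOff.refl _ _).write (by simp) _ _).write (by simp) _ _).write (by simp) _ _
  refine Sim.mono (Sim.assign_seq hq hs trivial trivial rfl rfl (Sim.assign_seq hq hb1 trivial
    trivial rfl rfl (Sim.assign_seq hq hb2 trivial trivial rfl rfl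
    (Det.for (A := 30) (B := (digitStep m).lineWeight * q) (e := .var 10) (fun i s' =>
        Bdd 30 q s' ∧ EqOff {16, 19, 24, 25, 26} s s' ∧
      s' 19 0 = i ∧ Digits m (2 * m * sz) i a s') hq (by norm_num) ⟨by norm_num, trivial⟩ ?_ ?_
      hb3 ?_)))) ?_ fun s' _ h => ⟨h.1, h.2.1, h.2.2.2⟩
  · rintro i hi s' ⟨hb, hoff, h19, -⟩
    exact ⟨hb, (he.of_eqOff (hoff.mono hwork)).blocks_eq, h19⟩
  · rintro i hi s' ⟨hb, hoff, h19, hd⟩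
    refine (digitStep_det hz (he.of_eqOff (hoff.mono hwork)) hb hi
      ((congrFun (hoff 18 (by simp)) 0).trans ha) hd h19).mono le_rfl ?_
    rintro s₁ ⟨hb₁, hoff₁, hd₁⟩
    refine ⟨hb₁, (congrFun (hoff₁ 19 (by simp)) 0).trans h19,
      hb₁.write_lt (lt_of_le_of_lt hi hz.blocks_lt),
      (hoff.trans (hoff₁.mono ?_)).write (by simp) _ _, Store.write_self _ _ _ _, ?_⟩
    · intro a ha; simp at ha ⊢; tauto
    · obtain ⟨g1, g2, g3, g4⟩ := hd₁
      constructor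
      · rw [Store.write_of_ne _ (by norm_num), g1]
      · rw [Store.write_of_ne _ (by norm_num), g2]
      · rw [Store.write_of_ne _ (by norm_num), g3]
      · rw [Store.write_of_ne _ (by norm_num)]; exact g4
  · refine ⟨hb3.write_lt (Nat.two_pow_pos q), he3.write (by simp) _ _, Store.write_self _ _ _ _,
      ⟨?_, ?_, ?_, ?_⟩⟩
    · simp [Store.write, AExp.val]
    · simp [Store.write, AExp.val, queryCoeff]
    · simp [Store.write, AExp.val, querySign]
    · intro B hB
      exact absurd hB (Nat.not_lt_zero B)
  · simp only [digitsCost, Cmd.lineWeight]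
    apply le_of_eq
    ring

/-- The number of the block to which the input bit in variable `17` belongs. -/
def blockExp (k : ℕ) : AExp :=
  (.var 17 /ₑ .get 4 (.get 0 (.lit 2))) %ₑ .get 0 (.lit 1) *ₑ .lit k +ₑ
    .var 17 /ₑ (.get 0 (.lit 0) *ₑ .get 0 (.lit 1) *ₑ .get 4 (.get 0 (.lit 2)))

theorem blockExp_val (hz : Sizes k n g b m sz q) (he : Env k n g b m sz y s) {x : ℕ}
    (hx : s 17 0 = x) :
    (blockExp k).val s = x / 2 ^ b % g * k + x / (n * g * 2 ^ b) := by
  simp only [blockExp, AExp.val, BinOp.apply, he.n_eq, he.g_eq, he.b_eq, hx, he.pow_eq b hz.b_le]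

/-- The number `U` that determines the carries for the input bit in variable `17`. -/
abbrev carryExp : AExp := .get 15 (.var 17) +ₑ .lit 1

/-- The power of two which is the coefficient of the split bit whose number is in variable `28`. -/
abbrev levelPowExp (m : ℕ) : AExp := .get 4 (.var 28 /ₑ .lit (2 * m))

/-- Says whether the input bit is set and its splitting has an unequal pair in the level. -/
abbrev activeExp (m : ℕ) : AExp :=
  .get 1 (.var 17) *ₑ (carryExp %ₑ levelPowExp m =ₑ .lit 0)

/-- Says whether the split bit belongs to the unequal pair of its level, if there is one. -/
abbrev pairExp (m : ℕ) : AExp := .var 28 /ₑ .lit 2 %ₑ .lit m =ₑ .get 14 (.var 17)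

/-- The split bit whose number is in variable `28`, for the input bit in variable `17`. -/
def splitBitExp (m : ℕ) : AExp :=
  activeExp m *ₑ (pairExp m *ₑ ((carryExp %ₑ (.lit 2 *ₑ levelPowExp m) =ₑ .lit 0) =ₑ
    .var 28 %ₑ .lit 2) +ₑ (.lit 1 -ₑ pairExp m) *ₑ .get 13 (.var 17)) +ₑ
    (.lit 1 -ₑ activeExp m) *ₑ .get 12 (.var 17)

theorem splitBitExp_val (he : Env k n g b m sz y s) {x e : ℕ} {v : Sample}
    (hx : s 17 0 = x) (h28 : s 28 0 = e) (hej : e / (2 * m) ≤ sz) (hv : HoldsSample s x v) :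
    (splitBitExp m).val s = (splitBit m (y x) v e).toNat := by
  obtain ⟨h12, h13, h14, h15⟩ := hv
  have hpw := he.pow_eq _ hej
  simp only [splitBitExp, AExp.val, BinOp.apply, hx, h28, h12, h13, h14, h15, hpw, he.y_eq,
    splitBit, Nat.dvd_iff_mod_eq_zero, pow_succ']
  set P := (v.2.2.2 + 1) % 2 ^ (e / (2 * m)) with hP
  set Q := (v.2.2.2 + 1) % (2 * 2 ^ (e / (2 * m))) with hQ
  set E := e / 2 % m with hE
  rcases Nat.mod_two_eq_zero_or_one e with h | h <;> rw [h] <;> cases y x <;>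
    by_cases h1 : P = 0 <;> by_cases h2 : Q = 0 <;> by_cases h3 : E = v.2.2.1 <;>
      simp [h1, h2, h3]

theorem splitBitExp_reads (m : ℕ) : (splitBitExp m).Reads 30 := by
  simp [splitBitExp, AExp.Reads]

theorem blockExp_reads (k : ℕ) : (blockExp k).Reads 30 := by
  simp [blockExp, AExp.Reads]

/-- Writes one bit of the instance of the query to the current stripe. -/
def writeBit (k m : ℕ) : Cmd :=
  .assign 28 (.get 16 (blockExp k)) ;;
  .set 41 (.var 17 *ₑ .var 7 +ₑ .var 8) (splitBitExp m)

/-- Writes the parameters of the instance of the query to the current stripe. -/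
def writeParams : Cmd :=
  .set 40 (.var 8) (.get 0 (.lit 0)) ;; .set 40 (.var 7 +ₑ .var 8) (.get 0 (.lit 1)) ;;
  .set 40 (.lit 2 *ₑ .var 7 +ₑ .var 8) (.get 0 (.lit 2))

/-- Writes the instance of the query to the current stripe. -/
def writeInst (k m : ℕ) : Cmd := writeParams ;; .for 17 (.var 9) (writeBit k m)

/-- A bound for the cost of `writeInst`. -/
def writeInstCost (k m N q : ℕ) : ℕ :=
  writeParams.lineWeight * q + (N + 1) * ((writeBit k m).lineWeight * q +
    Cmd.forWeight 17 (.var 9) * q)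

theorem stripe_addr_inj {K c x x' : ℕ} (hc : c < K) : x * K + c = x' * K + c ↔ x = x' := by
  constructor
  · intro h
    exact Nat.eq_of_mul_eq_mul_right (Nat.zero_lt_of_lt hc) (by omega)
  · rintro rfl; rfl

/-- The stripes from `c` on are blank. -/
def BlankFrom (K c : ℕ) (s : Store) : Prop := ∀ a x, simBase ≤ a → c ≤ x % K → s a x = 0

theorem writeParams_det (hz : Sizes k n g b m sz q) {q' K c : ℕ} (hqq : q ≤ q')
    (hs : Bdd 30 q s) (hs' : Bdd 43 q' s) (he : Env k n g b m sz y s) (h7 : s 7 0 = K)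
    (h8 : s 8 0 = c) (hc : c < K) (hblank : BlankFrom K c s) :
    Det writeParams s (writeParams.lineWeight * q) fun s' =>
      Bdd 30 q s' ∧ Bdd 43 q' s' ∧ EqOff {40} s s' ∧ (∀ x, s' 40 (x * K + c) =
        if x = 0 then n else if x = 1 then g else if x = 2 then b else 0) ∧
      ∀ z, z % K ≠ c → s' 40 z = s 40 z := by
  have hq := hz.q_pos
  have hbq : b < 2 ^ q := (hz.b_le.trans_lt hz.levels_lt).trans Nat.lt_two_pow_self
  have hp' : 2 ^ q ≤ 2 ^ q' := Nat.pow_le_pow_right (by norm_num) hqq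
  have hb1 := hs.write_lt (a := 40) (x := 0 * K + c) hz.n_lt
  have hb2 := hb1.write_lt (a := 40) (x := 1 * K + c) hz.g_lt
  have hb3 := hb2.write_lt (a := 40) (x := 2 * K + c) hbq
  rw [writeParams, Cmd.lineWeight, add_mul]
  refine Sim.assign_seq (x := 0 * K + c) (v := n) hq hs ⟨by norm_num, trivial⟩
    ⟨by norm_num, trivial⟩ ?_ he.n_eq ?_
  · simp only [AExp.val, h8, zero_mul, zero_add]
  rw [Cmd.lineWeight, add_mul]
  refine Sim.assign_seq (x := 1 * K + c) (v := g) hq hb1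
    ⟨⟨by norm_num, trivial⟩, by norm_num, trivial⟩ ⟨by norm_num, trivial⟩ ?_ ?_ ?_
  · simp [AExp.val, BinOp.apply, Store.write, h7, h8]
  · simp [AExp.val, Store.write, he.g_eq]
  refine Det.assign_last (x := 2 * K + c) (v := b) hq hb2
    ⟨⟨trivial, by norm_num, trivial⟩, by norm_num, trivial⟩ ⟨by norm_num, trivial⟩ ?_ ?_ ?_
  · simp [AExp.val, BinOp.apply, Store.write, h7, h8]
  · simp [AExp.val, Store.write, he.b_eq]
  refine ⟨hb3, ((hs'.write_lt (hz.n_lt.trans_le hp')).write_lt (hz.g_lt.trans_le hp')).write_lt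
    (hbq.trans_le hp'), (((EqOff.refl _ _).write (by simp) _ _).write (by simp) _ _).write
    (by simp) _ _, ?_, ?_⟩
  · intro x
    simp only [Store.write_apply, stripe_addr_inj hc]
    have h0 : s 40 (x * K + c) = 0 :=
      hblank 40 _ (by norm_num) (by rw [mul_add_mod_of_lt hc])
    rw [h0]
    split_ifs <;> first | rfl | omega
  · intro z hz'
    have : ∀ x, z ≠ x * K + c := by
      rintro x rfl
      exact hz' (mul_add_mod_of_lt hc)
    simp only [Store.write_apply, this, if_false]

theorem writeInst_det (hz : Sizes k n g b m sz q) {q' K c a : ℕ} {v : ℕ → Sample} (hqq : q ≤ q')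
    (hs : Bdd 30 q s) (hs' : Bdd 43 q' s) (he : Env k n g b m sz y s) (h7 : s 7 0 = K)
    (h8 : s 8 0 = c) (hc : c < K) (hblank : BlankFrom K c s)
    (hd : ∀ B < g * k, s 16 B = digit (2 * m * sz) a B)
    (hv : ∀ x < numVars k n g b, HoldsSample s x (v x)) :
    Det (writeInst k m) s (writeInstCost k m (numVars k n g b) q) fun s' =>
      Bdd 30 q s' ∧ Bdd 43 q' s' ∧ EqOff {17, 28, 40, 41} s s' ∧
      InStripe K c (inputStore (queryInst k n g b m (2 * m * sz) y a v)) s' ∧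
      ∀ a z, simBase ≤ a → z % K ≠ c → s' a z = s a z := by
  have hq := hz.q_pos
  have h1 : 1 < 2 ^ q := Nat.one_lt_two_pow (by omega)
  have hp' : 2 ^ q ≤ 2 ^ q' := Nat.pow_le_pow_right (by norm_num) hqq
  set t := 2 * m * sz with ht
  have htpos : 0 < t := by have := hz.m_pos; have := hz.levels_pos; positivity
  set bit : ℕ → Bool := fun x =>
    splitBit m (y x) (v x) (digit t a (x / 2 ^ b % g * k + x / (n * g * 2 ^ b))) with hbit
  refine Det.seq (writeParams_det hz hqq hs hs' he h7 h8 hc hblank) ?_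
  rintro s₁ ⟨hb₁, hb₁', hoff₁, hpar₁, hpar₁'⟩
  have hwork₁ : EqOff workArrays s s₁ := hoff₁.mono (by
    intro a ha; simp [workArrays] at ha ⊢; omega)
  have he₁ := he.of_eqOff hwork₁
  refine (Det.for (A := 30) (e := .var 9) (fun i s' => Bdd 30 q s' ∧ Bdd 43 q' s' ∧
    EqOff {17, 28, 41} s₁ s' ∧ s' 17 0 = i ∧
    (∀ x, s' 41 (x * K + c) = if x < i then (bit x).toNat else 0) ∧
    ∀ z, z % K ≠ c → s' 41 z = s₁ 41 z) hq (by norm_num) ⟨by norm_num, trivial⟩ ?_ ?_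
      hb₁ ?_).mono le_rfl ?_
  · rintro i hi s' ⟨hb, -, hoff, h17, -⟩
    refine ⟨hb, ?_, h17⟩
    have := hoff 9 (by simp)
    simp only [AExp.val]
    rw [this, he₁.vars_eq]
  · rintro i hi s' ⟨hb, hb', hoff, h17, hcell, hcell'⟩
    have hwork : EqOff workArrays s₁ s' := hoff.mono (by
      intro a ha; simp [workArrays] at ha ⊢; omega)
    have he' := he₁.of_eqOff hwork
    obtain ⟨j, i', l, w, hi'⟩ := exists_addr_eq hi
    set B := i / 2 ^ b % g * k + i / (n * g * 2 ^ b) with hB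
    have hBlt : B < g * k := by
      rw [hB, ← hi', addr_div_mod, addr_div]
      exact add_mul_lt l.2 j.2
    have hdig : digit t a B < t := Nat.mod_lt _ htpos
    have hdigq : digit t a B < 2 ^ q := hdig.trans hz.bits_lt
    have h16 : s' 16 B = digit t a B := by
      rw [hoff 16 (by simp), hoff₁ 16 (by simp), hd B hBlt]
    have hhold : HoldsSample s' i (v i) := by
      unfold HoldsSample
      rw [hoff 12 (by simp), hoff₁ 12 (by simp), hoff 13 (by simp), hoff₁ 13 (by simp),
        hoff 14 (by simp), hoff₁ 14 (by simp), hoff 15 (by simp), hoff₁ 15 (by simp)]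
      exact hv i hi
    have h7' : s' 7 0 = K := by rw [hoff 7 (by simp), hoff₁ 7 (by simp), h7]
    have h8' : s' 8 0 = c := by rw [hoff 8 (by simp), hoff₁ 8 (by simp), h8]
    have hbitle : (bit i).toNat ≤ 1 := by cases bit i <;> simp
    have hb2 := hb.write_lt (a := 28) (x := 0) hdigq
    have hb2' := hb'.write_lt (a := 28) (x := 0) (hdigq.trans_le hp')
    rw [writeBit, Cmd.lineWeight, add_mul]
    refine Sim.assign_seq (x := 0) (v := digit t a B) hq hb trivial
      ⟨by norm_num, blockExp_reads k⟩ rfl ?_ ?_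
    · rw [AExp.val, blockExp_val hz he' h17, h16]
    refine Det.assign_last (x := i * K + c) (v := (bit i).toNat) hq hb2
      ⟨⟨⟨by norm_num, trivial⟩, by norm_num, trivial⟩, by norm_num, trivial⟩
      (splitBitExp_reads m) ?_ ?_ ?_
    · simp [AExp.val, BinOp.apply, Store.write, h7', h8', h17]
    · have he2 : Env k n g b m sz y (s'.write 28 0 (digit t a B)) :=
        he'.of_eqOff ((EqOff.refl _ _).write (by simp [workArrays]) _ _)
      refine splitBitExp_val he2 (x := i) ?_ (Store.write_self _ _ _ _) ?_ ?_
      · rw [Store.write_of_ne _ (by norm_num), h17]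
      · exact (Nat.div_lt_of_lt_mul hdig).le
      · unfold HoldsSample at hhold ⊢
        simpa [Store.write] using hhold
    · have hb3 := hb2.write_lt (a := 41) (x := i * K + c) (v := (bit i).toNat) (by omega)
      have hb3' := hb2'.write_lt (a := 41) (x := i * K + c) (v := (bit i).toNat)
        (by omega)
      have hiq : i + 1 < 2 ^ q := lt_of_le_of_lt hi hz.vars_lt
      refine ⟨hb3, by simp [Store.write, h17], hb3.write_lt hiq, hb3'.write_lt (hiq.trans_le hp'),
        ((hoff.write (by simp) _ _).write (by simp) _ _).write (by simp) _ _,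
        Store.write_self _ _ _ _, ?_, ?_⟩
      · intro x
        rw [Store.write_of_ne _ (by norm_num)]
        simp only [Store.write_apply, stripe_addr_inj hc]
        rw [Store.write_of_ne _ (by norm_num), hcell]
        by_cases hx : x = i
        · subst hx; simp
        · rw [if_neg hx]
          exact if_congr (by omega) rfl rfl
      · intro z hz'
        have : z ≠ i * K + c := by
          rintro rfl
          exact hz' (mul_add_mod_of_lt hc)
        rw [Store.write_of_ne _ (by norm_num), Store.write_apply, if_neg this,
          Store.write_of_ne _ (by norm_num), hcell' z hz']
  · refine ⟨hb₁.write_lt (by omega), hb₁'.write_lt (by omega), (EqOff.refl _ _).write (by simp) _ _,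
      Store.write_self _ _ _ _, ?_, ?_⟩
    · intro x
      rw [Store.write_of_ne _ (by norm_num), hoff₁ 41 (by simp),
        hblank 41 _ (by norm_num) (by rw [mul_add_mod_of_lt hc])]
      simp
    · intro z _
      rw [Store.write_of_ne _ (by norm_num)]
  · rintro s' ⟨hb, hb', hoff, -, hcell, hcell'⟩
    have e40 : s' 40 = s₁ 40 := hoff 40 (by simp)
    refine ⟨hb, hb', ?_, ⟨hc, ?_, ?_, ?_⟩, ?_⟩
    · refine (hoff₁.mono ?_).trans (hoff.mono ?_)
      · intro a ha; simp at ha ⊢; tauto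
      · intro a ha; simp at ha ⊢; tauto
    · rw [hoff 7 (by simp), hoff₁ 7 (by simp), h7]
    · rw [hoff 8 (by simp), hoff₁ 8 (by simp), h8]
    · intro a' x
      rcases Nat.lt_or_ge a' 2 with h | h
      · interval_cases a'
        · rw [e40, hpar₁ x, inputStore, if_pos rfl]
        · rw [inputStore_one, hcell]
          by_cases hx : x < numVars k n g b
          · rw [if_pos hx, queryInst, instBits_bitsInst _ hx]
          · rw [if_neg hx, instBits_of_le _ (by omega)]
            rfl
      · rw [inputStore, if_neg (by omega), if_neg (by omega),
          hoff _ (by simp only [simBase, Set.mem_insert_iff, Set.mem_singleton_iff]; omega),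
          hoff₁ _ (by simp only [simBase, Set.mem_singleton_iff]; omega)]
        exact hblank _ _ (Nat.le_add_right _ _) (by rw [mul_add_mod_of_lt hc])
    · intro a' z ha' hz'
      by_cases h40 : a' = 40
      · subst h40
        rw [e40, hpar₁' z hz']
      by_cases h41 : a' = 41
      · subst h41
        rw [hcell' z hz', hoff₁ 41 (by simp)]
      · have : simBase ≤ a' := ha'
        rw [hoff a' (by simp only [simBase, Set.mem_insert_iff, Set.mem_singleton_iff] at *; omega),
          hoff₁ a' (by simpa using h40)]

end Query

section QueryLoop

variable {k n g b m sz q q' Tn : ℕ} {y : ℕ → Bool} {s : Store}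

/-- A run of the oracle in a stripe that holds its input. -/
theorem stripe_sim {K c : ℕ} {P : Cmd} {D : PMF (Store × ℕ)} {s₀ : Store} (h : Runs P s₀ D)
    (hT : ∀ r ∈ D.support, r.2 ≤ Tn) (hin : InStripe K c s₀ s) (h0 : s₀ 2 0 = 0)
    (hb : Bdd 43 q' s) (hq : stripeFactor K * Tn ≤ q') :
    Sim P.stripe s (stripeFactor K * Tn) (D.map fun r => r.1 2 0) fun s' o =>
      EqOffStripe K c s s' ∧ s' 42 c = o ∧ o < 2 ^ (stripeFactor K * Tn) ∧ Bdd 43 q' s' := by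
  have h1 := SimC.mono (h.stripe s hin).size_le (R' := fun s' t r => t ≤ stripeFactor K * Tn ∧
    InStripe K c r.1 s' ∧ EqOffStripe K c s s' ∧
      ∀ a x, (s' a x).size ≤ max (s a x).size (stripeFactor K * Tn)) (by
    rintro s' t r hr ⟨⟨h1, h2, h3⟩, h4⟩
    have h5 : t ≤ stripeFactor K * Tn := h1.trans (Nat.mul_le_mul_left _ (hT r hr))
    exact ⟨h5, h2, h3, fun a x => (h4 a x).trans (max_le_max le_rfl h5)⟩)
  refine SimC.map h1 _ ?_
  rintro s' t r ⟨h1, h2, h3, h4⟩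
  have e1 : s' 42 c = r.1 2 0 := by simpa [simBase] using h2.cell 2 0
  have e2 : s 42 c = 0 := by simpa [simBase, h0] using hin.cell 2 0
  refine ⟨h1, h3, e1, ?_, fun a ha x => (h4 a x).trans (max_le (hb a ha x) hq)⟩
  rw [← Nat.size_le, ← e1]
  simpa [e2] using h4 42 c

/-- Adds the answer of the oracle to one of the two sums. -/
def collect : Cmd :=
  .ite (.var 26 %ₑ .lit 2) (.assign 31 (.var 31 +ₑ .var 25 *ₑ .get 42 (.var 8)))
    (.assign 30 (.var 30 +ₑ .var 25 *ₑ .get 42 (.var 8)))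

/-- Asks the query whose number is in variable `18`. -/
def queryBody (k m : ℕ) (P : Cmd) : Cmd :=
  digitsCmd m ;; writeInst k m ;; P.stripe ;; collect ;; .assign 8 (.var 8 +ₑ .lit 1)

/-- A bound for the cost of `queryBody`, if the answer is obtained at cost `Tc`. -/
def queryBodyCost (k m d N q q' Tc : ℕ) : ℕ :=
  digitsCost m d q + (writeInstCost k m N q + (Tc + (collect.lineWeight * q' +
    (Cmd.assign 8 (.var 8 +ₑ .lit 1)).lineWeight * q)))

/-- The arrays that are modified by the queries. -/
def queryArrays : Set ℕ :=
  {a | a = 8 ∨ (16 ≤ a ∧ a ≤ 19) ∨ (24 ≤ a ∧ a ≤ 26) ∨ a = 28 ∨ a = 30 ∨ a = 31 ∨ simBase ≤ a}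

theorem queryArrays_subset : queryArrays ⊆ workArrays := by
  intro a ha
  simp only [queryArrays, workArrays, simBase, Set.mem_ofPred_eq] at ha ⊢
  omega

/-- The memory after `i` queries, when it was `s` before the first query, `c₀` is the number of
the first stripe used, and `P` are the two sums of the answers. -/
structure AfterQueries (q q' Tc K c₀ : ℕ) (s : Store) (i : ℕ) (s' : Store) (P : ℕ × ℕ) : Prop where
  small : Bdd 30 q s'
  big : Bdd 43 q' s'
  off : EqOff queryArrays s s'
  current : s' 8 0 = c₀ + i
  blank : BlankFrom K (c₀ + i) s'
  pos : s' 30 0 = P.1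
  neg : s' 31 0 = P.2
  pos_le : P.1 ≤ i * 2 ^ (q + Tc)
  neg_le : P.2 ≤ i * 2 ^ (q + Tc)

theorem AfterQueries.write {Tc K c₀ i x : ℕ} {s s' : Store} {P : ℕ × ℕ}
    (h : AfterQueries q q' Tc K c₀ s i s' P) (hq : q ≤ q') (hx : x < 2 ^ q) :
    AfterQueries q q' Tc K c₀ s i (s'.write 18 0 x) P where
  small := h.small.write_lt hx
  big := h.big.write_lt (hx.trans_le (Nat.pow_le_pow_right (by norm_num) hq))
  off := h.off.write (by simp [queryArrays]) _ _
  current := by rw [Store.write_of_ne _ (by norm_num), h.current]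
  blank a x ha hx := by
    rw [Store.write_of_ne _ (by unfold simBase at ha; omega)]
    exact h.blank a x ha hx
  pos := by rw [Store.write_of_ne _ (by norm_num), h.pos]
  neg := by rw [Store.write_of_ne _ (by norm_num), h.neg]
  pos_le := h.pos_le
  neg_le := h.neg_le

/-- Low arrays keep the bound `q'` if they satisfy the stronger bound `q`. -/
theorem Bdd.of_eqOff {s s' : Store} (h : Bdd 43 q' s) (hs : Bdd 30 q s') (hq : q ≤ q')
    (hoff : EqOff {a | a < 30} s s') : Bdd 43 q' s' := by
  intro a ha x
  by_cases h30 : a < 30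
  · exact (hs a h30 x).trans hq
  · rw [hoff a h30]
    exact h a ha x

theorem queryBody_sim (hz : Sizes k n g b m sz q) {K c₀ : ℕ} {P : Cmd}
    {D : Inst k n g b → PMF (Store × ℕ)}
    (hrun : ∀ I, Runs P (inputStore I) (D I) ∧ ∀ r ∈ (D I).support, r.2 ≤ Tn)
    (hq' : 2 * q + stripeFactor K * Tn ≤ q') (hK : K < 2 ^ q)
    (he : Env k n g b m sz y s) (h7 : s 7 0 = K) {v : ℕ → Sample}
    (hv : ∀ x < numVars k n g b, HoldsSample s x (v x))
    (hc : c₀ + (2 * m * sz) ^ (g * k) ≤ K) {i : ℕ} (hi : i < (2 * m * sz) ^ (g * k)) {s' : Store}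
    {Q : ℕ × ℕ} (h : AfterQueries q q' (stripeFactor K * Tn) K c₀ s i s' Q) (h18 : s' 18 0 = i) :
    Sim (queryBody k m P) s'
      (queryBodyCost k m (g * k) (numVars k n g b) q q' (stripeFactor K * Tn))
      (((D (queryInst k n g b m (2 * m * sz) y i v)).map fun r => r.1 2 0).map fun o =>
        addAnswer m (2 * m * sz) (g * k) i o Q)
      fun s'' Q' => AfterQueries q q' (stripeFactor K * Tn) K c₀ s (i + 1) s'' Q' ∧
        s'' 18 0 = i := by
  have hq := hz.q_pos
  set t := 2 * m * sz with ht
  set Tc := stripeFactor K * Tn with hTc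
  have htpos : 0 < t := by have := hz.m_pos; have := hz.levels_pos; positivity
  have hqq : q ≤ q' := by omega
  have hp' : 2 ^ q ≤ 2 ^ q' := Nat.pow_le_pow_right (by norm_num) hqq
  have he' : Env k n g b m sz y s' := he.of_eqOff (h.off.mono queryArrays_subset)
  have hcK : c₀ + i < K := by omega
  have hcoeff : queryCoeff m t (g * k) i < 2 ^ q := (queryCoeff_le ht htpos).trans_lt hz.coeff_lt
  refine Det.seq_sim (digitsCmd_det hz he' h.small h18) ?_
  rintro s₁ ⟨hb₁, hoff₁, hd₁⟩
  have hbig₁ : Bdd 43 q' s₁ := h.big.of_eqOff hb₁ hqq (hoff₁.mono (by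
    intro a ha; simp at ha ⊢; omega))
  have hQ₁ : EqOff queryArrays s s₁ := h.off.trans (hoff₁.mono (by
    intro a ha; simp [queryArrays] at ha ⊢; omega))
  have he₁ : Env k n g b m sz y s₁ := he.of_eqOff (hQ₁.mono queryArrays_subset)
  have h7₁ : s₁ 7 0 = K := by rw [hQ₁ 7 (by simp [queryArrays, simBase]), h7]
  have h8₁ : s₁ 8 0 = c₀ + i := by rw [hoff₁ 8 (by simp), h.current]
  have hblank₁ : BlankFrom K (c₀ + i) s₁ := fun a x ha hx => by
    rw [hoff₁ a (by simp only [simBase, Set.mem_insert_iff, Set.mem_singleton_iff] at ha ⊢; omega)]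
    exact h.blank a x ha hx
  have hv₁ : ∀ x < numVars k n g b, HoldsSample s₁ x (v x) := by
    intro x hx
    unfold HoldsSample
    rw [hQ₁ 12 (by simp [queryArrays, simBase]), hQ₁ 13 (by simp [queryArrays, simBase]),
      hQ₁ 14 (by simp [queryArrays, simBase]), hQ₁ 15 (by simp [queryArrays, simBase])]
    exact hv x hx
  refine Det.seq_sim (writeInst_det hz hqq hb₁ hbig₁ he₁ h7₁ h8₁ hcK hblank₁ hd₁.digit hv₁) ?_
  rintro s₂ ⟨hb₂, hbig₂, hoff₂, hin₂, hcell₂⟩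
  obtain ⟨hr, hT⟩ := hrun (queryInst k n g b m t y i v)
  refine Sim.seq_map (stripe_sim hr hT hin₂ (by simp [inputStore]) hbig₂ (by omega)) ?_
  rintro s₃ o ⟨hoff₃, h42, ho, hbig₃⟩
  have hlow : ∀ a < simBase, a ≠ 17 → a ≠ 28 → s₃ a = s₁ a := by
    intro a ha h17 h28
    rw [hoff₃.low a ha, hoff₂ a (by
      unfold simBase at ha
      simp only [Set.mem_insert_iff, Set.mem_singleton_iff]; omega)]
  have hb₃ : Bdd 30 q s₃ := fun a ha x => by
    rw [hoff₃.low a (by unfold simBase; omega)]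
    exact hb₂ a ha x
  have hQ₃ : EqOff queryArrays s s₃ := by
    intro a ha
    have ha' : a < simBase ∧ a ≠ 17 ∧ a ≠ 28 := by
      simp only [queryArrays, Set.mem_ofPred_eq] at ha
      omega
    rw [hlow a ha'.1 ha'.2.1 ha'.2.2, hQ₁ a ha]
  have h25 : s₃ 25 0 = queryCoeff m t (g * k) i := by
    rw [hlow 25 (by norm_num) (by norm_num) (by norm_num), hd₁.coeff]
  have h26 : s₃ 26 0 = querySign t (g * k) i := by
    rw [hlow 26 (by norm_num) (by norm_num) (by norm_num), hd₁.sign]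
  have h8 : s₃ 8 0 = c₀ + i := by
    rw [hlow 8 (by norm_num) (by norm_num) (by norm_num), h8₁]
  have h18' : s₃ 18 0 = i := by
    rw [hlow 18 (by norm_num) (by norm_num) (by norm_num), hoff₁ 18 (by simp), h18]
  have h30 : s₃ 30 0 = Q.1 := by
    rw [hlow 30 (by norm_num) (by norm_num) (by norm_num), hoff₁ 30 (by simp), h.pos]
  have h31 : s₃ 31 0 = Q.2 := by
    rw [hlow 31 (by norm_num) (by norm_num) (by norm_num), hoff₁ 31 (by simp), h.neg]
  have hblank₃ : BlankFrom K (c₀ + i + 1) s₃ := fun a x ha hx => by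
    rw [hoff₃.high a x (by omega), hcell₂ a x ha (by omega)]
    exact hblank₁ a x ha (by omega)
  -- Each answer adds less than `2 ^ (q + Tc)` to the sums.
  have hadd : queryCoeff m t (g * k) i * o ≤ 2 ^ (q + Tc) := by
    rw [pow_add]
    exact Nat.mul_le_mul hcoeff.le ho.le
  have hsum : (i + 1) * 2 ^ (q + Tc) < 2 ^ q' := by
    calc (i + 1) * 2 ^ (q + Tc) < 2 ^ q * 2 ^ (q + Tc) :=
          Nat.mul_lt_mul_of_pos_right (lt_of_le_of_lt hi hz.queries_lt) (Nat.two_pow_pos _)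
      _ = 2 ^ (2 * q + Tc) := by rw [← pow_add]; congr 1; omega
      _ ≤ 2 ^ q' := Nat.pow_le_pow_right (by norm_num) hq'
  have hmul : (i + 1) * 2 ^ (q + Tc) = i * 2 ^ (q + Tc) + 2 ^ (q + Tc) := by ring
  have h1' := h.pos_le
  have h2' := h.neg_le
  have hcq : c₀ + i + 1 < 2 ^ q := lt_of_le_of_lt hcK hK
  -- Moving on to the next stripe restores the invariant, whichever sum has been updated.
  have hlast : ∀ s₄ Q', Bdd 30 q s₄ → Bdd 43 q' s₄ → EqOff {30, 31} s₃ s₄ → s₄ 30 0 = Q'.1 →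
      s₄ 31 0 = Q'.2 → Q'.1 ≤ (i + 1) * 2 ^ (q + Tc) → Q'.2 ≤ (i + 1) * 2 ^ (q + Tc) →
      Det (.assign 8 (.var 8 +ₑ .lit 1)) s₄ ((Cmd.assign 8 (.var 8 +ₑ .lit 1)).lineWeight * q)
        fun s'' => AfterQueries q q' Tc K c₀ s (i + 1) s'' Q' ∧ s'' 18 0 = i := by
    intro s₄ Q' hb₄ hbig₄ hoff₄ e30 e31 hle1 hle2
    have hQ₄ : EqOff queryArrays s s₄ := hQ₃.trans (hoff₄.mono (by
      intro a ha; simp [queryArrays] at ha ⊢; omega))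
    refine Det.assign_last (x := 0) (v := c₀ + i + 1) hq hb₄ trivial ⟨⟨by norm_num, trivial⟩,
        trivial⟩
      rfl ?_ ⟨⟨hb₄.write_lt hcq, hbig₄.write_lt (hcq.trans_le hp'),
        hQ₄.write (by simp [queryArrays]) _ _, Store.write_self _ _ _ _, ?_, ?_, ?_, hle1, hle2⟩,
            ?_⟩
    · simp only [AExp.val, BinOp.apply]
      rw [hoff₄ 8 (by simp), h8]
    · intro a x ha hx
      unfold simBase at ha
      rw [Store.write_of_ne _ (by omega), hoff₄ a (by
        simp only [Set.mem_insert_iff, Set.mem_singleton_iff]; omega)]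
      exact hblank₃ a x ha hx
    · rw [Store.write_of_ne _ (by norm_num), e30]
    · rw [Store.write_of_ne _ (by norm_num), e31]
    · rw [Store.write_of_ne _ (by norm_num), hoff₄ 18 (by simp), h18']
  have hval : s₃ 25 0 * s₃ 42 (s₃ 8 0) = queryCoeff m t (g * k) i * o := by
    rw [h25, h8, h42]
  refine Det.seq (Sim.ite_line (e := .var 26 %ₑ .lit 2) (hq.trans hqq) hbig₃ ⟨⟨by norm_num,
      trivial⟩, trivial⟩
    (R := fun s₄ (_ : Unit) => Bdd 30 q s₄ ∧ Bdd 43 q' s₄ ∧ EqOff {30, 31} s₃ s₄ ∧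
      s₄ 30 0 = (addAnswer m t (g * k) i o Q).1 ∧ s₄ 31 0 = (addAnswer m t (g * k) i o Q).2)
    (fun hs => ?_) fun hs => ?_) ?_
  · replace hs : querySign t (g * k) i % 2 ≠ 0 := by
      simpa only [AExp.val, BinOp.apply, h26] using hs
    rw [addAnswer, if_neg hs]
    refine Det.assign_last (x := 0) (v := Q.2 + queryCoeff m t (g * k) i * o) (hq.trans hqq) hbig₃
      trivial ⟨⟨by norm_num, trivial⟩, ⟨by norm_num, trivial⟩, by norm_num, by norm_num,
          trivial⟩ rfl
      ?_ ⟨hb₃.write_of_le (by norm_num), hbig₃.write_lt (by omega),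
        (EqOff.refl _ _).write (by simp) _ _, ?_, Store.write_self _ _ _ _⟩
    · simp only [AExp.val, BinOp.apply, h31, hval]
    · rw [Store.write_of_ne _ (by norm_num), h30]
  · replace hs : querySign t (g * k) i % 2 = 0 := by
      simpa only [AExp.val, BinOp.apply, h26] using hs
    rw [addAnswer, if_pos hs]
    refine Det.assign_last (x := 0) (v := Q.1 + queryCoeff m t (g * k) i * o) (hq.trans hqq) hbig₃
      trivial ⟨⟨by norm_num, trivial⟩, ⟨by norm_num, trivial⟩, by norm_num, by norm_num,
          trivial⟩ rfl
      ?_ ⟨hb₃.write_of_le (by norm_num), hbig₃.write_lt (by omega),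
        (EqOff.refl _ _).write (by simp) _ _, Store.write_self _ _ _ _, ?_⟩
    · simp only [AExp.val, BinOp.apply, h30, hval]
    · rw [Store.write_of_ne _ (by norm_num), h31]
  · rintro s₄ ⟨hb₄, hbig₄, hoff₄, e30, e31⟩
    refine hlast s₄ _ hb₄ hbig₄ hoff₄ e30 e31 ?_ ?_ <;> unfold addAnswer <;> split_ifs <;> omega

/-- Asks all queries. -/
def queryLoop (k m : ℕ) (P : Cmd) : Cmd := .for 18 (.var 6) (queryBody k m P)

theorem queryLoop_sim (hz : Sizes k n g b m sz q) {K c₀ : ℕ} {P : Cmd}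
    {D : Inst k n g b → PMF (Store × ℕ)}
    (hrun : ∀ I, Runs P (inputStore I) (D I) ∧ ∀ r ∈ (D I).support, r.2 ≤ Tn)
    (hq' : 2 * q + stripeFactor K * Tn ≤ q') (hK : K < 2 ^ q)
    (he : Env k n g b m sz y s) (h7 : s 7 0 = K) {v : ℕ → Sample}
    (hv : ∀ x < numVars k n g b, HoldsSample s x (v x))
    (hc : c₀ + (2 * m * sz) ^ (g * k) ≤ K)
    (h : AfterQueries q q' (stripeFactor K * Tn) K c₀ s 0 s (0, 0)) :
    Sim (queryLoop k m P) s (((2 * m * sz) ^ (g * k) + 1) *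
      (queryBodyCost k m (g * k) (numVars k n g b) q q' (stripeFactor K * Tn) +
        Cmd.forWeight 18 (.var 6) * q))
      (queries m (2 * m * sz) (fun I => (D I).map fun r => r.1 2 0) y v)
      (AfterQueries q q' (stripeFactor K * Tn) K c₀ s ((2 * m * sz) ^ (g * k))) := by
  have hqq : q ≤ q' := by omega
  refine (Sim.for (A := 30) (e := .var 6) (fun i s' Q =>
    AfterQueries q q' (stripeFactor K * Tn) K c₀ s i s' Q ∧ s' 18 0 = i) hz.q_pos (by norm_num)
    ⟨by norm_num, trivial⟩ ?_ ?_ h.small ⟨h.write hqq (Nat.two_pow_pos _),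
      Store.write_self _ _ _ _⟩).mono le_rfl fun _ _ h => h.1
  · rintro i hi s' Q ⟨h', h18⟩
    refine ⟨h'.small, ?_, h18⟩
    simp only [AExp.val]
    rw [h'.off 6 (by simp [queryArrays, simBase]), he.queries_eq]
  · rintro i hi s' Q ⟨h', h18⟩
    refine (queryBody_sim hz hrun hq' hK he h7 hv hc hi h' h18).mono le_rfl ?_
    rintro s'' Q' ⟨h'', h18'⟩
    exact ⟨h''.small, h18', h''.write hqq (lt_of_le_of_lt hi hz.queries_lt),
      Store.write_self _ _ _ _⟩

end QueryLoop

/-! ### The program: trials and votes -/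

section Trials

variable {k n g b m sz q q' Tn w : ℕ} {y : ℕ → Bool} {s : Store} {μ : unitInterval}
  {coinCmd P : Cmd}

/-- One trial, with the result in variable `33`. -/
def trialCmd (coinCmd : Cmd) (k m : ℕ) (P : Cmd) : Cmd :=
  sampleAll coinCmd m ;; .assign 30 (.lit 0) ;; .assign 31 (.lit 0) ;; queryLoop k m P ;;
    .assign 33 (.var 30 -ₑ .var 31)

/-- A bound for the cost of `trialCmd`, if `N` is the number of input bits, `t` the number of split
bits for each of them, and each answer is obtained at cost `Tc`. -/
def trialCost (w k m d N t q q' Tc : ℕ) : ℕ :=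
  (N + 1) * (sampleBodyCost w m t q + Cmd.forWeight 17 (.var 9) * q) +
    ((Cmd.assign 30 (.lit 0)).lineWeight * q + ((Cmd.assign 31 (.lit 0)).lineWeight * q +
      ((t ^ d + 1) * (queryBodyCost k m d N q q' Tc + Cmd.forWeight 18 (.var 6) * q) +
        (Cmd.assign 33 (.var 30 -ₑ .var 31)).lineWeight * q')))

/-- The arrays that are modified by a trial. -/
def trialArrays : Set ℕ :=
  {a | a = 8 ∨ (12 ≤ a ∧ a ≤ 19) ∨ (21 ≤ a ∧ a ≤ 26) ∨ a = 28 ∨ a = 30 ∨ a = 31 ∨ a = 33 ∨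
    simBase ≤ a}

theorem trialCmd_sim (hcoin : IsCoin μ coinCmd w) (hz : Sizes k n g b m sz q) {K c₀ : ℕ}
    {D : Inst k n g b → PMF (Store × ℕ)}
    (hrun : ∀ I, Runs P (inputStore I) (D I) ∧ ∀ r ∈ (D I).support, r.2 ≤ Tn)
    (hq' : 2 * q + stripeFactor K * Tn ≤ q') (hK : K < 2 ^ q)
    (hs : Bdd 30 q s) (hs' : Bdd 43 q' s) (he : Env k n g b m sz y s) (h7 : s 7 0 = K)
    (h8 : s 8 0 = c₀) (hblank : BlankFrom K c₀ s) (hc : c₀ + (2 * m * sz) ^ (g * k) ≤ K) :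
    Sim (trialCmd coinCmd k m P) s
      (trialCost w k m (g * k) (numVars k n g b) (2 * m * sz) q q' (stripeFactor K * Tn))
      (trial μ m sz (fun I => (D I).map fun r => r.1 2 0) y) fun s' v =>
        Bdd 30 q s' ∧ Bdd 43 q' s' ∧ EqOff trialArrays s s' ∧
        s' 8 0 = c₀ + (2 * m * sz) ^ (g * k) ∧ BlankFrom K (c₀ + (2 * m * sz) ^ (g * k)) s' ∧
        s' 33 0 = v := by
  have hq := hz.q_pos
  have hqq : q ≤ q' := by omega
  set t := 2 * m * sz with ht
  set Tc := stripeFactor K * Tn with hTc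
  refine Sim.seq (sampleAll_sim hcoin hq hz.bits_lt hz.levels_lt hz.m_lt hz.vars_lt hs he.levels_eq
    (he.pow_eq _ le_rfl) he.bits_eq he.vars_eq) ?_
  rintro s₁ v ⟨hb₁, hoff₁, hv₁⟩
  have hbig₁ : Bdd 43 q' s₁ := hs'.of_eqOff hb₁ hqq (hoff₁.mono (by
    intro a ha; simp at ha ⊢; omega))
  refine Sim.assign_seq (x := 0) (v := 0) hq hb₁ trivial trivial rfl rfl ?_
  refine Sim.assign_seq (x := 0) (v := 0) hq (hb₁.write_of_le (by norm_num)) trivial trivial rfl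
    rfl ?_
  set s₂ := (s₁.write 30 0 0).write 31 0 0 with hs₂
  have hoff₂ : EqOff trialArrays s s₂ := ((hoff₁.mono (by
    intro a ha; simp [trialArrays] at ha ⊢; omega)).write (by simp [trialArrays]) _ _).write
    (by simp [trialArrays]) _ _
  have hwork : trialArrays ⊆ workArrays := by
    intro a ha
    simp only [trialArrays, workArrays, simBase, Set.mem_ofPred_eq] at ha ⊢
    omega
  have hlow : ∀ a, a ≠ 30 → a ≠ 31 → s₂ a = s₁ a := fun a h h' => by
    rw [hs₂, Store.write_of_ne _ h', Store.write_of_ne _ h]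
  have h8₂ : s₂ 8 0 = c₀ := by
    rw [hlow 8 (by norm_num) (by norm_num), hoff₁ 8 (by simp), h8]
  have h7₂ : s₂ 7 0 = K := by
    rw [hlow 7 (by norm_num) (by norm_num), hoff₁ 7 (by simp), h7]
  have hblank₂ : BlankFrom K c₀ s₂ := fun a x ha hx => by
    have ha' := ha
    unfold simBase at ha'
    rw [hlow a (by omega) (by omega), hoff₁ a (by
      simp only [Set.mem_insert_iff, Set.mem_singleton_iff]; omega)]
    exact hblank a x ha hx
  have hb₂ : Bdd 30 q s₂ := (hb₁.write_of_le (by norm_num)).write_of_le (by norm_num)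
  have hbig₂ : Bdd 43 q' s₂ := (hbig₁.write (by simp)).write (by simp)
  have hv₂ : ∀ x < numVars k n g b, HoldsSample s₂ x (v x) := by
    intro x hx
    unfold HoldsSample
    rw [hlow 12 (by norm_num) (by norm_num), hlow 13 (by norm_num) (by norm_num),
      hlow 14 (by norm_num) (by norm_num), hlow 15 (by norm_num) (by norm_num)]
    exact hv₁ x hx
  refine Sim.seq_map (queryLoop_sim hz hrun hq' hK (he.of_eqOff (hoff₂.mono hwork)) h7₂ hv₂ hc
    ⟨hb₂, hbig₂, EqOff.refl _ _, h8₂, hblank₂, ?_, Store.write_self _ _ _ _, by simp, by simp⟩) ?_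
  · rw [hs₂, Store.write_of_ne _ (by norm_num), Store.write_self]
  rintro s₃ Q h₃
  refine Det.assign_last (x := 0) (v := Q.1 - Q.2) (hq.trans hqq) h₃.big trivial
    ⟨⟨by norm_num, trivial⟩, by norm_num, trivial⟩ rfl ?_
    ⟨h₃.small.write_of_le (by norm_num), h₃.big.write ?_, (hoff₂.trans (h₃.off.mono ?_)).write
      (by simp [trialArrays]) _ _, ?_, ?_, Store.write_self _ _ _ _⟩
  · simp only [AExp.val, BinOp.apply, h₃.pos, h₃.neg]
  · refine (Nat.size_le_size (Nat.sub_le _ _)).trans ?_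
    rw [← h₃.pos]
    exact h₃.big 30 (by norm_num) 0
  · intro a ha
    simp only [trialArrays, queryArrays, Set.mem_ofPred_eq] at ha ⊢
    omega
  · rw [Store.write_of_ne _ (by norm_num), h₃.current]
  · intro a x ha hx
    rw [Store.write_of_ne _ (by unfold simBase at ha; omega)]
    exact h₃.blank a x ha hx

/-- One step of the vote, with the candidate in variable `32` and the counter in variable `27`. -/
def voteCmd : Cmd :=
  .ite (.var 27) (.ite (.var 33 =ₑ .var 32) (.assign 27 (.var 27 +ₑ .lit 1))
    (.assign 27 (.var 27 -ₑ .lit 1))) (.assign 32 (.var 33) ;; .assign 27 (.lit 1))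

theorem voteCmd_det (hq : 1 ≤ q) (hqq : q ≤ q') (hs : Bdd 30 q s) (hs' : Bdd 43 q' s) {v : ℕ}
    {Q : ℕ × ℕ} (h33 : s 33 0 = v) (h32 : s 32 0 = Q.1) (h27 : s 27 0 = Q.2)
    (hQ : Q.2 + 1 < 2 ^ q) :
    Det voteCmd s (voteCmd.lineWeight * q') fun s' => Bdd 30 q s' ∧ Bdd 43 q' s' ∧
      EqOff {27, 32} s s' ∧ s' 32 0 = (voteStep v Q).1 ∧ s' 27 0 = (voteStep v Q).2 := by
  have hp' : 2 ^ q ≤ 2 ^ q' := Nat.pow_le_pow_right (by norm_num) hqq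
  refine Sim.ite_line (e := .var 27) (hq.trans hqq) hs' ⟨by norm_num, trivial⟩
    (fun h => ?_) fun h => ?_
  · replace h : Q.2 ≠ 0 := by simpa only [AExp.val, h27] using h
    refine Sim.ite_line (e := .var 33 =ₑ .var 32) (hq.trans hqq) hs'
      ⟨⟨by norm_num, trivial⟩, by norm_num, trivial⟩ (fun h' => ?_) fun h' => ?_
    · replace h' : v = Q.1 := by
        simpa only [AExp.val, BinOp.apply, h33, h32, ne_eq, ite_eq_right_iff, one_ne_zero,
          imp_false, not_not] using h'
      refine Det.assign_last (x := 0) (v := Q.2 + 1) (hq.trans hqq) hs' trivial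
        ⟨⟨by norm_num, trivial⟩, trivial⟩ rfl ?_ ⟨hs.write_lt hQ, hs'.write_lt (by omega),
        (EqOff.refl _ _).write (by simp) _ _, ?_, ?_⟩
      · simp only [AExp.val, BinOp.apply, h27]
      · rw [Store.write_of_ne _ (by norm_num), h32, voteStep, if_neg h, if_pos h']
      · rw [Store.write_self, voteStep, if_neg h, if_pos h']
    · replace h' : v ≠ Q.1 := by
        simpa only [AExp.val, BinOp.apply, h33, h32, ite_eq_right_iff, one_ne_zero,
          imp_false] using h'
      refine Det.assign_last (x := 0) (v := Q.2 - 1) (hq.trans hqq) hs' trivial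
        ⟨⟨by norm_num, trivial⟩, trivial⟩ rfl ?_ ⟨hs.write_lt (by omega), hs'.write_lt (by omega),
        (EqOff.refl _ _).write (by simp) _ _, ?_, ?_⟩
      · simp only [AExp.val, BinOp.apply, h27]
      · rw [Store.write_of_ne _ (by norm_num), h32, voteStep, if_neg h, if_neg h']
      · rw [Store.write_self, voteStep, if_neg h, if_neg h']
  · replace h : Q.2 = 0 := by simpa only [AExp.val, h27] using h
    have hv : v.size ≤ q' := h33 ▸ hs' 33 (by norm_num) 0
    rw [Cmd.lineWeight, add_mul]
    refine Sim.assign_seq (x := 0) (v := v) (hq.trans hqq) hs' trivial ⟨by norm_num, trivial⟩ rfl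
      h33 ?_
    refine Det.assign_last (x := 0) (v := 1) (hq.trans hqq) (hs'.write hv) trivial trivial rfl rfl
      ⟨(hs.write_of_le (by norm_num)).write_lt (by omega), (hs'.write hv).write_lt (by omega),
        ((EqOff.refl _ _).write (by simp) _ _).write (by simp) _ _, ?_, ?_⟩
    · rw [Store.write_of_ne _ (by norm_num), Store.write_self, voteStep, if_pos h]
    · rw [Store.write_self, voteStep, if_pos h]

theorem voteStep_snd_le (v : ℕ) (Q : ℕ × ℕ) : (voteStep v Q).2 ≤ Q.2 + 1 := by
  unfold voteStep
  split_ifs <;> simp only <;> omega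

/-- All trials and the vote between their results. -/
def votes (coinCmd : Cmd) (k m : ℕ) (P : Cmd) : Cmd :=
  .for 20 (.var 11) (trialCmd coinCmd k m P ;; voteCmd)

theorem votes_sim (hcoin : IsCoin μ coinCmd w) (hz : Sizes k n g b m sz q) {K : ℕ}
    {D : Inst k n g b → PMF (Store × ℕ)}
    (hrun : ∀ I, Runs P (inputStore I) (D I) ∧ ∀ r ∈ (D I).support, r.2 ≤ Tn)
    (hKdef : K = sz * sz * (2 * m * sz) ^ (g * k)) (hq' : 2 * q + stripeFactor K * Tn ≤ q')
    (hs : Bdd 30 q s) (hs' : Bdd 43 q' s) (he : Env k n g b m sz y s)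
    (h8 : s 8 0 = 0) (hblank : BlankFrom K 0 s) (h27 : s 27 0 = 0) (h32 : s 32 0 = 0) :
    Sim (votes coinCmd k m P) s ((sz * sz + 1) *
      (trialCost w k m (g * k) (numVars k n g b) (2 * m * sz) q q' (stripeFactor K * Tn) +
        voteCmd.lineWeight * q' + Cmd.forWeight 20 (.var 11) * q))
      (vote (trial μ m sz (fun I => (D I).map fun r => r.1 2 0) y) (sz * sz)) fun s' Q =>
        Bdd 43 q' s' ∧ s' 32 0 = Q.1 := by
  have hq := hz.q_pos
  have hqq : q ≤ q' := by omega
  have hp' : 2 ^ q ≤ 2 ^ q' := Nat.pow_le_pow_right (by norm_num) hqq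
  have hK : K < 2 ^ q := hKdef ▸ hz.stripes_lt
  set A := (2 * m * sz) ^ (g * k) with hA
  refine (Sim.for (A := 30) (e := .var 11) (fun r s' Q => Bdd 30 q s' ∧ Bdd 43 q' s' ∧
    EqOff workArrays s s' ∧ s' 20 0 = r ∧ s' 8 0 = r * A ∧ BlankFrom K (r * A) s' ∧
    s' 32 0 = Q.1 ∧ s' 27 0 = Q.2 ∧ Q.2 ≤ r) hq (by norm_num) ⟨by norm_num, trivial⟩ ?_ ?_ hs
    ?_).mono le_rfl fun s' Q h => ⟨h.2.1, h.2.2.2.2.2.2.1⟩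
  · rintro r hr s' Q ⟨hb, -, hoff, h20, -⟩
    exact ⟨hb, (he.of_eqOff hoff).trials_eq, h20⟩
  · rintro r hr s' Q ⟨hb, hb', hoff, h20, h8', hblank', h32', h27', hQ⟩
    have he' := he.of_eqOff hoff
    have hrA : r * A + A ≤ K := by
      calc r * A + A = (r + 1) * A := by ring
        _ ≤ sz * sz * A := Nat.mul_le_mul_right _ hr
        _ = K := hKdef.symm
    have hQq : Q.2 + 1 < 2 ^ q :=
      lt_of_le_of_lt (Nat.succ_le_of_lt (lt_of_le_of_lt hQ hr)) hz.trials_lt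
    refine Sim.seq_map (trialCmd_sim hcoin hz hrun hq' hK hb hb' he'
      (he'.stripes_eq.trans hKdef.symm) h8' hblank' hrA) ?_
    rintro s₁ v ⟨hb₁, hb₁', hoff₁, h8₁, hblank₁, h33₁⟩
    have g20 : s₁ 20 0 = r := by rw [hoff₁ 20 (by simp [trialArrays, simBase]), h20]
    have g32 : s₁ 32 0 = Q.1 := by rw [hoff₁ 32 (by simp [trialArrays, simBase]), h32']
    have g27 : s₁ 27 0 = Q.2 := by rw [hoff₁ 27 (by simp [trialArrays, simBase]), h27']
    refine (voteCmd_det hq hqq hb₁ hb₁' h33₁ g32 g27 hQq).mono le_rfl ?_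
    rintro s₂ ⟨hb₂, hb₂', hoff₂, h32₂, h27₂⟩
    have hrq : r + 1 < 2 ^ q := lt_of_le_of_lt hr hz.trials_lt
    refine ⟨hb₂, by rw [hoff₂ 20 (by simp), g20], hb₂.write_lt hrq,
      hb₂'.write_lt (hrq.trans_le hp'), ?_, Store.write_self _ _ _ _, ?_, ?_, ?_, ?_, ?_⟩
    · refine ((hoff.trans (hoff₁.mono ?_)).trans (hoff₂.mono ?_)).write (by simp [workArrays]) _ _
      · intro a ha
        simp only [trialArrays, workArrays, simBase, Set.mem_ofPred_eq] at ha ⊢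
        omega
      · intro a ha
        simp [workArrays] at ha ⊢
        omega
    · rw [Store.write_of_ne _ (by norm_num), hoff₂ 8 (by simp), h8₁]
      ring
    · intro a x ha hx
      have ha' := ha
      unfold simBase at ha'
      rw [Store.write_of_ne _ (by omega), hoff₂ a (by
        simp only [Set.mem_insert_iff, Set.mem_singleton_iff]; omega)]
      refine hblank₁ a x ha ?_
      calc r * A + A = (r + 1) * A := by ring
        _ ≤ x % K := hx
    · rw [Store.write_of_ne _ (by norm_num), h32₂]
    · rw [Store.write_of_ne _ (by norm_num), h27₂]
    · exact (voteStep_snd_le v Q).trans (by omega)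
  · refine ⟨hs.write (by simp), hs'.write (by simp),
      (EqOff.refl _ _).write (by simp [workArrays]) _ _,
      Store.write_self _ _ _ _, ?_, ?_, ?_, ?_, le_rfl⟩
    · rw [Store.write_of_ne _ (by norm_num), h8, zero_mul]
    · intro a x ha hx
      rw [Store.write_of_ne _ (by unfold simBase at ha; omega)]
      exact hblank a x ha (Nat.zero_le _)
    · rw [Store.write_of_ne _ (by norm_num), h32]
    · rw [Store.write_of_ne _ (by norm_num), h27]

/-! ### The program: initialization -/

/-- The body of the loop that writes the table of powers of two. -/
def powersStep : Cmd :=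
  .set 4 (.var 3 +ₑ .lit 1) (.get 4 (.var 3) *ₑ .lit 2) ;; .assign 3 (.var 3 +ₑ .lit 1)

/-- The condition of the loop that writes the table of powers of two. -/
def powersGuard : AExp :=
  .get 4 (.var 3) <ₑ .get 0 (.lit 0) *ₑ .get 0 (.lit 0) *ₑ .get 0 (.lit 0) +ₑ .lit 1

/-- Computes the power of variable `5` whose exponent is in variable `10`. -/
def powCmd : Cmd := .assign 6 (.lit 1) ;; .for 19 (.var 10) (.assign 6 (.var 6 *ₑ .var 5))

/-- Computes the numbers of input bits, of split bits, of blocks and of trials. -/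
def paramsCmd (k m : ℕ) : Cmd :=
  .assign 9 (.lit k *ₑ .get 0 (.lit 0) *ₑ .get 0 (.lit 1) *ₑ .get 4 (.get 0 (.lit 2))) ;;
  .assign 5 (.lit (2 * m) *ₑ .var 3) ;;
  .assign 10 (.get 0 (.lit 1) *ₑ .lit k) ;;
  .assign 11 (.var 3 *ₑ .var 3)

/-- Computes all parameters from the input. -/
def initCmd (k m : ℕ) : Cmd :=
  (.set 4 (.lit 0) (.lit 1) ;; .while powersGuard powersStep) ;; paramsCmd k m ;; powCmd ;;
    .assign 7 (.var 11 *ₑ .var 6)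

/-- A bound for the cost of `initCmd`. -/
def initCost (k m sz d q : ℕ) : ℕ :=
  ((Cmd.set 4 (.lit 0) (.lit 1)).lineWeight * q + (sz * ((powersGuard.weight + 1) * q +
    powersStep.lineWeight * q) + (powersGuard.weight + 1) * q)) +
  ((paramsCmd k m).lineWeight * q + (((Cmd.assign 6 (.lit 1)).lineWeight * q +
    (d + 1) * ((Cmd.assign 6 (.var 6 *ₑ .var 5)).lineWeight * q + Cmd.forWeight 19 (.var 10) * q)) +
    (Cmd.assign 7 (.var 11 *ₑ .var 6)).lineWeight * q))

theorem powers_det (hq : 1 ≤ q) (hs : Bdd 30 q s) (hn : s 0 0 = n) (hsz : sz = (n ^ 3).size)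
    (hlt : sz < q) (h3 : s 3 0 = 0) :
    Det (.set 4 (.lit 0) (.lit 1) ;; .while powersGuard powersStep) s
      ((Cmd.set 4 (.lit 0) (.lit 1)).lineWeight * q + (sz * ((powersGuard.weight + 1) * q +
        powersStep.lineWeight * q) + (powersGuard.weight + 1) * q)) fun s' =>
      Bdd 30 q s' ∧ EqOff {3, 4} s s' ∧ s' 3 0 = sz ∧ ∀ j ≤ sz, s' 4 j = 2 ^ j := by
  have hq1 : 1 < 2 ^ q := Nat.one_lt_two_pow (by omega)
  refine Sim.assign_seq (x := 0) (v := 1) hq hs trivial trivial rfl rfl ?_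
  have hr : powersGuard.Reads 30 := by simp [powersGuard, AExp.Reads]
  refine Det.while (n := sz) (Inv := fun i s' => Bdd 30 q s' ∧ EqOff {3, 4} s s' ∧ s' 3 0 = i ∧
    ∀ j ≤ i, s' 4 j = 2 ^ j) ?_ ?_ ?_ ?_
  · rintro i hi s' ⟨hb, -⟩
    have := AExp.cost_le hq hb hr
    rw [add_mul]
    omega
  · rintro i hi s' ⟨hb, hoff, h3', h4'⟩
    have h0 : s' 0 0 = n := by rw [hoff 0 (by simp), hn]
    simp only [powersGuard, AExp.val, BinOp.apply, h3', h4' i le_rfl, h0]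
    rw [hsz, Nat.lt_size, pow_succ, pow_two]
    split_ifs with h <;> simp <;> omega
  · rintro i hi s' ⟨hb, hoff, h3', h4'⟩
    have hpow : 2 ^ (i + 1) < 2 ^ q := Nat.pow_lt_pow_right (by norm_num) (by omega)
    have hiq : i + 1 < 2 ^ q := lt_of_lt_of_le (by omega) Nat.lt_two_pow_self.le
    rw [powersStep, Cmd.lineWeight, add_mul]
    refine Sim.assign_seq (x := i + 1) (v := 2 ^ (i + 1)) hq hb
      ⟨⟨by norm_num, trivial⟩, trivial⟩ ⟨⟨by norm_num, by norm_num, trivial⟩, trivial⟩ ?_ ?_ ?_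
    · simp only [AExp.val, BinOp.apply, h3']
    · simp only [AExp.val, BinOp.apply, h3', h4' i le_rfl, pow_succ]
    refine Det.assign_last (x := 0) (v := i + 1) hq (hb.write_lt hpow) trivial
      ⟨⟨by norm_num, trivial⟩, trivial⟩ rfl ?_ ⟨(hb.write_lt hpow).write_lt hiq,
        (hoff.write (by simp) _ _).write (by simp) _ _, Store.write_self _ _ _ _, ?_⟩
    · simp only [AExp.val, BinOp.apply]
      rw [Store.write_of_ne _ (by norm_num), h3']
    · intro j hj
      rw [Store.write_of_ne _ (by norm_num), Store.write_apply]
      split_ifs with h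
      · rw [h]
      · exact h4' j (by omega)
  · refine ⟨hs.write_lt hq1, (EqOff.refl _ _).write (by simp) _ _, ?_, ?_⟩
    · rw [Store.write_of_ne _ (by norm_num), h3]
    · intro j hj
      obtain rfl : j = 0 := by omega
      rw [Store.write_self, pow_zero]

theorem powCmd_det {t d : ℕ} (hq : 1 ≤ q) (hs : Bdd 30 q s) (h5 : s 5 0 = t) (h10 : s 10 0 = d)
    (ht : 0 < t) (htd : t ^ d < 2 ^ q) (hd : d < 2 ^ q) :
    Det powCmd s ((Cmd.assign 6 (.lit 1)).lineWeight * q +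
      (d + 1) * ((Cmd.assign 6 (.var 6 *ₑ .var 5)).lineWeight * q +
        Cmd.forWeight 19 (.var 10) * q)) fun s' =>
      Bdd 30 q s' ∧ EqOff {6, 19} s s' ∧ s' 6 0 = t ^ d := by
  have hb1 := hs.write_lt (a := 6) (x := 0) (Nat.one_lt_two_pow (n := q) (by omega))
  refine Sim.assign_seq (x := 0) (v := 1) hq hs trivial trivial rfl rfl ?_
  refine (Det.for (A := 30) (e := .var 10)
    (B := (Cmd.assign 6 (.var 6 *ₑ .var 5)).lineWeight * q) (fun i s' => Bdd 30 q s' ∧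
    EqOff {6, 19} s s' ∧ s' 6 0 = t ^ i ∧ s' 19 0 = i) hq (by norm_num) ⟨by norm_num, trivial⟩
    ?_ ?_ hb1 ⟨hb1.write (by simp), ((EqOff.refl _ _).write (by simp) _ _).write (by simp) _ _, ?_,
      Store.write_self _ _ _ _⟩).mono le_rfl fun s' h => ⟨h.1, h.2.1, h.2.2.1⟩
  · rintro i hi s' ⟨hb, hoff, -, h19⟩
    refine ⟨hb, ?_, h19⟩
    simp only [AExp.val]
    rw [hoff 10 (by simp), h10]
  · rintro i hi s' ⟨hb, hoff, h6, h19⟩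
    have hb2 := hb.write_lt (a := 6) (x := 0) ((Nat.pow_le_pow_right ht hi).trans_lt htd)
    refine Det.assign_last (x := 0) (v := t ^ (i + 1)) hq hb trivial
      ⟨⟨by norm_num, trivial⟩, by norm_num, trivial⟩ rfl ?_ ⟨hb2, ?_,
        hb2.write_lt (lt_of_le_of_lt hi hd), (hoff.write (by simp) _ _).write (by simp) _ _, ?_,
        Store.write_self _ _ _ _⟩
    · simp only [AExp.val, BinOp.apply, h6]
      rw [hoff 5 (by simp), h5, pow_succ]
    · rw [Store.write_of_ne _ (by norm_num), h19]
    · rw [Store.write_of_ne _ (by norm_num), Store.write_self]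
  · rw [Store.write_of_ne _ (by norm_num), Store.write_self, pow_zero]

theorem initCmd_det (hz : Sizes k n g b m sz q) (hsz : sz = (n ^ 3).size) (I : Inst k n g b) :
    Det (initCmd k m) (inputStore I) (initCost k m sz (g * k) q) fun s' =>
      Bdd 30 q s' ∧ EqOff {3, 4, 5, 6, 7, 9, 10, 11, 19} (inputStore I) s' ∧
        Env k n g b m sz (instBits I) s' := by
  have hq := hz.q_pos
  have hq1 : 1 < 2 ^ q := Nat.one_lt_two_pow (by omega)
  have hbq : b < 2 ^ q := (hz.b_le.trans_lt hz.levels_lt).trans Nat.lt_two_pow_self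
  have htpos : 0 < 2 * m * sz := by have := hz.m_pos; have := hz.levels_pos; positivity
  have hb : Bdd 30 q (inputStore I) := by
    intro a _ x
    apply size_le_of_lt_two_pow
    by_cases h1 : a = 1
    · subst h1
      rw [inputStore_one]
      cases instBits I x <;> simp
      omega
    · simp only [inputStore, h1, if_false]
      split_ifs
      exacts [hz.n_lt, hz.g_lt, hbq, Nat.two_pow_pos q, Nat.two_pow_pos q]
  refine Det.seq (powers_det (n := n) hq hb (by simp [inputStore]) hsz hz.levels_lt
    (by simp [inputStore])) ?_
  rintro s₁ ⟨hb₁, hoff₁, h3, h4⟩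
  have e00 : s₁ 0 0 = n := by rw [hoff₁ 0 (by simp)]; simp [inputStore]
  have e01 : s₁ 0 1 = g := by rw [hoff₁ 0 (by simp)]; simp [inputStore]
  have e02 : s₁ 0 2 = b := by rw [hoff₁ 0 (by simp)]; simp [inputStore]
  have hb₂ := hb₁.write_lt (a := 9) (x := 0) hz.vars_lt
  have hb₃ := hb₂.write_lt (a := 5) (x := 0) hz.bits_lt
  have hb₄ := hb₃.write_lt (a := 10) (x := 0) hz.blocks_lt
  have hb₅ := hb₄.write_lt (a := 11) (x := 0) hz.trials_lt
  have hparams : Det (paramsCmd k m) s₁ ((paramsCmd k m).lineWeight * q) fun s' =>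
      s' = (((s₁.write 9 0 (numVars k n g b)).write 5 0 (2 * m * sz)).write 10 0 (g * k)).write
        11 0 (sz * sz) := by
    rw [paramsCmd, Cmd.lineWeight, add_mul]
    refine Sim.assign_seq (x := 0) (v := numVars k n g b) hq hb₁ trivial
      ⟨⟨⟨trivial, by norm_num, trivial⟩, by norm_num, trivial⟩, by norm_num, by norm_num, trivial⟩
      rfl ?_ ?_
    · simp only [AExp.val, BinOp.apply, e00, e01, e02, h4 b hz.b_le, numVars]
    rw [Cmd.lineWeight, add_mul]
    refine Sim.assign_seq (x := 0) (v := 2 * m * sz) hq hb₂ trivial ⟨trivial, by norm_num, trivial⟩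
      rfl ?_ ?_
    · simp only [AExp.val, BinOp.apply]
      rw [Store.write_of_ne _ (by norm_num), h3]
    rw [Cmd.lineWeight, add_mul]
    refine Sim.assign_seq (x := 0) (v := g * k) hq hb₃ trivial ⟨⟨by norm_num, trivial⟩, trivial⟩
      rfl ?_ ?_
    · simp only [AExp.val, BinOp.apply]
      rw [Store.write_of_ne _ (by norm_num), Store.write_of_ne _ (by norm_num), e01]
    refine Det.assign_last (x := 0) (v := sz * sz) hq hb₄ trivial
      ⟨⟨by norm_num, trivial⟩, by norm_num, trivial⟩ rfl ?_ rfl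
    simp only [AExp.val, BinOp.apply]
    rw [Store.write_of_ne _ (by norm_num), Store.write_of_ne _ (by norm_num),
      Store.write_of_ne _ (by norm_num), h3]
  refine Det.seq hparams ?_
  rintro s₂ hs₂
  rw [← hs₂] at hb₅
  have hoff₂ : EqOff {5, 9, 10, 11} s₁ s₂ := hs₂ ▸ ((((EqOff.refl _ _).write (by simp) _ _).write
    (by simp) _ _).write (by simp) _ _).write (by simp) _ _
  have e5 : s₂ 5 0 = 2 * m * sz := by simp [hs₂, Store.write]
  have e9 : s₂ 9 0 = numVars k n g b := by simp [hs₂, Store.write]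
  have e10 : s₂ 10 0 = g * k := by simp [hs₂, Store.write]
  have e11 : s₂ 11 0 = sz * sz := by simp [hs₂, Store.write]
  refine Det.seq (powCmd_det hq hb₅ e5 e10 htpos hz.queries_lt hz.blocks_lt) ?_
  rintro s₃ ⟨hb₆, hoff₃, h6⟩
  refine Det.assign_last (x := 0) (v := sz * sz * (2 * m * sz) ^ (g * k)) hq hb₆ trivial
    ⟨⟨by norm_num, trivial⟩, by norm_num, trivial⟩ rfl ?_ ⟨hb₆.write_lt hz.stripes_lt, ?_, ?_⟩
  · simp only [AExp.val, BinOp.apply]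
    rw [h6, hoff₃ 11 (by simp), e11]
  · refine (((hoff₁.mono ?_).trans (hoff₂.mono ?_)).trans (hoff₃.mono ?_)).write (by simp) _ _ <;>
      (intro a ha; simp at ha ⊢; omega)
  · constructor
    · rw [Store.write_of_ne _ (by norm_num), hoff₃ 0 (by simp), hoff₂ 0 (by simp), e00]
    · rw [Store.write_of_ne _ (by norm_num), hoff₃ 0 (by simp), hoff₂ 0 (by simp), e01]
    · rw [Store.write_of_ne _ (by norm_num), hoff₃ 0 (by simp), hoff₂ 0 (by simp), e02]
    · intro x
      rw [Store.write_of_ne _ (by norm_num), hoff₃ 1 (by simp), hoff₂ 1 (by simp),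
        hoff₁ 1 (by simp), inputStore_one]
    · rw [Store.write_of_ne _ (by norm_num), hoff₃ 3 (by simp), hoff₂ 3 (by simp), h3]
    · intro j hj
      rw [Store.write_of_ne _ (by norm_num), hoff₃ 4 (by simp), hoff₂ 4 (by simp), h4 j hj]
    · rw [Store.write_of_ne _ (by norm_num), hoff₃ 5 (by simp), e5]
    · rw [Store.write_of_ne _ (by norm_num), h6]
    · rw [Store.write_self]
    · rw [Store.write_of_ne _ (by norm_num), hoff₃ 9 (by simp), e9]
    · rw [Store.write_of_ne _ (by norm_num), hoff₃ 10 (by simp), e10]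
    · rw [Store.write_of_ne _ (by norm_num), hoff₃ 11 (by simp), e11]

/-- The program that solves the problem in the worst case, with the program `P` that solves it on
average as a subroutine. -/
def solver (coinCmd : Cmd) (k m : ℕ) (P : Cmd) : Cmd :=
  initCmd k m ;; votes coinCmd k m P ;; .assign 2 (.var 32)

/-- A bound for the cost of `solver`. -/
def solverCost (w k m sz d N q Tc : ℕ) : ℕ :=
  initCost k m sz d q + ((sz * sz + 1) * (trialCost w k m d N (2 * m * sz) q (2 * q + Tc) Tc +
    voteCmd.lineWeight * (2 * q + Tc) + Cmd.forWeight 20 (.var 11) * q) +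
      (Cmd.assign 2 (.var 32)).lineWeight * (2 * q + Tc))

theorem solver_sim (hcoin : IsCoin μ coinCmd w) (hz : Sizes k n g b m sz q)
    (hsz : sz = (n ^ 3).size) {D : Inst k n g b → PMF (Store × ℕ)}
    (hrun : ∀ I, Runs P (inputStore I) (D I) ∧ ∀ r ∈ (D I).support, r.2 ≤ Tn)
    (I : Inst k n g b) :
    Sim (solver coinCmd k m P) (inputStore I)
      (solverCost w k m sz (g * k) (numVars k n g b) q
        (stripeFactor (sz * sz * (2 * m * sz) ^ (g * k)) * Tn))
      ((vote (trial μ m sz (fun I => (D I).map fun r => r.1 2 0) (instBits I)) (sz * sz)).map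
        Prod.fst) fun s' v => s' 2 0 = v := by
  refine Det.seq_sim (initCmd_det hz hsz I) ?_
  rintro s ⟨hb, hoff, he⟩
  have hzero : ∀ a, 12 ≤ a → a ≠ 19 → s a = fun _ => 0 := by
    intro a ha h19
    rw [hoff a (by simp only [Set.mem_insert_iff, Set.mem_singleton_iff]; omega)]
    funext x
    rw [inputStore, if_neg (by omega), if_neg (by omega)]
  have hq := hz.q_pos
  refine Sim.seq_map (votes_sim hcoin hz hrun rfl le_rfl hb ?_ he ?_ ?_ ?_ ?_) ?_
  · intro a ha x
    by_cases h : a < 30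
    · exact (hb a h x).trans (by omega)
    · rw [hzero a (by omega) (by omega)]
      simp
  · rw [hoff 8 (by simp)]
    simp [inputStore]
  · intro a x ha _
    unfold simBase at ha
    rw [hzero a (by omega) (by omega)]
  · rw [hzero 27 (by norm_num) (by norm_num)]
  · rw [hzero 32 (by norm_num) (by norm_num)]
  · rintro s' Q ⟨hb', h32⟩
    exact Det.assign_last (x := 0) (v := Q.1) (by omega) hb' trivial ⟨by norm_num, trivial⟩ rfl h32
      (Store.write_self _ _ _ _)

theorem solver_usesCoins {coins : Set ℝ} (hc : coinCmd.UsesCoins coins) (hP : P.UsesCoins coins)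
    (k m : ℕ) : (solver coinCmd k m P).UsesCoins coins := by
  have := hP.stripe
  simp [solver, initCmd, powersStep, paramsCmd, powCmd, votes, Cmd.for, trialCmd, voteCmd,
    sampleAll, sampleBody, countHeads, queryLoop, queryBody, digitsCmd, digitStep, writeInst,
    writeParams, writeBit, collect, Cmd.UsesCoins, hc, this]

end Trials

/-! ### Bounds up to subpolynomial factors -/

/-- `u = O(n^ε T)` for every `ε > 0`. For `T = 1` this says that `u` grows subpolynomially. -/
def SoftO (T u : ℕ → ℕ) : Prop :=
  ∀ ε : ℝ, 0 < ε → (fun n : ℕ => (u n : ℝ)) =O[atTop] fun n : ℕ => (n : ℝ) ^ ε * (T n : ℝ)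

section SoftO

variable {S T u v : ℕ → ℕ}

theorem SoftO.mono (h : SoftO T v) (huv : ∀ᶠ n in atTop, u n ≤ v n) : SoftO T u := fun ε hε =>
  (IsBigO.of_bound 1 (by
    filter_upwards [huv] with n hn
    simpa using (Nat.cast_le (α := ℝ)).2 hn)).trans (h ε hε)

theorem SoftO.add (hu : SoftO T u) (hv : SoftO T v) : SoftO T fun n => u n + v n := fun ε hε => by
  simpa only [Nat.cast_add] using (hu ε hε).add (hv ε hε)

/-- A subpolynomial factor does not matter. -/
theorem SoftO.mul (hu : SoftO (fun _ => 1) u) (hv : SoftO T v) :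
    SoftO T fun n => u n * v n := fun ε hε => by
  have h := (hu (ε / 2) (half_pos hε)).mul (hv (ε / 2) (half_pos hε))
  simp only [Nat.cast_mul]
  refine h.congr' EventuallyEq.rfl ?_
  filter_upwards [eventually_gt_atTop 0] with n hn
  have hn' : (0 : ℝ) < n := by exact_mod_cast hn
  have : (n : ℝ) ^ ε = (n : ℝ) ^ (ε / 2) * (n : ℝ) ^ (ε / 2) := by
    rw [← Real.rpow_add hn', add_halves]
  rw [this]
  push_cast
  ring

theorem SoftO.mul_right (hu : SoftO T u) (hv : SoftO (fun _ => 1) v) :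
    SoftO T fun n => u n * v n := by
  simpa only [mul_comm] using hv.mul hu

theorem SoftO.of_one (hT : ∀ᶠ n in atTop, 1 ≤ T n) (hu : SoftO (fun _ => 1) u) : SoftO T u :=
  fun ε hε => (hu ε hε).trans (IsBigO.of_bound 1 (by
    filter_upwards [hT] with n hn
    have h1 : (1 : ℝ) ≤ T n := by exact_mod_cast hn
    have h2 : (0 : ℝ) ≤ (n : ℝ) ^ ε := Real.rpow_nonneg (Nat.cast_nonneg n) ε
    rw [Real.norm_of_nonneg (by positivity), Real.norm_of_nonneg (by positivity), one_mul,
      Nat.cast_one]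
    exact mul_le_mul_of_nonneg_left h1 h2))

theorem SoftO.self (T : ℕ → ℕ) : SoftO T T := fun ε hε => IsBigO.of_bound 1 (by
  filter_upwards [eventually_ge_atTop 1] with n hn
  have hn' : (1 : ℝ) ≤ n := by exact_mod_cast hn
  have h1 : (1 : ℝ) ≤ (n : ℝ) ^ ε := Real.one_le_rpow hn' hε.le
  have h2 : (0 : ℝ) ≤ T n := Nat.cast_nonneg _
  rw [Real.norm_of_nonneg h2, Real.norm_of_nonneg (by positivity), one_mul]
  exact le_mul_of_one_le_left h2 h1)

theorem SoftO.const (c : ℕ) : SoftO (fun _ => 1) fun _ => c := by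
  have h := SoftO.self (fun _ => 1)
  intro ε hε
  have := (h ε hε).const_mul_left (c : ℝ)
  simpa using this

/-- The cost of the solver is the running time of the oracle up to a subpolynomial factor. -/
theorem softO_solverCost (w k m : ℕ) {sz d N q : ℕ → ℕ} (hT : ∀ᶠ n in atTop, 1 ≤ T n)
    (hsz : SoftO (fun _ => 1) sz) (hd : SoftO (fun _ => 1) d) (hq : SoftO (fun _ => 1) q)
    (ht : SoftO (fun _ => 1) fun n => (2 * m * sz n) ^ d n) (hN : SoftO T N) :
    SoftO T fun n => solverCost w k m (sz n) (d n) (N n) (q n)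
      (stripeFactor (sz n * sz n * (2 * m * sz n) ^ d n) * T n) := by
  have one : ∀ {u}, SoftO (fun _ => 1) u → SoftO T u := fun h => h.of_one hT
  have c := SoftO.const
  have hsz2 : SoftO (fun _ => 1) fun n => sz n * sz n := hsz.mul hsz
  have hTc : SoftO T fun n =>
      stripeFactor (sz n * sz n * (2 * m * sz n) ^ d n) * T n := by
    refine SoftO.mul ?_ (SoftO.self T)
    refine ((c 10).mul ?_).add (c 10)
    exact (hsz2.mul ht).mono (Eventually.of_forall fun n => Nat.size_le.2 Nat.lt_two_pow_self)
  have hq' : SoftO T fun n => 2 * q n + stripeFactor (sz n * sz n * (2 * m * sz n) ^ d n) * T n :=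
    (one ((c 2).mul hq)).add hTc
  have hbits : SoftO (fun _ => 1) fun n => 2 * m * sz n := (c (2 * m)).mul hsz
  have hinit : SoftO (fun _ => 1) fun n => initCost k m (sz n) (d n) (q n) :=
    (((c _).mul hq).add ((hsz.mul (((c _).mul hq).add ((c _).mul hq))).add ((c _).mul hq))).add
      (((c _).mul hq).add ((((c _).mul hq).add ((hd.add (c 1)).mul (((c _).mul hq).add
        ((c _).mul hq)))).add ((c _).mul hq)))
  have hsample : SoftO (fun _ => 1) fun n => sampleBodyCost w m (2 * m * sz n) (q n) :=
    ((((hbits.add (c 1)).mul ((((c _).mul hq).add ((c _).mul hq)).add ((c _).mul hq))).add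
      ((c _).mul hq)).add ((c _).mul hq))
  have hN1 : SoftO T fun n => N n + 1 := hN.add (one (c 1))
  have hwrite : SoftO T fun n => writeInstCost k m (N n) (q n) :=
    (one ((c _).mul hq)).add (hN1.mul_right (((c _).mul hq).add ((c _).mul hq)))
  have hdigits : SoftO (fun _ => 1) fun n => digitsCost m (d n) (q n) :=
    ((c _).mul hq).add ((hd.add (c 1)).mul (((c _).mul hq).add ((c _).mul hq)))
  have hquery : SoftO T fun n => queryBodyCost k m (d n) (N n) (q n)
      (2 * q n + stripeFactor (sz n * sz n * (2 * m * sz n) ^ d n) * T n)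
      (stripeFactor (sz n * sz n * (2 * m * sz n) ^ d n) * T n) :=
    (one hdigits).add (hwrite.add (hTc.add (((c _).mul hq').add (one ((c _).mul hq)))))
  have htrial : SoftO T fun n => trialCost w k m (d n) (N n) (2 * m * sz n) (q n)
      (2 * q n + stripeFactor (sz n * sz n * (2 * m * sz n) ^ d n) * T n)
      (stripeFactor (sz n * sz n * (2 * m * sz n) ^ d n) * T n) :=
    (hN1.mul_right (hsample.add ((c _).mul hq))).add ((one ((c _).mul hq)).add
      ((one ((c _).mul hq)).add (((ht.add (c 1)).mul (hquery.add (one ((c _).mul hq)))).add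
        ((c _).mul hq'))))
  exact (one hinit).add (((hsz2.add (c 1)).mul ((htrial.add ((c _).mul hq')).add
    (one ((c _).mul hq)))).add ((c _).mul hq'))

end SoftO

/-! ### Growth of the parameters -/

theorem SoftO.of_le_rpow {u : ℕ → ℕ}
    (h : ∀ ε : ℝ, 0 < ε → ∀ᶠ n : ℕ in atTop, (u n : ℝ) ≤ (n : ℝ) ^ ε) :
    SoftO (fun _ => 1) u := fun ε hε => IsBigO.of_bound 1 (by
  filter_upwards [h ε hε] with n hn
  have h1 : (0 : ℝ) ≤ (n : ℝ) ^ ε := Real.rpow_nonneg (Nat.cast_nonneg n) ε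
  rw [Real.norm_of_nonneg (Nat.cast_nonneg _), Real.norm_of_nonneg (by positivity)]
  simpa using hn)

theorem SoftO.eventually_le {u : ℕ → ℕ} (h : SoftO (fun _ => 1) u) :
    ∀ᶠ n in atTop, u n ≤ n := by
  obtain ⟨C, hC⟩ := (h (1 / 2) (by norm_num)).bound
  have h2 : Tendsto (fun n : ℕ => (n : ℝ) ^ (1 / 2 : ℝ)) atTop atTop :=
    (tendsto_rpow_atTop (by norm_num)).comp tendsto_natCast_atTop_atTop
  filter_upwards [hC, h2.eventually_ge_atTop C, eventually_gt_atTop 0] with n hn hCn hn0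
  have hn' : (0 : ℝ) < n := by exact_mod_cast hn0
  have hpos : (0 : ℝ) ≤ (n : ℝ) ^ (1 / 2 : ℝ) := by positivity
  rw [Nat.cast_one, mul_one, Real.norm_natCast, Real.norm_of_nonneg hpos] at hn
  have : (u n : ℝ) ≤ n := by
    calc (u n : ℝ) ≤ (n : ℝ) ^ (1 / 2 : ℝ) * (n : ℝ) ^ (1 / 2 : ℝ) :=
          hn.trans (mul_le_mul_of_nonneg_right hCn hpos)
      _ = n := by rw [← Real.rpow_add hn']; norm_num
  exact_mod_cast this

theorem tendsto_logb_two : Tendsto (fun n : ℕ => Real.logb 2 n) atTop atTop :=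
  (Real.tendsto_logb_atTop (by norm_num)).comp tendsto_natCast_atTop_atTop

theorem tendsto_logb_logb_two :
    Tendsto (fun n : ℕ => Real.logb 2 (Real.logb 2 n)) atTop atTop :=
  (Real.tendsto_logb_atTop (by norm_num)).comp tendsto_logb_two

theorem two_rpow_mul_logb {x : ℝ} (hx : 0 < x) (ε : ℝ) : (2 : ℝ) ^ (Real.logb 2 x * ε) = x ^ ε := by
  rw [Real.rpow_mul (by norm_num), Real.rpow_logb (by norm_num) (by norm_num) hx]

theorem three_mul_logb_le_size {n : ℕ} (hn : 0 < n) :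
    3 * Real.logb 2 n ≤ ((n ^ 3).size : ℝ) := by
  have hn' : (0 : ℝ) < n := by exact_mod_cast hn
  have h : ((n ^ 3 : ℕ) : ℝ) ≤ (2 : ℝ) ^ ((n ^ 3).size) := by exact_mod_cast (Nat.lt_size_self _).le
  have h2 := Real.logb_le_logb_of_le (b := 2) (by norm_num) (by positivity) h
  rw [Real.logb_pow, Real.logb_self_eq_one (by norm_num), Nat.cast_pow, Real.logb_pow] at h2
  push_cast at h2
  linarith

theorem size_le_three_mul_logb {n : ℕ} (hn : 0 < n) :
    ((n ^ 3).size : ℝ) ≤ 3 * Real.logb 2 n + 1 := by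
  have hn' : (0 : ℝ) < n := by exact_mod_cast hn
  have hpos : 0 < (n ^ 3).size := Nat.size_pos.2 (by positivity)
  have h : (2 : ℝ) ^ ((n ^ 3).size - 1) ≤ ((n ^ 3 : ℕ) : ℝ) := by
    exact_mod_cast Nat.lt_size.1 (Nat.sub_lt hpos one_pos)
  have h2 := Real.logb_le_logb_of_le (b := 2) (by norm_num) (by positivity) h
  rw [Real.logb_pow, Real.logb_self_eq_one (by norm_num), Nat.cast_pow, Real.logb_pow,
    Nat.cast_sub hpos] at h2
  push_cast at h2
  linarith

theorem tendsto_size_cube : Tendsto (fun n : ℕ => (n ^ 3).size) atTop atTop := by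
  rw [← tendsto_natCast_atTop_iff (R := ℝ)]
  refine tendsto_atTop_mono' _ ?_ tendsto_logb_two
  filter_upwards [eventually_gt_atTop 0, tendsto_logb_two.eventually_ge_atTop 0] with n hn hL
  have := three_mul_logb_le_size hn
  linarith

theorem softO_of_le_mul_logb {u : ℕ → ℕ} (C : ℝ)
    (h : ∀ᶠ n : ℕ in atTop, (u n : ℝ) ≤ C * Real.logb 2 n) : SoftO (fun _ => 1) u := by
  intro ε hε
  have h1 : (fun n : ℕ => (u n : ℝ)) =O[atTop] fun n : ℕ => Real.log n :=
    IsBigO.of_bound (C / Real.log 2) (by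
      filter_upwards [h, eventually_ge_atTop 1] with n hn hn1
      have : (1 : ℝ) ≤ n := by exact_mod_cast hn1
      rw [Real.norm_of_nonneg (Nat.cast_nonneg _), Real.norm_of_nonneg (Real.log_nonneg this)]
      refine hn.trans (le_of_eq ?_)
      rw [Real.logb]
      ring)
  have h2 := (isLittleO_log_rpow_atTop hε).comp_tendsto (tendsto_natCast_atTop_atTop (R := ℝ))
  simpa [Function.comp_def] using h1.trans h2.isBigO

theorem size_le_four_mul_logb : ∀ᶠ n : ℕ in atTop, ((n ^ 3).size : ℝ) ≤ 4 * Real.logb 2 n := by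
  filter_upwards [eventually_gt_atTop 0, tendsto_logb_two.eventually_ge_atTop 1] with n hn hL
  have := size_le_three_mul_logb hn
  linarith

theorem softO_size : SoftO (fun _ => 1) fun n => (n ^ 3).size :=
  softO_of_le_mul_logb 4 size_le_four_mul_logb

section Growth

variable {g b : ℕ → ℕ}

theorem softO_levels (hg : (fun n : ℕ => (g n : ℝ)) =o[atTop]
    fun n : ℕ => Real.logb 2 n / Real.logb 2 (Real.logb 2 n)) : SoftO (fun _ => 1) g := by
  refine softO_of_le_mul_logb 1 ?_
  filter_upwards [hg.bound one_pos, tendsto_logb_two.eventually_ge_atTop 0,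
    tendsto_logb_logb_two.eventually_ge_atTop 1] with n hn hL hLL
  rw [Real.norm_of_nonneg (Nat.cast_nonneg _), Real.norm_of_nonneg (by positivity)] at hn
  refine hn.trans ?_
  rw [one_mul, one_mul]
  exact div_le_self hL hLL

theorem softO_two_pow (hb : (fun n : ℕ => (b n : ℝ)) =o[atTop] fun n : ℕ => Real.logb 2 n) :
    SoftO (fun _ => 1) fun n => 2 ^ b n := by
  refine SoftO.of_le_rpow fun ε hε => ?_
  filter_upwards [hb.bound hε, tendsto_logb_two.eventually_ge_atTop 0, eventually_gt_atTop 0]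
    with n hn hL hn0
  rw [Real.norm_of_nonneg (Nat.cast_nonneg _), Real.norm_of_nonneg hL] at hn
  have hn' : (0 : ℝ) < n := by exact_mod_cast hn0
  rw [← two_rpow_mul_logb hn', mul_comm]
  push_cast
  rw [← Real.rpow_natCast]
  exact Real.rpow_le_rpow_of_exponent_le (by norm_num) hn

/-- The number of queries is subpolynomial: this is where `g = o(lg n / lg lg n)` is needed. -/
theorem softO_queries (m k : ℕ) (hg : (fun n : ℕ => (g n : ℝ)) =o[atTop]
    fun n : ℕ => Real.logb 2 n / Real.logb 2 (Real.logb 2 n)) :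
    SoftO (fun _ => 1) fun n => (2 * m * (n ^ 3).size) ^ (g n * k) := by
  refine SoftO.of_le_rpow fun ε hε => ?_
  have hk : (0 : ℝ) < ε / (2 * (k + 1)) := by positivity
  filter_upwards [hg.bound hk, tendsto_logb_two.eventually_ge_atTop (max 1 (8 * m)),
    tendsto_logb_logb_two.eventually_ge_atTop 1, eventually_gt_atTop 0, size_le_four_mul_logb]
    with n hn hL hLL hn0 hsz
  have hn' : (0 : ℝ) < n := by exact_mod_cast hn0
  set L := Real.logb 2 n with hLdef
  have hL1 : 1 ≤ L := (le_max_left _ _).trans hL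
  have hL8 : 8 * (m : ℝ) ≤ L := (le_max_right _ _).trans hL
  have hL0 : 0 < L := by linarith
  rw [Real.norm_of_nonneg (Nat.cast_nonneg _), Real.norm_of_nonneg (by positivity)] at hn
  have hgL : g n * Real.logb 2 L ≤ ε / (2 * (k + 1)) * L := by
    rw [← mul_div_assoc, le_div_iff₀ (by linarith)] at hn
    exact hn
  -- `t ^ (g k) ≤ (lg n) ^ (2 g k) = 2 ^ (2 g k lg lg n)`, with an exponent `o(lg n)`.
  have ht : (2 * m * (n ^ 3).size : ℝ) ≤ L ^ 2 := by
    calc (2 * m * (n ^ 3).size : ℝ) ≤ 2 * m * (4 * L) := by gcongr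
      _ = 8 * m * L := by ring
      _ ≤ L * L := by gcongr
      _ = L ^ 2 := by ring
  push_cast
  calc (2 * m * (n ^ 3).size : ℝ) ^ (g n * k) ≤ (L ^ 2) ^ (g n * k) := by gcongr
    _ = L ^ ((2 * (g n * k) : ℕ) : ℝ) := by rw [Real.rpow_natCast, pow_mul L]
    _ = 2 ^ (Real.logb 2 L * ((2 * (g n * k) : ℕ) : ℝ)) := (two_rpow_mul_logb hL0 _).symm
    _ ≤ 2 ^ (L * ε) := by
        refine Real.rpow_le_rpow_of_exponent_le (by norm_num) ?_
        push_cast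
        calc Real.logb 2 L * (2 * (g n * k)) = 2 * k * (g n * Real.logb 2 L) := by ring
          _ ≤ 2 * k * (ε / (2 * (k + 1)) * L) := by gcongr
          _ = k / (k + 1) * (ε * L) := by field_simp
          _ ≤ 1 * (ε * L) := by
              gcongr
              rw [div_le_one (by positivity)]
              linarith
          _ = L * ε := by ring
    _ = (n : ℝ) ^ ε := two_rpow_mul_logb hn' ε

theorem numVars_le_sq (k : ℕ) (hg : SoftO (fun _ => 1) g)
    (hb : SoftO (fun _ => 1) fun n => 2 ^ b n) :
    ∀ᶠ n in atTop, numVars k n (g n) (b n) ≤ n ^ 2 := by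
  filter_upwards [(((SoftO.const k).mul hg).mul hb).eventually_le] with n hn
  calc numVars k n (g n) (b n) = k * g n * 2 ^ b n * n := by unfold numVars; ring
    _ ≤ n * n := Nat.mul_le_mul_right _ hn
    _ = n ^ 2 := by ring

/-- The coefficients of the queries have about `(n ^ 3).size * (g n * k)` bits; all other numbers
are much smaller. -/
theorem eventually_sizes {k m : ℕ} (hk : 0 < k) (hm : 0 < m)
    (hg : SoftO (fun _ => 1) g)
    (hb : (fun n : ℕ => (b n : ℝ)) =o[atTop] fun n : ℕ => Real.logb 2 n) :
    ∀ᶠ n in atTop, Sizes k n (g n) (b n) m (n ^ 3).size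
      ((n ^ 3).size * (g n * k + 1) + 1) := by
  filter_upwards [numVars_le_sq k hg (softO_two_pow hb), eventually_ge_atTop 1,
    hb.bound one_pos, tendsto_logb_two.eventually_ge_atTop 0,
    tendsto_size_cube.eventually_ge_atTop (2 * m + 4)] with n hN hn hbn hL hsz
  set sz := (n ^ 3).size with hszdef
  rw [Real.norm_of_nonneg (Nat.cast_nonneg _), Real.norm_of_nonneg hL] at hbn
  have hcube : n ^ 3 < 2 ^ sz := Nat.lt_size_self _
  have hsq : sz * sz ≤ 2 ^ sz := by
    have h : ∀ x : ℕ, 4 ≤ x → x * x ≤ 2 ^ x := by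
      intro x hx
      induction x, hx using Nat.le_induction with
      | base => norm_num
      | succ x hx ih => rw [pow_succ]; nlinarith
    exact h sz (by omega)
  have hbits : 2 * m * sz ≤ 2 ^ sz := (Nat.mul_le_mul_right sz (by omega)).trans hsq
  have hd : g n * k ≤ sz * (g n * k) := Nat.le_mul_of_pos_left _ (by omega)
  have hgd : g n ≤ g n * k := Nat.le_mul_of_pos_right _ hk
  have hq : sz * (g n * k + 1) + 1 = sz * (g n * k) + sz + 1 := by ring
  rw [hq]
  have hpow : 2 ^ sz < 2 ^ (sz * (g n * k) + sz + 1) :=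
    Nat.pow_lt_pow_right (by norm_num) (by omega)
  have hself : sz * (g n * k) + sz + 1 < 2 ^ (sz * (g n * k) + sz + 1) := Nat.lt_two_pow_self
  have hqueries : (2 * m * sz) ^ (g n * k) ≤ 2 ^ (sz * (g n * k)) := by
    rw [pow_mul 2]
    exact Nat.pow_le_pow_left hbits _
  constructor
  · omega
  · exact hm
  · omega
  · omega
  · exact (Nat.le_self_pow (by norm_num) n).trans_lt (hcube.trans hpow)
  · omega
  · have h := three_mul_logb_le_size hn
    have : (b n : ℝ) ≤ sz := by linarith
    exact_mod_cast this
  · omega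
  · exact hbits.trans_lt hpow
  · exact hqueries.trans_lt (Nat.pow_lt_pow_right (by norm_num) (by omega))
  · calc sz * sz * (2 * m * sz) ^ (g n * k) ≤ 2 ^ sz * 2 ^ (sz * (g n * k)) :=
          Nat.mul_le_mul hsq hqueries
      _ = 2 ^ (sz * (g n * k) + sz) := by rw [← pow_add, add_comm]
      _ < _ := Nat.pow_lt_pow_right (by norm_num) (by omega)
  · exact (hN.trans (Nat.pow_le_pow_right hn (by norm_num))).trans_lt (hcube.trans hpow)
  · omega
  · exact hsq.trans_lt hpow
  · exact Nat.pow_lt_pow_right (by norm_num) (by omega)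

end Growth

/-! ### Error bounds -/

theorem seven_tenths_pow_le {n : ℕ} (hn : 0 < n) (hL : 0 ≤ Real.logb 2 n) :
    (7 / 10 : ℝ) ^ ((n ^ 3).size * (n ^ 3).size) ≤ 2 ^ (-(Real.logb 2 n) ^ 2) := by
  set L := Real.logb 2 n with hLdef
  have h := three_mul_logb_le_size hn
  have h9 : 9 * L ^ 2 ≤ (((n ^ 3).size * (n ^ 3).size : ℕ) : ℝ) := by
    push_cast
    nlinarith
  rw [← Real.rpow_natCast]
  calc (7 / 10 : ℝ) ^ (((n ^ 3).size * (n ^ 3).size : ℕ) : ℝ) ≤ (7 / 10) ^ (9 * L ^ 2) :=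
        Real.rpow_le_rpow_of_exponent_ge (by norm_num) (by norm_num) h9
    _ = ((7 / 10) ^ (9 : ℝ)) ^ (L ^ 2) := Real.rpow_mul (by norm_num) _ _
    _ ≤ (2⁻¹) ^ (L ^ 2) := by
        refine Real.rpow_le_rpow (by positivity) ?_ (by positivity)
        rw [show (9 : ℝ) = ((9 : ℕ) : ℝ) by norm_num, Real.rpow_natCast]
        norm_num
    _ = 2 ^ (-L ^ 2) := by rw [Real.inv_rpow (by norm_num), Real.rpow_neg (by norm_num)]

/-- The errors of all queries of a trial add up to at most `1 / 10`, even if each error becomes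
twice as likely by the deviation of the queries from the average-case distribution. -/
theorem eventually_queries_mul_le {k m : ℕ} {g : ℕ → ℕ} (hk : 0 < k) (hg : ∀ n, 0 < g n) :
    ∀ᶠ n : ℕ in atTop, ((2 * m * (n ^ 3).size : ℕ) : ℝ) ^ (g n * k) *
      (2 * (1 - threshold k g n)) ≤ 1 / 10 := by
  filter_upwards [tendsto_logb_two.eventually_ge_atTop 1, size_le_four_mul_logb,
    tendsto_logb_logb_two.eventually_ge_atTop (max 1 (160 * m))] with n hL hsz hLL
  have hLL1 := (le_max_left _ _).trans hLL
  have hLLm := (le_max_right _ _).trans hLL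
  unfold threshold
  set L := Real.logb 2 n with hLdef
  set L' := Real.logb 2 L
  have hthr : 1 - (1 - 1 / (L ^ (k * g n) * L' ^ (k * g n))) = 1 / (L * L') ^ (g n * k) := by
    rw [mul_pow, mul_comm k]
    ring
  have hLpos : 0 < L := by linarith
  have hLLpos : 0 < L' := by linarith
  rw [hthr]
  -- The `d`-th power of this ratio, with `d = g k`, is the number of queries times the error.
  have hratio : ((2 * m * (n ^ 3).size : ℕ) : ℝ) / (L * L') ≤ 1 / 20 := by
    rw [div_le_div_iff₀ (by positivity) (by norm_num)]
    push_cast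
    calc (2 * m * (n ^ 3).size : ℝ) * 20 ≤ 2 * m * (4 * L) * 20 := by gcongr
      _ = L * (160 * m) := by ring
      _ ≤ L * L' := by gcongr
      _ = 1 * (L * L') := (one_mul _).symm
  calc ((2 * m * (n ^ 3).size : ℕ) : ℝ) ^ (g n * k) * (2 * (1 / (L * L') ^ (g n * k))) =
        2 * (((2 * m * (n ^ 3).size : ℕ) : ℝ) / (L * L')) ^ (g n * k) := by
          rw [div_pow]; ring
    _ ≤ 2 * (1 / 20) := by
        gcongr
        refine (pow_le_of_le_one (by positivity) (hratio.trans (by norm_num)) ?_).trans hratio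
        have := hg n
        positivity
    _ = 1 / 10 := by norm_num

/-- The deviations of the split bits from the law of the coin add up to little. -/
theorem exists_deviation {μ : unitInterval} (h0 : (0 : ℝ) < μ) (h1 : (μ : ℝ) < 1) :
    ∀ᶠ n : ℕ in atTop, ∃ c : ℝ, 1 ≤ c ∧
      (∀ v, bernMass μ v + 2 / 2 ^ (n ^ 3).size ≤ c * bernMass μ v) ∧
      ∀ N ≤ n ^ 2, c ^ N ≤ 2 := by
  obtain ⟨p, hp, hpv⟩ : ∃ p : ℝ, 0 < p ∧ ∀ v, p ≤ bernMass μ v := by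
    refine ⟨min μ (1 - μ), lt_min h0 (sub_pos.2 h1), fun v => ?_⟩
    cases v <;> simp [bernMass]
  filter_upwards [tendsto_natCast_atTop_atTop.eventually_ge_atTop (4 / p), eventually_gt_atTop 0]
    with n hn hn0
  have hn' : (0 : ℝ) < n := by exact_mod_cast hn0
  set x : ℝ := 2 / 2 ^ (n ^ 3).size / p with hx
  have hx0 : 0 ≤ x := by positivity
  refine ⟨1 + x, by linarith, fun v => ?_, fun N hN => ?_⟩
  · have : 2 / 2 ^ (n ^ 3).size = x * p := by rw [hx, div_mul_cancel₀ _ hp.ne']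
    rw [this, add_mul, one_mul]
    gcongr
    exact hpv v
  · have hcube : ((n ^ 3 : ℕ) : ℝ) ≤ (2 : ℝ) ^ ((n ^ 3).size) := by
      exact_mod_cast (Nat.lt_size_self _).le
    have hNx : N * x ≤ 1 / 2 := by
      have hN' : (N : ℝ) ≤ (n : ℝ) ^ 2 := by exact_mod_cast hN
      calc N * x ≤ (n : ℝ) ^ 2 * (2 / ((n ^ 3 : ℕ) : ℝ) / p) := by
            rw [hx]
            gcongr
        _ = 2 / (n * p) := by
            push_cast
            field_simp
        _ ≤ 1 / 2 := by
            rw [div_le_iff₀ hp] at hn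
            rw [div_le_div_iff₀ (by positivity) (by norm_num)]
            linarith
    calc (1 + x) ^ N ≤ Real.exp x ^ N := by
          gcongr
          linarith [Real.add_one_le_exp x]
      _ = Real.exp (N * x) := (Real.exp_nat_mul x N).symm
      _ ≤ Real.exp (Real.log 2) := by
          gcongr
          linarith [Real.log_two_gt_d9]
      _ = 2 := Real.exp_log (by norm_num)

/-! ### The reduction from the worst case to the average case -/

theorem expect_wrong_output (D : PMF (Store × ℕ)) (N : ℕ) :
    expect D (fun r => if r.1 2 0 = N then 0 else 1) = ENNReal.ofReal (1 - successProb D N) := by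
  have h1 : D.toOuterMeasure {r | r.1 2 0 = N} =
      expect D fun r => if r.1 2 0 = N then 1 else 0 := by
    rw [PMF.toOuterMeasure_apply, expect]
    congr 1
    funext r
    by_cases h : r.1 2 0 = N <;> simp [Set.indicator, h]
  have h2 : D.toOuterMeasure {r | r.1 2 0 = N} +
      expect D (fun r => if r.1 2 0 = N then 0 else 1) = 1 := by
    rw [h1, ← expect_add]
    refine Eq.trans ?_ (expect_const D 1)
    congr 1
    funext r
    split_ifs <;> simp
  have h3 : D.toOuterMeasure {r | r.1 2 0 = N} ≠ ⊤ :=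
    ne_top_of_le_ne_top ENNReal.one_ne_top (h2 ▸ le_self_add)
  rw [successProb, ENNReal.ofReal_sub _ ENNReal.toReal_nonneg, ENNReal.ofReal_toReal h3,
    ENNReal.ofReal_one]
  exact ENNReal.eq_sub_of_add_eq h3 (by rw [add_comm, h2])

theorem successProb_le_one (D : PMF (Store × ℕ)) (N : ℕ) : successProb D N ≤ 1 := by
  refine ENNReal.toReal_le_of_le_ofReal zero_le_one ?_
  rw [ENNReal.ofReal_one, PMF.toOuterMeasure_apply]
  calc ∑' x, ({r | r.1 2 0 = N} : Set (Store × ℕ)).indicator D x ≤ ∑' x, D x :=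
        ENNReal.tsum_le_tsum fun x => Set.indicator_le_self _ _ x
    _ = 1 := D.tsum_coe

theorem instMass_nonneg (μ : unitInterval) {k n g b : ℕ} (I : Inst k n g b) :
    0 ≤ instMass μ I := by
  unfold instMass vectorMass setMass
  refine Finset.prod_nonneg fun _ _ => Finset.prod_nonneg fun _ _ => Finset.prod_nonneg fun _ _ =>
    Finset.prod_nonneg fun _ _ => ?_
  split_ifs
  · exact μ.2.1
  · exact sub_nonneg.2 μ.2.2

theorem sum_instMass (μ : unitInterval) (k n g b : ℕ) : ∑ I : Inst k n g b, instMass μ I = 1 := by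
  have h := expect_bernTable μ (k := k) (n := n) (g := g) (b := b) fun _ => 1
  rw [expect_const] at h
  simp only [mul_one] at h
  rw [← ENNReal.ofReal_sum_of_nonneg fun I _ => instMass_nonneg μ I] at h
  have := congrArg ENNReal.toReal h
  rw [ENNReal.toReal_ofReal (Finset.sum_nonneg fun I _ => instMass_nonneg μ I)] at this
  simpa using this.symm

/-- The error of the oracle on average, in terms of its success probability. -/
theorem sum_oracleErr_le {μ : unitInterval} {k n g b : ℕ} {f : (Fin k → Fin b → Bool) → Bool}
    {D : Inst k n g b → PMF (Store × ℕ)} {p : ℝ}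
    (hp : p ≤ ∑ I, instMass μ I * successProb (D I) (count f I)) :
    ∑ I, ENNReal.ofReal (instMass μ I) * oracleErr f (fun I => (D I).map fun r => r.1 2 0) I ≤
      ENNReal.ofReal (1 - p) := by
  have h : ∀ I, ENNReal.ofReal (instMass μ I) *
      oracleErr f (fun I => (D I).map fun r => r.1 2 0) I =
      ENNReal.ofReal (instMass μ I * (1 - successProb (D I) (count f I))) := by
    intro I
    rw [oracleErr, expect_map, expect_wrong_output, ENNReal.ofReal_mul (instMass_nonneg μ I)]
  rw [Finset.sum_congr rfl fun I _ => h I, ← ENNReal.ofReal_sum_of_nonneg fun I _ =>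
    mul_nonneg (instMass_nonneg μ I) (sub_nonneg.2 (successProb_le_one _ _))]
  refine ENNReal.ofReal_le_ofReal ?_
  simp only [mul_sub, mul_one, Finset.sum_sub_distrib, sum_instMass]
  linarith

/-- A program that simulates a probabilistic computation `M` of its output errs as often as `M`. -/
theorem SimC.expect_wrong_output_le {c : Cmd} {s : Store} {B N : ℕ} {M : PMF ℕ}
    (h : Sim c s B M fun s' v => s' 2 0 = v) :
    ∃ D, Runs c s D ∧ (∀ r ∈ D.support, r.2 ≤ B) ∧
      ENNReal.ofReal (1 - successProb D N) = expect M fun v => if v = N then 0 else 1 := by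
  obtain ⟨J, h1, rfl, h3⟩ := h
  refine ⟨J.map Prod.fst, h1, ?_, ?_⟩
  · intro r hr
    obtain ⟨p, hp, rfl⟩ := (PMF.mem_support_map_iff _ _ _).1 hr
    exact (h3 p hp).1
  · rw [← expect_wrong_output, expect_map, expect_map]
    refine le_antisymm (expect_mono fun p hp => ?_) (expect_mono fun p hp => ?_) <;>
      rw [(h3 p hp).2]

/-- A trial fails with probability at most `1 / 10`: each query is wrong with at most twice the error
`1 - p` of the oracle. -/
theorem expect_trial_le_tenth {μ : unitInterval} {k n g b m sz : ℕ} (hm : EnoughPairs μ m)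
    (hsz : 0 < sz) {f : (Fin k → Fin b → Bool) → Bool} {D : Inst k n g b → PMF (Store × ℕ)}
    {p c : ℝ} (hp : p ≤ ∑ I, instMass μ I * successProb (D I) (count f I))
    (hc1 : 1 ≤ c) (hc : ∀ v, bernMass μ v + 2 / 2 ^ sz ≤ c * bernMass μ v)
    (hcN : c ^ numVars k n g b ≤ 2)
    (ht : ((2 * m * sz : ℕ) : ℝ) ^ (g * k) * (2 * (1 - p)) ≤ 1 / 10) (I : Inst k n g b) :
    expect (trial μ m sz (fun I => (D I).map fun r => r.1 2 0) (instBits I))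
      (fun v => if v = count f I then 0 else 1) ≤ 10⁻¹ := by
  have hc0 : 0 ≤ c := zero_le_one.trans hc1
  refine (expect_trial_le (c := ENNReal.ofReal c) hm hsz f _ I fun v => ?_).trans ?_
  · rw [bern_apply, ← ENNReal.ofReal_mul hc0]
    exact ENNReal.ofReal_le_ofReal (hc v)
  calc _ ≤ (((2 * m * sz) ^ (g * k) : ℕ) : ENNReal) * (ENNReal.ofReal 2 *
        ENNReal.ofReal (1 - p)) := by
        rw [← ENNReal.ofReal_pow hc0]
        gcongr
        exact sum_oracleErr_le hp
    _ = ENNReal.ofReal (((2 * m * sz : ℕ) : ℝ) ^ (g * k) * (2 * (1 - p))) := by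
        rw [ENNReal.ofReal_mul (by positivity), ENNReal.ofReal_mul (by norm_num), ← Nat.cast_pow,
          ENNReal.ofReal_natCast]
    _ ≤ ENNReal.ofReal (1 / 10) := ENNReal.ofReal_le_ofReal ht
    _ = 10⁻¹ := by
        rw [one_div, ENNReal.ofReal_inv_of_pos (by norm_num)]
        norm_num

theorem exists_isCoin {coins : Set ℝ} {μ : unitInterval} (h0 : (0 : ℝ) < μ) (h1 : (μ : ℝ) < 1)
    (h : (μ : ℝ) ∈ coins ∨ (μ : ℝ) ∈ Set.range ((↑) : ℚ → ℝ)) :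
    ∃ c w, IsCoin μ c w ∧ c.UsesCoins coins := by
  rcases h with h | ⟨x, hx⟩
  · exact ⟨_, _, isCoin_flip μ, h⟩
  · have hx0 : 0 < x := by rw [← hx] at h0; exact_mod_cast h0
    have hx1 : x < 1 := by rw [← hx] at h1; exact_mod_cast h1
    have hnum : ((x.num.toNat : ℕ) : ℤ) = x.num := Int.toNat_of_nonneg (Rat.num_nonneg.2 hx0.le)
    have hle : x.num.toNat ≤ x.den := by
      have := Rat.num_lt_denom_iff.2 hx1
      omega
    have hμ : (μ : ℝ) = (x.num.toNat : ℕ) / (x.den : ℕ) := by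
      rw [← hx, Rat.cast_def, ← hnum]
      rfl
    obtain ⟨w, hw⟩ := isCoin_rand μ x.den_pos hle hμ
    exact ⟨_, w, hw, ⟨trivial, trivial⟩⟩

theorem worstCaseSolvable_of_avgCaseSolvable {k : ℕ} (hk : 0 < k) {g b : ℕ → ℕ}
    (hg_pos : ∀ n, 0 < g n)
    (hg : (fun n : ℕ => (g n : ℝ)) =o[atTop]
      fun n : ℕ => Real.logb 2 n / Real.logb 2 (Real.logb 2 n))
    (hb : (fun n : ℕ => (b n : ℝ)) =o[atTop] fun n : ℕ => Real.logb 2 n)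
    {coins : Set ℝ} {T : ℕ → ℕ} (hT : ∀ᶠ n : ℕ in atTop, n ≤ T n) {f : FunFamily k b}
    {μ : ℝ} (h0 : 0 < μ) (h1 : μ < 1) (hμ : μ ∈ coins ∨ μ ∈ Set.range ((↑) : ℚ → ℝ))
    (h : AvgCaseSolvable coins g b f μ T (threshold k g)) :
    WorstCaseSolvableSoftO coins g b f T := by
  classical
  obtain ⟨P, D, hP, hrun, havg⟩ := h
  lift μ to unitInterval using ⟨h0.le, h1.le⟩
  obtain ⟨m, hm⟩ := exists_enoughPairs h0 h1
  obtain ⟨coinCmd, w, hcoin, hcoins⟩ := exists_isCoin h0 h1 hμ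
  have hm0 : 0 < m := lt_of_lt_of_le two_pos hm.two_le
  have hgS := softO_levels hg
  have hbS := softO_two_pow hb
  have hT1 : ∀ᶠ n in atTop, 1 ≤ T n := by
    filter_upwards [hT, eventually_ge_atTop 1] with n hn hn1
    exact hn1.trans hn
  set T' : ℕ → ℕ := fun n => solverCost w k m (n ^ 3).size (g n * k) (numVars k n (g n) (b n))
    ((n ^ 3).size * (g n * k + 1) + 1)
    (stripeFactor ((n ^ 3).size * (n ^ 3).size * (2 * m * (n ^ 3).size) ^ (g n * k)) * T n)
    with hT'
  set Good : ∀ n, Inst k n (g n) (b n) → PMF (Store × ℕ) → Prop := fun n I D' =>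
    Runs (solver coinCmd k m P) (inputStore I) D' ∧ (∀ r ∈ D'.support, r.2 ≤ T' n) ∧
      1 - (2 : ℝ) ^ (-(Real.logb 2 n) ^ 2) ≤ successProb D' (count (f n) I) with hGood
  have key : ∀ᶠ n in atTop, ∀ I, ∃ D', Good n I D' := by
    filter_upwards [hrun, havg, eventually_sizes hk hm0 hgS hb, eventually_gt_atTop 0,
      tendsto_logb_two.eventually_ge_atTop 0, numVars_le_sq k hgS hbS,
      eventually_queries_mul_le (m := m) hk hg_pos, exists_deviation h0 h1]
      with n hrun havg hsizes hn hL hN hthr hdev I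
    obtain ⟨c, hc1, hc, hcN⟩ := hdev
    obtain ⟨D', h1, h2, h3⟩ := SimC.expect_wrong_output_le (N := count (f n) I)
      (solver_sim hcoin hsizes rfl hrun I)
    refine ⟨D', h1, h2, ?_⟩
    have hvote := expect_vote_le (expect_trial_le_tenth hm hsizes.levels_pos havg hc1 hc
      (hcN _ hN) hthr I) ((n ^ 3).size * (n ^ 3).size)
    rw [expect_map] at h3
    rw [← h3] at hvote
    have h710 : (2⁻¹ + 10⁻¹ * 2 : ENNReal) = ENNReal.ofReal (7 / 10) := by
      rw [show (7 / 10 : ℝ) = 2⁻¹ + 10⁻¹ * 2 by norm_num, ENNReal.ofReal_add (by norm_num)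
        (by norm_num), ENNReal.ofReal_mul (by norm_num), ENNReal.ofReal_inv_of_pos (by norm_num),
        ENNReal.ofReal_inv_of_pos (by norm_num)]
      norm_num
    rw [h710, ← ENNReal.ofReal_pow (by norm_num), ENNReal.ofReal_le_ofReal_iff (by positivity)]
      at hvote
    linarith [seven_tenths_pow_le hn hL]
  have hchoice : ∀ n I, ∃ D', (∃ D'', Good n I D'') → Good n I D' := by
    intro n I
    by_cases h : ∃ D'', Good n I D''
    · exact ⟨h.choose, fun _ => h.choose_spec⟩
    · exact ⟨PMF.pure (fun _ _ => 0, 0), fun h' => absurd h' h⟩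
  choose D' hD' using hchoice
  refine ⟨solver coinCmd k m P, T', D', solver_usesCoins hcoins hP k m, ?_, ?_, ?_⟩
  · filter_upwards [key] with n hn I
    exact ⟨(hD' n I (hn I)).1, (hD' n I (hn I)).2.1⟩
  · have hd : SoftO (fun _ => 1) fun n => g n * k := hgS.mul (SoftO.const k)
    have hN : SoftO T fun n => numVars k n (g n) (b n) := by
      have hn : SoftO T fun n => k * g n * 2 ^ b n * n :=
        (((SoftO.const k).mul hgS).mul hbS).mul ((SoftO.self T).mono hT)
      refine hn.mono (Eventually.of_forall fun n => le_of_eq ?_)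
      unfold numVars
      ring
    exact softO_solverCost w k m hT1 softO_size hd
      ((softO_size.mul (hd.add (SoftO.const 1))).add (SoftO.const 1)) (softO_queries m k hg) hN
  · filter_upwards [key] with n hn I
    exact (hD' n I (hn I)).2.2

theorem instMass_half {k n g b : ℕ} (I : Inst k n g b) :
    instMass (1 / 2) I = 1 / (Fintype.card (Inst k n g b) : ℝ) := by
  have h : ∀ p : Prop, ∀ _ : Decidable p, (if p then (1 / 2 : ℝ) else 1 - 1 / 2) = 2⁻¹ := by
    intro p _
    split_ifs <;> norm_num
  simp only [instMass, vectorMass, setMass, h, Finset.prod_const, Finset.card_univ]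
  simp [Fintype.card_finset, inv_pow]

end FactoredAvg

theorem mainTheorem2 (k : ℕ) (hk : 2 ≤ k) (g b : ℕ → ℕ)
    (hg_pos : ∀ n, 0 < g n) (hb_pos : ∀ n, 0 < b n)
    (hg : (fun n : ℕ => (g n : ℝ)) =o[atTop]
      fun n : ℕ => Real.logb 2 n / Real.logb 2 (Real.logb 2 n))
    (hb : (fun n : ℕ => (b n : ℝ)) =o[atTop] fun n : ℕ => Real.logb 2 n)
    (coins : Set ℝ) (T : ℕ → ℕ) (hT : ∀ᶠ n : ℕ in atTop, n ≤ T n) :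
    (∀ (f : FactoredAvg.FunFamily k b) (μ : ℝ), 0 < μ → μ < 1 →
      (μ ∈ coins ∨ μ ∈ Set.range ((↑) : ℚ → ℝ)) →
      FactoredAvg.AvgCaseSolvable coins g b f μ T (FactoredAvg.threshold k g) →
      FactoredAvg.WorstCaseSolvableSoftO coins g b f T) ∧
    (∀ (n : ℕ) (I : FactoredAvg.Inst k n (g n) (b n)),
      FactoredAvg.instMass (1 / 2) I =
        1 / (Fintype.card (FactoredAvg.Inst k n (g n) (b n)) : ℝ)) ∧
    (∀ F : ∀ m : ℕ, (Fin k → Fin m → Bool) → Bool,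
      (F = FactoredAvg.orthogonalTuple k ∨ F = FactoredAvg.zeroSum k ∨
        F = FactoredAvg.sumToLast k ∨ F = FactoredAvg.zeroXor k) →
      FactoredAvg.AvgCaseSolvable coins g b (fun n => F (b n)) (1 / 2) T
        (FactoredAvg.threshold k g) →
      FactoredAvg.WorstCaseSolvableSoftO coins g b (fun n => F (b n)) T) := by
  have hk0 : 0 < k := lt_of_lt_of_le two_pos hk
  refine ⟨fun f μ h0 h1 hμ h => ?_, fun n I => FactoredAvg.instMass_half I, fun F _ h => ?_⟩
  · exact FactoredAvg.worstCaseSolvable_of_avgCaseSolvable hk0 hg_pos hg hb hT h0 h1 hμ h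
  · exact FactoredAvg.worstCaseSolvable_of_avgCaseSolvable hk0 hg_pos hg hb hT (by norm_num)
      (by norm_num) (Or.inr ⟨1 / 2, by norm_num⟩) h
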